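/- Let $H$ be a separable real Hilbert space (for instance $H=L^2([0,1])$), with Hilbert–Schmidt norm $\|\Psi\|_{HS}=(\sum_i\|\Psi e_i\|^2)^{1/2}$, $(e_i)$ any orthonormal basis, and write $f\otimes g=\langle f,\cdot\rangle g$. **Process.** Let $(Y_t)_{t\in\mathbb Z}$ be $H$-valued random variables on a probability space with $\mathbb E Y_t=0$, $\mathbb E\|Y_0\|^2<\infty$ and $Y_t=f(\delta_t,\delta_{t-1},\dots)$ almost surely, where $(\delta_t)_{t\in\mathbb Z}$ are i.i.d. with values in a measurable space $S$ and $f:S^{\infty}\to H$ is measurable. For $m\ge 0$ let $Y_{t,m}=f(\delta_t,\dots,\delta_{t-m+1},\delta'_{t-m},\delta'_{t-m-1},\dots)$, where $(\delta'_s)_s$ is an independent copy of $(\delta_s)_s$. Assume that for every $t$ $$\sum_{m\ge1}\sqrt{\mathbb E\|Y_t-Y_{t,m}\|^2}<\infty\quad\text{and}\quad \lim_{m\to\infty}m\sqrt{\mathbb E\|Y_t-Y_{t,m}\|^2}=0 .$$ **Windows.** Let $w:\mathbb R\to[0,1]$ vanish outside $[0,1]$, be positive in a neighbourhood of $1/2$,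 symmetric around $1/2$, and nondecreasing on $[0,1/2]$. Put $w_b(t)=w((t-\tfrac12)/b)$ for $1\le t\le b$ and $\|w_b\|_2=(\sum_{t=1}^b w_b(t)^2)^{1/2}$. **Tapered block bootstrap.** Let the sample size be $n=kb$ with integers $k$ and $1\le b<n$, let $\overline Y_n=n^{-1}\sum_{t=1}^nY_t$, $X_t=Y_t-\overline Y_n$ and $N=n-b+1$. Let $I_1,\dots,I_k$ be i.i.d. uniform on $\{1,\dots,N\}$, independent of the data $\mathbf Y_n=(Y_1,\dots,Y_n)$. The pseudo-observations $X_1^*,\dots,X_n^*$ are $$X^*_{(i-1)b+s}=w_b(s)\,\frac{b^{1/2}}{\|w_b\|_2}\,X_{I_i+s-1},\qquad 1\le i\le k,\ 1\le s\le b .$$ Let $\overline X_n^*=n^{-1}\sum_{t=1}^nX_t^*$, and let $\mathbb E^*$ and $\mathcal L(\,\cdot\mid\mathbf Y_n)$ denote expectation and law conditional on $\mathbf Y_n$. **Theorem.** Let $n\to\infty$ along a sequence of sample sizes $n=kb$ with $b=b(n)$ and $k=k(n)$ as above such that $b^{-1}+bn^{-1/2}\to0$. Then: (i) for every metric $d$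 on the Borel probability measures on $H$ that metrizes weak convergence, $$d\big(\mathcal L(\sqrt n(\overline X_n^*-\mathbb E^*\overline X_n^*)\mid\mathbf Y_n),\ \mathcal L(\sqrt n\,\overline Y_n)\big)\to0\quad\text{in probability};$$ (ii) $$\big\|n\,\mathbb E^*\big[(\overline X_n^*-\mathbb E^*\overline X_n^*)\otimes(\overline X_n^*-\mathbb E^*\overline X_n^*)\big]-n\,\mathbb E(\overline Y_n\otimes\overline Y_n)\big\|_{HS}\to0\quad\text{in probability}.$$ -/

import Mathlib

open MeasureTheory ProbabilityTheory Filter Topology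
open scoped ENNReal

namespace TBB

/-! ### Weak dependence -/

section Dependence

variable {Ω S H : Type*} [MeasurableSpace Ω] [MeasurableSpace S]
  [NormedAddCommGroup H] [MeasurableSpace H]

/-- The value `f (δ_t, δ_{t-1}, δ_{t-2}, …)` of a causal functional of the innovations. -/
def causal (f : (ℕ → S) → H) (δ : ℤ → Ω → S) (t : ℤ) (ω : Ω) : H :=
  f fun j => δ (t - (j : ℤ)) ω

/-- The coupled variable
`X_{t,m} = f (δ_t, …, δ_{t-m+1}, δ'_{t-m}, δ'_{t-m-1}, …)`, realised on `Ω × Ω`: the original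
innovations are read off the first coordinate, and their independent copies `δ'` are the
same innovations read off the second coordinate. Under the product measure `P.prod P` the family
`δ'` is independent of, and distributed as, the original family. -/
def coupled (f : (ℕ → S) → H) (δ : ℤ → Ω → S) (m : ℕ) (t : ℤ) (p : Ω × Ω) : H :=
  f fun j => if j < m then δ (t - (j : ℤ)) p.1 else δ (t - (j : ℤ)) p.2

/-- The approximation error `√(E ‖X_t - X_{t,m}‖²)`. -/
noncomputable def approxError (P : Measure Ω) (f : (ℕ → S) → H) (δ : ℤ → Ω → S)
    (m : ℕ) (t : ℤ) : ℝ :=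
  √(∫ p, ‖causal f δ t p.1 - coupled f δ m t p‖ ^ 2 ∂(P.prod P))

/-- `X` is `L²`-`m`-approximable, with measurable functional `f` and i.i.d. innovations `δ`. -/
structure IsL2mApproximable (P : Measure Ω) (X : ℤ → Ω → H) (f : (ℕ → S) → H)
    (δ : ℤ → Ω → S) : Prop where
  measurable_f : Measurable f
  measurable_innov : ∀ t, Measurable (δ t)
  indep_innov : iIndepFun δ P
  ident_innov : ∀ t, IdentDistrib (δ t) (δ 0) P P
  representation : ∀ t, X t =ᵐ[P] causal f δ t
  memLp : MemLp (X 0) 2 P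
  summable_approx : ∀ t, Summable fun m : ℕ => approxError P f δ (m + 1) t

/-- The strengthened weak dependence condition: `L²`-`m`-approximability together with
`m √(E ‖X_t - X_{t,m}‖²) → 0`. -/
structure StronglyApproximable (P : Measure Ω) (X : ℤ → Ω → H) (f : (ℕ → S) → H)
    (δ : ℤ → Ω → S) : Prop extends IsL2mApproximable P X f δ where
  rate : ∀ t, Tendsto (fun m : ℕ => (m : ℝ) * approxError P f δ m t) atTop (𝓝 0)

end Dependence

/-! ### Data-tapering windows -/

/-- Conditions on the function `w` that generates the windows `w_n(t) = w ((t - 1/2) / n)`. -/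
structure IsTaper (w : ℝ → ℝ) : Prop where
  mem_Icc : ∀ τ, w τ ∈ Set.Icc (0 : ℝ) 1
  eq_zero : ∀ τ, τ ∉ Set.Icc (0 : ℝ) 1 → w τ = 0
  pos_near_half : ∀ᶠ τ in 𝓝 (1 / 2 : ℝ), 0 < w τ
  symm : ∀ τ, w (1 - τ) = w τ
  mono : MonotoneOn w (Set.Icc 0 (1 / 2))

/-- The data-tapering window `w_n(t) = w ((t - 1/2) / n)`. -/
noncomputable def window (w : ℝ → ℝ) (n t : ℕ) : ℝ := w (((t : ℝ) - 1 / 2) / n)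

/-- `‖w_n‖₂ = (∑_{t=1}^n w_n(t)²)^{1/2}`. -/
noncomputable def windowNorm (w : ℝ → ℝ) (n : ℕ) : ℝ :=
  √(∑ t ∈ Finset.Icc 1 n, window w n t ^ 2)

section Hilbert

variable {H : Type*} [NormedAddCommGroup H] [InnerProductSpace ℝ H]

/-! ### Tensor products of vectors and the Hilbert–Schmidt norm -/

/-- `f ⊗ g = ⟨f, ·⟩ g`. -/
noncomputable def tensor (f g : H) : H →L[ℝ] H := InnerProductSpace.rankOne ℝ g f

/-- The Hilbert–Schmidt norm `(∑_i ‖Ψ e_i‖²)^{1/2}` of an operator, computed in an orthonormal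
basis `e`; it is `∞` if the operator is not Hilbert–Schmidt. -/
noncomputable def hsNorm {ι : Type*} (e : HilbertBasis ι ℝ H) (Ψ : H →L[ℝ] H) : ℝ≥0∞ :=
  (∑' i, ‖Ψ (e i)‖ₑ ^ 2) ^ (1 / 2 : ℝ)

/-! ### The tapered block bootstrap for observations `y 1, …, y n`, where `n = k * b` -/

/-- The sample mean `n⁻¹ ∑_{t=1}^n y_t`. -/
noncomputable def sampleMean (n : ℕ) (y : ℕ → H) : H :=
  (n : ℝ)⁻¹ • ∑ t ∈ Finset.Icc 1 n, y t

/-- The centered observations `x_t = y_t - ȳ_n`. -/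
noncomputable def centered (n : ℕ) (y : ℕ → H) (t : ℕ) : H := y t - sampleMean n y

/-- The number `N = n - b + 1` of available blocks. -/
abbrev numBlocks (n b : ℕ) : ℕ := n - b + 1

/-- Entry number `r + 1` of the tapered block number `i + 1` (`r < b`, `i < N`):
`w_b(r+1) (b^{1/2} / ‖w_b‖₂) x_{(i+1)+r}`. -/
noncomputable def taperedBlock (w : ℝ → ℝ) (n b : ℕ) (y : ℕ → H)
    (i : Fin (numBlocks n b)) (r : Fin b) : H :=
  (window w b (r + 1) * (√b / windowNorm w b)) • centered n y ((i : ℕ) + 1 + r)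

/-- Choice of `k` block numbers (shifted by one, so in `{0, …, N-1}`). -/
abbrev Draw (k b : ℕ) : Type := Fin k → Fin (numBlocks (k * b) b)

/-- The law of the `k` block numbers: independent, each uniform on the `N` possible values. -/
noncomputable def drawLaw (k b : ℕ) : ProbabilityMeasure (Draw k b) :=
  ⟨Measure.pi fun _ => (PMF.uniformOfFintype (Fin (numBlocks (k * b) b))).toMeasure,
    inferInstance⟩

/-- The pseudo-observations `x*_1, …, x*_n`, `n = k * b`: the selected blocks joined in the order
of selection. Position `s` (counted from `0`) is entry `s % b` of the block drawn at step
`s / b`. -/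
noncomputable def pseudoObs (w : ℝ → ℝ) (k b : ℕ) (y : ℕ → H) (I : Draw k b)
    (s : Fin (k * b)) : H :=
  taperedBlock w (k * b) b y (I s.divNat) s.modNat

/-- The bootstrap sample mean `n⁻¹ ∑_{t=1}^n x*_t`. -/
noncomputable def bootMean (w : ℝ → ℝ) (k b : ℕ) (y : ℕ → H) (I : Draw k b) : H :=
  ((k * b : ℕ) : ℝ)⁻¹ • ∑ s, pseudoObs w k b y I s

/-- The bootstrap sample mean minus its expectation `E*` given the observations. -/
noncomputable def bootDev (w : ℝ → ℝ) (k b : ℕ) (y : ℕ → H) (I : Draw k b) : H :=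
  bootMean w k b y I - ∫ J, bootMean w k b y J ∂(drawLaw k b : Measure (Draw k b))

/-- The bootstrap covariance operator `n E* [(x̄* - E* x̄*) ⊗ (x̄* - E* x̄*)]`. -/
noncomputable def bootCov (w : ℝ → ℝ) (k b : ℕ) (y : ℕ → H) : H →L[ℝ] H :=
  ((k * b : ℕ) : ℝ) •
    ∫ I, tensor (bootDev w k b y I) (bootDev w k b y I) ∂(drawLaw k b : Measure (Draw k b))

/-- The conditional law of `√n (x̄* - E* x̄*)` given the observations `y`. -/
noncomputable def bootLaw [MeasurableSpace H] (w : ℝ → ℝ) (k b : ℕ) (y : ℕ → H) :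
    ProbabilityMeasure H :=
  (drawLaw k b).map (f := fun I => √((k * b : ℕ) : ℝ) • bootDev w k b y I)
    (Measurable.of_discrete).aemeasurable

/-! ### The sample mean of a process -/

section Series

variable {Ω : Type*} [MeasurableSpace Ω]

/-- The observed stretch at the sample point `ω`. -/
def obs (Y : ℤ → Ω → H) (ω : Ω) (t : ℕ) : H := Y (t : ℤ) ω

/-- The covariance operator `n E (Ȳ_n ⊗ Ȳ_n)`. -/
noncomputable def meanCov (P : Measure Ω) (Y : ℤ → Ω → H) (n : ℕ) : H →L[ℝ] H :=
  (n : ℝ) • ∫ ω, tensor (sampleMean n (obs Y ω)) (sampleMean n (obs Y ω)) ∂P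

variable [MeasurableSpace H] [BorelSpace H] [SecondCountableTopology H]

theorem measurable_scaledMean {Y : ℤ → Ω → H} (hY : ∀ t, Measurable (Y t)) (n : ℕ) :
    Measurable fun ω => √(n : ℝ) • sampleMean n (obs Y ω) := by
  have h : Measurable fun ω => ∑ t ∈ Finset.Icc 1 n, obs Y ω t :=
    Finset.measurable_sum _ fun t _ => hY t
  exact (h.const_smul ((n : ℝ)⁻¹)).const_smul (√(n : ℝ))

/-- The law of `√n Ȳ_n`. -/
noncomputable def meanLaw (P : Measure Ω) [IsProbabilityMeasure P] (Y : ℤ → Ω → H)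
    (hY : ∀ t, Measurable (Y t)) (n : ℕ) : ProbabilityMeasure H :=
  ProbabilityMeasure.map (⟨P, inferInstance⟩ : ProbabilityMeasure Ω)
    (f := fun ω => √(n : ℝ) • sampleMean n (obs Y ω)) (measurable_scaledMean hY n).aemeasurable

end Series

end Hilbert

/-! ### Metrics for weak convergence -/

/-- `d` is a metric on the Borel probability measures of `H` that metrizes weak convergence. -/
structure MetrizesWeakConvergence {H : Type*} [TopologicalSpace H] [MeasurableSpace H]
    [OpensMeasurableSpace H]
    (d : ProbabilityMeasure H → ProbabilityMeasure H → ℝ) : Prop where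
  eq_zero_iff : ∀ μ ν, d μ ν = 0 ↔ μ = ν
  symm : ∀ μ ν, d μ ν = d ν μ
  triangle : ∀ μ ν ρ, d μ ρ ≤ d μ ν + d ν ρ
  tendsto_iff : ∀ (u : ℕ → ProbabilityMeasure H) (μ : ProbabilityMeasure H),
    Tendsto (fun n => d (u n) μ) atTop (𝓝 0) ↔ Tendsto u atTop (𝓝 μ)

end TBB

set_option linter.unusedSectionVars false

namespace TBB

/-! ### Second moments of weighted sums -/

section SecondMoments

variable {α H : Type*} [MeasurableSpace α] {μ : Measure α} [NormedAddCommGroup H]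

/-! The scaled sample mean and every normalized tapered block sum are weighted sums `∑ a_t Y_t` with
`∑ a_t² ≤ 1`. If a process `V` satisfies `E‖∑ a_t (Y_t - V_t)‖² ≤ η ∑ a_t²` for all finite families
of weights (`SumBound`), then replacing `Y` by `V` costs at most `η` in mean square, uniformly in
the sample size and the block length. The bootstrap inherits this: its scaled deviation is
`k^{-1/2}` times a sum of `k` conditionally independent centered block sums (`scaled_bootDev_eq`),
so its conditional second moment is at most the average of the squared block norms
(`integral_bootSq_le`).

A suitable `V` has the form `∑_q ψ_q(δ_t, …, δ_{t-m+1}) x_q` with finitely many bounded centered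
`ψ_q`. It arises in two steps. Averaging over all but the last `m` innovations leaves an error whose
covariance at lag `d` is at most `ρ(m)²` for `d ≤ m` and `ρ(m) ρ(d)` for `d > m`, where `ρ` is the
coupling error. The total `(m + 1) ρ(m)² + ρ(m) ∑ ρ` is small by weak dependence
(`exists_integral_sub_project_le`). The resulting functional of `m` innovations is then approximated
by a centered simple function (`exists_finite_range_approx_recent`).

For `V` everything reduces to real series. Windows have bounded variation and diverging norm, so
their autocorrelation at each fixed lag tends to one; tapered block sums and the scaled mean
therefore share one limiting variance. The bootstrap variance is an average of squared block sums
minus a squared average. Blocks at distance `b + m` are independent and fourth moments are bounded,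
so it converges in mean (`tendsto_integral_abs_bootVar_sub`). Polarization gives covariances.
Expanding characteristic functions then yields the same Gaussian limit for both laws: the bootstrap
summands are bounded by a multiple of `√b / √k = b / √n`, and the sample mean is cut into long
blocks separated by gaps of length `m`.

The operator statement follows by comparing second moment operators of `Y` and `V`. The statement
about laws is first proved for the Lévy–Prokhorov distance. A general metric for weak convergence
need not be uniformly comparable with it, so the last step uses tightness of the laws of the means:
along a subsequence these converge, the bootstrap laws converge almost surely to the same limit, and
any such metric sees both convergences. -/

lemma integrable_norm_sq {X : α → H} (hX : MemLp X 2 μ) : Integrable (fun a => ‖X a‖ ^ 2) μ :=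
  (memLp_two_iff_integrable_sq_norm hX.1).1 hX

lemma integral_norm_mul_norm_le {X : α → H} {G : Type*} [NormedAddCommGroup G] {Y : α → G}
    (hX : MemLp X 2 μ) (hY : MemLp Y 2 μ) :
    ∫ a, ‖X a‖ * ‖Y a‖ ∂μ ≤ √(∫ a, ‖X a‖ ^ 2 ∂μ) * √(∫ a, ‖Y a‖ ^ 2 ∂μ) := by
  have h := integral_mul_le_Lp_mul_Lq_of_nonneg (μ := μ) Real.HolderConjugate.two_two
    (f := fun a => ‖X a‖) (g := fun a => ‖Y a‖) (ae_of_all _ fun _ => norm_nonneg _)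
    (ae_of_all _ fun _ => norm_nonneg _) (by simpa using hX.norm) (by simpa using hY.norm)
  simpa [Real.sqrt_eq_rpow] using h

lemma integrable_norm_mul_norm {X : α → H} {G : Type*} [NormedAddCommGroup G] {Y : α → G}
    (hX : MemLp X 2 μ) (hY : MemLp Y 2 μ) : Integrable (fun a => ‖X a‖ * ‖Y a‖) μ :=
  MemLp.integrable_mul hX.norm hY.norm

lemma integral_norm_add_sq_le {X Y : α → H} (hX : MemLp X 2 μ) (hY : MemLp Y 2 μ) :
    ∫ a, ‖X a + Y a‖ ^ 2 ∂μ ≤ 2 * ∫ a, ‖X a‖ ^ 2 ∂μ + 2 * ∫ a, ‖Y a‖ ^ 2 ∂μ := by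
  rw [← integral_const_mul, ← integral_const_mul, ← integral_add
    ((integrable_norm_sq hX).const_mul _) ((integrable_norm_sq hY).const_mul _)]
  refine integral_mono (integrable_norm_sq (hX.add hY))
    (((integrable_norm_sq hX).const_mul _).add ((integrable_norm_sq hY).const_mul _)) fun a => ?_
  have h := norm_add_le (X a) (Y a)
  have h2 := pow_le_pow_left₀ (norm_nonneg _) h 2
  dsimp only [Pi.add_apply]
  nlinarith [sq_nonneg (‖X a‖ - ‖Y a‖)]

variable [InnerProductSpace ℝ H]

lemma integrable_inner {X Y : α → H} (hX : MemLp X 2 μ) (hY : MemLp Y 2 μ) :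
    Integrable (fun a => inner ℝ (X a) (Y a)) μ :=
  (integrable_norm_mul_norm hX hY).mono' (hX.1.inner hY.1)
    (ae_of_all _ fun _ => norm_inner_le_norm _ _)

lemma abs_integral_inner_le {X Y : α → H} (hX : MemLp X 2 μ) (hY : MemLp Y 2 μ) :
    |∫ a, inner ℝ (X a) (Y a) ∂μ| ≤ √(∫ a, ‖X a‖ ^ 2 ∂μ) * √(∫ a, ‖Y a‖ ^ 2 ∂μ) := by
  refine (abs_integral_le_integral_abs).trans (le_trans ?_ (integral_norm_mul_norm_le hX hY))
  exact integral_mono (integrable_inner hX hY).abs (integrable_norm_mul_norm hX hY)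
    fun _ => abs_real_inner_le_norm _ _

lemma norm_integral_smul_sq_le {X : α → ℝ} {Y : α → H} (hX : MemLp X 2 μ) (hY : MemLp Y 2 μ) :
    ‖∫ a, X a • Y a ∂μ‖ ^ 2 ≤ (∫ a, X a ^ 2 ∂μ) * ∫ a, ‖Y a‖ ^ 2 ∂μ := by
  have h1 : ‖∫ a, X a • Y a ∂μ‖ ≤ √(∫ a, ‖X a‖ ^ 2 ∂μ) * √(∫ a, ‖Y a‖ ^ 2 ∂μ) := by
    refine (norm_integral_le_integral_norm _).trans ?_
    simp_rw [norm_smul]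
    exact integral_norm_mul_norm_le hX hY
  refine (pow_le_pow_left₀ (norm_nonneg _) h1 2).trans (le_of_eq ?_)
  rw [mul_pow, Real.sq_sqrt (by positivity), Real.sq_sqrt (by positivity)]
  simp

lemma norm_integral_sq_le [IsProbabilityMeasure μ] {X : α → H} (hX : MemLp X 2 μ) :
    ‖∫ a, X a ∂μ‖ ^ 2 ≤ ∫ a, ‖X a‖ ^ 2 ∂μ := by
  simpa using norm_integral_smul_sq_le (X := fun _ => (1 : ℝ)) (memLp_const 1) hX

lemma integral_norm_sq_sum_eq {ι : Type*} (F : Finset ι) (a : ι → ℝ) {X : ι → α → H}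
    (hX : ∀ i ∈ F, MemLp (X i) 2 μ) :
    ∫ x, ‖∑ i ∈ F, a i • X i x‖ ^ 2 ∂μ
      = ∑ i ∈ F, ∑ j ∈ F, a i * a j * ∫ x, inner ℝ (X i x) (X j x) ∂μ := by
  have h : ∀ x, ‖∑ i ∈ F, a i • X i x‖ ^ 2
      = ∑ i ∈ F, ∑ j ∈ F, a i * a j * inner ℝ (X i x) (X j x) := by
    intro x
    rw [← real_inner_self_eq_norm_sq, sum_inner]
    refine Finset.sum_congr rfl fun i _ => ?_
    rw [inner_sum]
    refine Finset.sum_congr rfl fun j _ => ?_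
    rw [real_inner_smul_left, real_inner_smul_right]; ring
  simp_rw [h]
  rw [integral_finsetSum _ fun i hi => integrable_finsetSum _ fun j hj =>
    (integrable_inner (hX i hi) (hX j hj)).const_mul _]
  refine Finset.sum_congr rfl fun i hi => ?_
  rw [integral_finsetSum _ fun j hj => (integrable_inner (hX i hi) (hX j hj)).const_mul _]
  refine Finset.sum_congr rfl fun j hj => ?_
  rw [integral_const_mul]

/-- Since `p` is injective, each lag occurs at most once on either side of `z`; this gives the
factor two. -/
lemma sum_natAbs_sub_le {ι : Type*} (F : Finset ι) {p : ι → ℤ} (hp : Function.Injective p)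
    {r : ℕ → ℝ} (hr0 : ∀ h, 0 ≤ r h) (hr : Summable r) (z : ℤ) :
    ∑ j ∈ F, r (z - p j).natAbs ≤ 2 * ∑' h, r h := by
  classical
  rw [← Finset.sum_filter_add_sum_filter_not F (fun j => p j ≤ z), two_mul]
  refine add_le_add ?_ ?_
  · rw [← Finset.sum_image (s := F.filter fun j => p j ≤ z) (g := fun j => (z - p j).natAbs)
      (f := r)]
    · exact hr.sum_le_tsum _ fun h _ => hr0 h
    · intro i hi j hj hij
      simp only [Finset.coe_filter, Set.mem_ofPred_eq] at hi hj hij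
      exact hp (by omega)
  · rw [← Finset.sum_image (s := F.filter fun j => ¬ p j ≤ z) (g := fun j => (z - p j).natAbs)
      (f := r)]
    · exact hr.sum_le_tsum _ fun h _ => hr0 h
    · intro i hi j hj hij
      simp only [Finset.coe_filter, Set.mem_ofPred_eq] at hi hj hij
      exact hp (by omega)

/-- A weighted sum of square integrable variables with summable covariances has second moment
of the order of the sum of the squared weights. -/
theorem integral_norm_sq_sum_le {ι : Type*} (F : Finset ι) {p : ι → ℤ}
    (hp : Function.Injective p) (a : ι → ℝ) {X : ι → α → H} (hX : ∀ i ∈ F, MemLp (X i) 2 μ)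
    {r : ℕ → ℝ} (hr0 : ∀ h, 0 ≤ r h) (hr : Summable r)
    (hcov : ∀ i ∈ F, ∀ j ∈ F, |∫ x, inner ℝ (X i x) (X j x) ∂μ| ≤ r (p i - p j).natAbs) :
    ∫ x, ‖∑ i ∈ F, a i • X i x‖ ^ 2 ∂μ ≤ 2 * (∑' h, r h) * ∑ i ∈ F, a i ^ 2 := by
  rw [integral_norm_sq_sum_eq F a hX]
  -- Schur test: `|a_i a_j| ≤ (a_i² + a_j²) / 2`, so only the row sums of the covariance bounds
  -- matter.
  have key : ∀ i ∈ F, ∀ j ∈ F, a i * a j * ∫ x, inner ℝ (X i x) (X j x) ∂μ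
      ≤ a i ^ 2 / 2 * r (p i - p j).natAbs + a j ^ 2 / 2 * r (p j - p i).natAbs := by
    intro i hi j hj
    have h1 := hcov i hi j hj
    have h2 : (p j - p i).natAbs = (p i - p j).natAbs := by omega
    rw [h2]
    set c := ∫ x, inner ℝ (X i x) (X j x) ∂μ
    set ρ := r (p i - p j).natAbs
    have h3 : a i * a j * c ≤ |a i| * |a j| * ρ := by
      calc a i * a j * c ≤ |a i * a j * c| := le_abs_self _
        _ = |a i| * |a j| * |c| := by rw [abs_mul, abs_mul]
        _ ≤ _ := by gcongr
    have h4 : |a i| * |a j| ≤ a i ^ 2 / 2 + a j ^ 2 / 2 := by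
      nlinarith [sq_nonneg (|a i| - |a j|), sq_abs (a i), sq_abs (a j)]
    nlinarith [hr0 (p i - p j).natAbs]
  calc _ ≤ ∑ i ∈ F, ∑ j ∈ F,
        (a i ^ 2 / 2 * r (p i - p j).natAbs + a j ^ 2 / 2 * r (p j - p i).natAbs) :=
        Finset.sum_le_sum fun i hi => Finset.sum_le_sum fun j hj => key i hi j hj
    _ = ∑ i ∈ F, a i ^ 2 * ∑ j ∈ F, r (p i - p j).natAbs := by
        simp_rw [Finset.sum_add_distrib]
        rw [Finset.sum_comm (f := fun i j => a j ^ 2 / 2 * r (p j - p i).natAbs),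
          ← Finset.sum_add_distrib]
        refine Finset.sum_congr rfl fun i _ => ?_
        rw [← Finset.mul_sum]; ring
    _ ≤ ∑ i ∈ F, a i ^ 2 * (2 * ∑' h, r h) := by
        gcongr with i hi
        exact sum_natAbs_sub_le F hp hr0 hr (p i)
    _ = _ := by rw [← Finset.sum_mul]; ring

/-- The case of variables that are uncorrelated as soon as their indices differ by at least `L`. -/
theorem integral_norm_sq_sum_le_of_range {ι : Type*} (F : Finset ι) {p : ι → ℤ}
    (hp : Function.Injective p) (a : ι → ℝ) {X : ι → α → H} (hX : ∀ i ∈ F, MemLp (X i) 2 μ)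
    {C : ℝ} (hC : ∀ i ∈ F, ∫ x, ‖X i x‖ ^ 2 ∂μ ≤ C) (L : ℕ)
    (hcov : ∀ i ∈ F, ∀ j ∈ F, p i + L ≤ p j → ∫ x, inner ℝ (X i x) (X j x) ∂μ = 0) :
    ∫ x, ‖∑ i ∈ F, a i • X i x‖ ^ 2 ∂μ ≤ 2 * (L * C) * ∑ i ∈ F, a i ^ 2 := by
  rcases F.eq_empty_or_nonempty with rfl | ⟨i₀, hi₀⟩
  · simp
  have hC0 : 0 ≤ C := (integral_nonneg fun _ => by positivity).trans (hC i₀ hi₀)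
  have hz : ∀ h ∉ Finset.range L, (if h < L then C else 0) = 0 := by
    intro h hh; rw [if_neg (by simpa using hh)]
  -- The covariance bound is `C` at the `L` lags below `L` and zero beyond, with sum `L * C`.
  have h := integral_norm_sq_sum_le F hp a hX (r := fun h => if h < L then C else 0)
    (fun h => by split_ifs <;> simp [hC0]) (summable_of_ne_finset_zero hz)
    (fun i hi j hj => by
      split_ifs with hij
      · refine (abs_integral_inner_le (hX i hi) (hX j hj)).trans ?_
        calc _ ≤ √C * √C := by gcongr; exacts [hC i hi, hC j hj]
          _ = C := Real.mul_self_sqrt hC0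
      · rcases le_total (p i) (p j) with h1 | h1
        · rw [hcov i hi j hj (by omega), abs_zero]
        · simp_rw [real_inner_comm (X j _) (X i _)]
          rw [hcov j hj i hi (by omega), abs_zero])
  rw [tsum_eq_sum hz, Finset.sum_congr rfl (g := fun _ => C)
    (fun h hh => by rw [if_pos (by simpa using hh)])] at h
  simpa using h

end SecondMoments

/-! ### The Hilbert–Schmidt norm -/

section HilbertSchmidt

variable {H : Type*} [NormedAddCommGroup H] [InnerProductSpace ℝ H] {ι : Type*}

/-- Minkowski's inequality in `ℓ²`, read as an `L²` space for the counting measure on the discrete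
index set. -/
lemma hsNorm_add_le (e : HilbertBasis ι ℝ H) (Φ Ψ : H →L[ℝ] H) :
    hsNorm e (Φ + Ψ) ≤ hsNorm e Φ + hsNorm e Ψ := by
  let _ : MeasurableSpace ι := ⊤
  have key : ∀ Θ : H →L[ℝ] H,
      hsNorm e Θ = (∫⁻ i, ‖Θ (e i)‖ₑ ^ (2 : ℝ) ∂Measure.count) ^ (1 / (2 : ℝ)) := by
    intro Θ
    rw [lintegral_count' measurable_from_top]
    simp [hsNorm]
  rw [key, key, key]
  refine le_trans ?_ (ENNReal.lintegral_Lp_add_le (μ := Measure.count) (p := 2)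
    (f := fun i => ‖Φ (e i)‖ₑ) (g := fun i => ‖Ψ (e i)‖ₑ)
    measurable_from_top.aemeasurable measurable_from_top.aemeasurable (by norm_num))
  gcongr with i
  exact enorm_add_le _ _

lemma hsNorm_zero (e : HilbertBasis ι ℝ H) : hsNorm e 0 = 0 := by simp [hsNorm]

lemma hsNorm_sum_le {κ : Type*} (e : HilbertBasis ι ℝ H) (F : Finset κ) (Φ : κ → H →L[ℝ] H) :
    hsNorm e (∑ j ∈ F, Φ j) ≤ ∑ j ∈ F, hsNorm e (Φ j) := by
  classical
  induction F using Finset.induction_on with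
  | empty => simp [hsNorm_zero]
  | insert j F hj ih =>
    rw [Finset.sum_insert hj, Finset.sum_insert hj]
    exact (hsNorm_add_le e _ _).trans (by gcongr)

lemma tensor_apply (f g v : H) : tensor f g v = inner ℝ f v • g := rfl

lemma tensor_smul_smul (c d : ℝ) (f g : H) : tensor (c • f) (d • g) = (c * d) • tensor f g := by
  ext v
  simp only [tensor_apply, smul_apply, real_inner_smul_left, smul_smul]
  ring_nf

lemma tensor_sum_sum {κ : Type*} [Fintype κ] (a b : κ → ℝ) (x : κ → H) :
    tensor (∑ q, a q • x q) (∑ q, b q • x q)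
      = ∑ q, ∑ q', (a q * b q') • tensor (x q) (x q') := by
  simp only [tensor, map_sum, sum_apply, map_smulₛₗ, smul_apply, conj_trivial,
    Finset.smul_sum, smul_smul]
  rw [Finset.sum_comm]
  simp only [RingHom.id_apply]
  exact Finset.sum_comm

variable {α : Type*} [MeasurableSpace α] {μ : Measure α}

lemma continuous_tensor : Continuous fun p : H × H => tensor p.1 p.2 :=
  isBoundedBilinearMap_smulRight.continuous.comp
    (((innerSL ℝ).continuous.comp continuous_fst).prodMk continuous_snd)

lemma integrable_tensor {f g : α → H} (hf : MemLp f 2 μ) (hg : MemLp g 2 μ) :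
    Integrable (fun a => tensor (f a) (g a)) μ := by
  refine (integrable_norm_mul_norm hf hg).mono' ?_ (ae_of_all _ fun a => ?_)
  · exact (continuous_tensor (H := H)).comp_aestronglyMeasurable₂ hf.1 hg.1
  · simp [tensor, mul_comm]

/-- Cauchy–Schwarz inequality for the Hilbert–Schmidt norm of a mixed second moment operator. -/
theorem hsNorm_integral_tensor_le (e : HilbertBasis ι ℝ H) {f g : α → H} (hf : MemLp f 2 μ)
    (hg : MemLp g 2 μ) :
    hsNorm e (∫ a, tensor (f a) (g a) ∂μ)
      ≤ ENNReal.ofReal (√(∫ a, ‖f a‖ ^ 2 ∂μ) * √(∫ a, ‖g a‖ ^ 2 ∂μ)) := by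
  have hi : ∀ i, MemLp (fun a => inner ℝ (f a) (e i)) 2 μ := fun i =>
    hf.inner_const _
  have h1 : ∀ i, ‖(∫ a, tensor (f a) (g a) ∂μ) (e i)‖ₑ ^ 2
      ≤ ENNReal.ofReal ((∫ a, inner ℝ (f a) (e i) ^ 2 ∂μ) * ∫ a, ‖g a‖ ^ 2 ∂μ) := by
    intro i
    rw [ContinuousLinearMap.integral_apply (integrable_tensor hf hg)]
    simp_rw [tensor_apply]
    rw [← ofReal_norm, ← ENNReal.ofReal_pow (norm_nonneg _)]
    exact ENNReal.ofReal_le_ofReal (norm_integral_smul_sq_le (hi i) hg)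
  have h2 : ∑' i, ‖(∫ a, tensor (f a) (g a) ∂μ) (e i)‖ₑ ^ 2
      ≤ ENNReal.ofReal ((∫ a, ‖f a‖ ^ 2 ∂μ) * ∫ a, ‖g a‖ ^ 2 ∂μ) := by
    -- Finite partial sums suffice, and for these Bessel's inequality bounds the squared
    -- coefficients of `f a` by `‖f a‖ ^ 2` under the integral.
    refine ENNReal.summable.tsum_le_of_sum_le fun s => ?_
    refine (Finset.sum_le_sum fun i _ => h1 i).trans ?_
    rw [← ENNReal.ofReal_sum_of_nonneg (fun i _ => by positivity), ← Finset.sum_mul,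
      ← integral_finsetSum _ fun i _ => (hi i).integrable_sq]
    refine ENNReal.ofReal_le_ofReal ?_
    gcongr
    · exact integrable_finsetSum _ fun i _ => (hi i).integrable_sq
    · exact integrable_norm_sq hf
    · intro a
      have := e.orthonormal.sum_inner_products_le (f a) (s := s)
      simpa [real_inner_comm, sq_abs] using this
  unfold hsNorm
  calc _ ≤ (ENNReal.ofReal ((∫ a, ‖f a‖ ^ 2 ∂μ) * ∫ a, ‖g a‖ ^ 2 ∂μ)) ^ (1 / 2 : ℝ) := by
        gcongr
    _ = _ := by
        rw [ENNReal.ofReal_rpow_of_nonneg (by positivity) (by norm_num), ← Real.sqrt_eq_rpow,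
          Real.sqrt_mul (by positivity)]

/-- The deterministic case of the Cauchy–Schwarz bound, for a point mass. -/
lemma hsNorm_tensor_le [CompleteSpace H] (e : HilbertBasis ι ℝ H) (f g : H) :
    hsNorm e (tensor f g) ≤ ENNReal.ofReal (‖f‖ * ‖g‖) := by
  have h := hsNorm_integral_tensor_le (μ := Measure.dirac ()) e
    (f := fun _ => f) (g := fun _ => g) (memLp_const f) (memLp_const g)
  simpa using h

/-- Second moment operators depend continuously on the variable. -/
theorem hsNorm_integral_tensor_sub_le (e : HilbertBasis ι ℝ H) {f g : α → H} (hf : MemLp f 2 μ)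
    (hg : MemLp g 2 μ) {θ : ℝ} (hθ : 0 < θ) :
    hsNorm e (∫ a, tensor (f a) (f a) ∂μ - ∫ a, tensor (g a) (g a) ∂μ)
      ≤ ENNReal.ofReal ((1 + 1 / θ) * (∫ a, ‖f a - g a‖ ^ 2 ∂μ) + θ * ∫ a, ‖f a‖ ^ 2 ∂μ) := by
  have hd : MemLp (fun a => f a - g a) 2 μ := hf.sub hg
  -- `f ⊗ f - g ⊗ g = (f - g) ⊗ f + g ⊗ (f - g)`.
  have h1 : ∫ a, tensor (f a) (f a) ∂μ - ∫ a, tensor (g a) (g a) ∂μ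
      = ∫ a, tensor (f a - g a) (f a) ∂μ + ∫ a, tensor (g a) (f a - g a) ∂μ := by
    rw [← integral_add (integrable_tensor hd hf) (integrable_tensor hg hd),
      ← integral_sub (integrable_tensor hf hf) (integrable_tensor hg hg)]
    congr 1 with a v
    simp [tensor]
  rw [h1]
  refine (hsNorm_add_le e _ _).trans ((add_le_add (hsNorm_integral_tensor_le e hd hf)
    (hsNorm_integral_tensor_le e hg hd)).trans ?_)
  rw [← ENNReal.ofReal_add (by positivity) (by positivity)]
  refine ENNReal.ofReal_le_ofReal ?_
  set A := ∫ a, ‖f a‖ ^ 2 ∂μ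
  set D := ∫ a, ‖f a - g a‖ ^ 2 ∂μ
  have hA : 0 ≤ A := by positivity
  have hD : 0 ≤ D := by positivity
  -- Triangle inequality in `L²`, which removes `g` from the bound in favour of `f` and `f - g`.
  have hg2 : √(∫ a, ‖g a‖ ^ 2 ∂μ) ≤ √A + √D := by
    have : ∫ a, ‖g a‖ ^ 2 ∂μ ≤ (√A + √D) ^ 2 := by
      have h3 := abs_integral_inner_le hf hd
      have h4 : ∫ a, ‖g a‖ ^ 2 ∂μ = A - 2 * (∫ a, inner ℝ (f a) (f a - g a) ∂μ) + D := by
        have h41 : Integrable (fun a => ‖f a‖ ^ 2 - 2 * inner ℝ (f a) (f a - g a)) μ :=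
          (integrable_norm_sq hf).sub ((integrable_inner hf hd).const_mul _)
        rw [← integral_const_mul, ← integral_sub (integrable_norm_sq hf)
          ((integrable_inner hf hd).const_mul _), ← integral_add h41 (integrable_norm_sq hd)]
        congr 1 with a
        rw [← norm_sub_sq_real]; simp
      have h5 := neg_le_of_abs_le h3
      rw [h4]
      nlinarith [Real.sq_sqrt hA, Real.sq_sqrt hD]
    calc _ ≤ √((√A + √D) ^ 2) := Real.sqrt_le_sqrt this
      _ = _ := Real.sqrt_sq (by positivity)
  have h6 : √D * √A + √(∫ a, ‖g a‖ ^ 2 ∂μ) * √D ≤ D + 2 * (√D * √A) := by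
    nlinarith [Real.sq_sqrt hD, Real.sqrt_nonneg D, Real.sqrt_nonneg A]
  refine h6.trans ?_
  -- Young's inequality with parameter `θ`. The product of roots becomes a bound linear in the
  -- second moments, which can later be integrated over the data.
  have h7 : 2 * (√D * √A) ≤ 1 / θ * D + θ * A := by
    have h8 : 0 ≤ (√D - θ * √A) ^ 2 / θ := by positivity
    have h9 : (√D - θ * √A) ^ 2 / θ = 1 / θ * (√D) ^ 2 - 2 * (√D * √A) + θ * (√A) ^ 2 := by
      field_simp; ring
    rw [h9, Real.sq_sqrt hA, Real.sq_sqrt hD] at h8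
    linarith
  linarith

end HilbertSchmidt

/-! ### Fields generated by the innovations -/

section Innovations

variable {Ω S : Type*} [MeasurableSpace Ω] [MeasurableSpace S]

/-- The σ-algebra generated by the innovations with time index in `A`. -/
@[reducible]
def innovField (δ : ℤ → Ω → S) (A : Set ℤ) : MeasurableSpace Ω :=
  ⨆ i ∈ A, MeasurableSpace.comap (δ i) inferInstance

/-- A sequence of independent and identically distributed variables. -/
structure IsIID (P : Measure Ω) (δ : ℤ → Ω → S) : Prop where
  measurable : ∀ t, Measurable (δ t)
  indep : iIndepFun δ P
  ident : ∀ t, IdentDistrib (δ t) (δ 0) P P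

/-- The innovations up to time `t`, in reversed order. -/
def past (δ : ℤ → Ω → S) (t : ℤ) (ω : Ω) : ℕ → S := fun j => δ (t - (j : ℤ)) ω

/-- The last `m` innovations up to time `t`, in reversed order. -/
def recent (δ : ℤ → Ω → S) (m : ℕ) (t : ℤ) (ω : Ω) : Fin m → S := fun j => δ (t - (j : ℤ)) ω

/-- The sequence that starts with `u` and continues with the corresponding entries of `s`. -/
def glue (m : ℕ) (u : Fin m → S) (s : ℕ → S) : ℕ → S :=
  fun j => if h : j < m then u ⟨j, h⟩ else s j

variable {P : Measure Ω} {δ : ℤ → Ω → S}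

lemma innovField_mono {A B : Set ℤ} (h : A ⊆ B) : innovField δ A ≤ innovField δ B :=
  biSup_mono fun _ hi => h hi

lemma measurable_innov_field {A : Set ℤ} {i : ℤ} (hi : i ∈ A) : Measurable[innovField δ A] (δ i) :=
  Measurable.mono (comap_measurable (δ i))
    (le_iSup₂_of_le (f := fun i (_ : i ∈ A) => MeasurableSpace.comap (δ i) inferInstance) i hi
      le_rfl) le_rfl

lemma measurable_recent_field {m : ℕ} {t : ℤ} {A : Set ℤ} (hA : Set.Ioc (t - m) t ⊆ A) :
    Measurable[innovField δ A] (recent δ m t) := by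
  refine @measurable_pi_lambda _ _ _ (innovField δ A) _ _ fun j => ?_
  refine measurable_innov_field (hA ?_)
  have := j.2
  constructor <;> omega

lemma measurable_past_field {t : ℤ} : Measurable[innovField δ (Set.Iic t)] (past δ t) := by
  refine @measurable_pi_lambda _ _ _ (innovField δ (Set.Iic t)) _ _ fun j => ?_
  refine measurable_innov_field ?_
  simp

namespace IsIID

lemma innovField_le (h : IsIID P δ) (A : Set ℤ) : innovField δ A ≤ ‹MeasurableSpace Ω› :=
  iSup₂_le fun i _ => (h.measurable i).comap_le

lemma indepFun (h : IsIID P δ) {A B : Set ℤ} (hAB : Disjoint A B) {β γ : Type*}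
    [MeasurableSpace β] [MeasurableSpace γ] {X : Ω → β} {Y : Ω → γ}
    (hX : Measurable[innovField δ A] X) (hY : Measurable[innovField δ B] Y) : IndepFun X Y P := by
  have h1 : Indep (innovField δ A) (innovField δ B) P :=
    indep_iSup_of_disjoint (fun i => (h.measurable i).comap_le) h.indep hAB
  rw [IndepFun_iff_Indep]
  exact indep_of_indep_of_le_left (indep_of_indep_of_le_right h1 hY.comap_le) hX.comap_le

lemma measurable_recent (h : IsIID P δ) (m : ℕ) (t : ℤ) : Measurable (recent δ m t) :=
  measurable_pi_lambda _ fun _ => h.measurable _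

lemma measurable_past (h : IsIID P δ) (t : ℤ) : Measurable (past δ t) :=
  measurable_pi_lambda _ fun _ => h.measurable _

/-- Independence survives injective reindexing and the marginals agree, so the joint law depends on
the index type alone. The laws of `past` and `recent` and shift invariance are instances. -/
lemma map_reindex (h : IsIID P δ) {κ : Type*} {σ : κ → ℤ} (hσ : Function.Injective σ) :
    P.map (fun ω i => δ (σ i) ω) = Measure.infinitePi fun _ : κ => P.map (δ 0) := by
  have h1 := (h.indep.precomp hσ).map_fun_eq_infinitePi_map fun i => h.measurable (σ i)
  rw [h1]
  congr 1 with i : 1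
  exact (h.ident (σ i)).map_eq

lemma map_past (h : IsIID P δ) (t : ℤ) :
    P.map (past δ t) = Measure.infinitePi fun _ : ℕ => P.map (δ 0) :=
  h.map_reindex (σ := fun j : ℕ => t - (j : ℤ)) fun i j hij => by simpa using hij

lemma map_recent (h : IsIID P δ) (m : ℕ) (t : ℤ) :
    P.map (recent δ m t) = Measure.infinitePi fun _ : Fin m => P.map (δ 0) :=
  h.map_reindex (σ := fun j : Fin m => t - ((j : ℕ) : ℤ)) fun i j hij => by
    simpa [Fin.ext_iff] using hij

/-- The distribution of the innovations is invariant under time shifts. -/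
lemma identDistrib_shift (h : IsIID P δ) {β : Type*} [MeasurableSpace β] {F : (ℤ → S) → β}
    (hF : Measurable F) (t : ℤ) :
    IdentDistrib (fun ω => F fun i => δ (t + i) ω) (fun ω => F fun i => δ i ω) P P := by
  have h1 : IdentDistrib (fun ω (i : ℤ) => δ (t + i) ω) (fun ω (i : ℤ) => δ i ω) P P :=
    ⟨(measurable_pi_lambda _ fun i => h.measurable _).aemeasurable,
      (measurable_pi_lambda _ fun i => h.measurable _).aemeasurable, by
      rw [h.map_reindex (σ := fun i => t + i) (add_right_injective t),
        h.map_reindex (σ := fun i => i) Function.injective_id]⟩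
  exact h1.comp hF

variable [IsProbabilityMeasure P]

/-- Replacing the remote innovations by an independent copy leaves an i.i.d. sequence: a cylinder
event splits into a condition on the first `m` entries, read off one factor, and a condition on the
others, read off the other factor. -/
lemma map_glue (h : IsIID P δ) (m : ℕ) (t : ℤ) :
    (P.prod P).map (fun p => glue m (recent δ m t p.1) (past δ t p.2))
      = Measure.infinitePi fun _ : ℕ => P.map (δ 0) := by
  have : IsProbabilityMeasure (P.map (δ 0)) :=
    Measure.isProbabilityMeasure_map (h.measurable 0).aemeasurable
  have hm : Measurable fun p : Ω × Ω => glue m (recent δ m t p.1) (past δ t p.2) := by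
    refine measurable_pi_lambda _ fun j => ?_
    by_cases hj : j < m
    · simpa [glue, hj, recent] using! (h.measurable _).comp measurable_fst
    · simpa [glue, hj, past] using! (h.measurable _).comp measurable_snd
  refine Measure.eq_infinitePi _ fun s T hT => ?_
  rw [Measure.map_apply hm (MeasurableSet.pi s.countable_toSet fun i _ => hT i)]
  have hpre : (fun p : Ω × Ω => glue m (recent δ m t p.1) (past δ t p.2)) ⁻¹' Set.pi s T
      = (past δ t ⁻¹' Set.pi (s.filter (· < m) : Finset ℕ) T)
        ×ˢ (past δ t ⁻¹' Set.pi (s.filter (¬ · < m) : Finset ℕ) T) := by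
    ext p
    simp only [Set.mem_preimage, Set.mem_pi, Finset.mem_coe, Set.mem_prod, Finset.mem_filter,
      and_imp]
    constructor
    · intro hp
      exact ⟨fun i hi him => by simpa [glue, him, recent, past] using hp i hi,
        fun i hi him => by simpa [glue, him, past] using hp i hi⟩
    · rintro ⟨h1, h2⟩ i hi
      by_cases him : i < m
      · simpa [glue, him, recent, past] using h1 i hi him
      · simpa [glue, him, past] using h2 i hi him
  have hpi : ∀ s' : Finset ℕ, P (past δ t ⁻¹' Set.pi s' T) = ∏ i ∈ s', (P.map (δ 0)) (T i) := by
    intro s'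
    rw [← Measure.map_apply (h.measurable_past t)
      (MeasurableSet.pi s'.countable_toSet fun i _ => hT i), h.map_past,
      Measure.infinitePi_pi _ fun i _ => hT i]
  rw [hpre, Measure.prod_prod, hpi, hpi, Finset.prod_filter_mul_prod_filter_not]

end IsIID

end Innovations

/-! ### Approximation of a causal process by functionals of finitely many innovations -/

section Projection

variable {Ω S H : Type*} [MeasurableSpace Ω] [MeasurableSpace S] {P : Measure Ω}
  [IsProbabilityMeasure P] {δ : ℤ → Ω → S} [NormedAddCommGroup H] [InnerProductSpace ℝ H]
  [MeasurableSpace H]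

/-- The functional `f` averaged over all but its first `m` arguments. -/
noncomputable def partialMean (P : Measure Ω) (δ : ℤ → Ω → S) (f : (ℕ → S) → H) (m : ℕ)
    (u : Fin m → S) : H :=
  ∫ s, f (glue m u s) ∂(P.map (past δ 0))

/-- The conditional expectation of the causal process given the last `m` innovations. -/
noncomputable def project (P : Measure Ω) (δ : ℤ → Ω → S) (f : (ℕ → S) → H) (m : ℕ) (t : ℤ)
    (ω : Ω) : H :=
  partialMean P δ f m (recent δ m t ω)

lemma causal_eq (f : (ℕ → S) → H) (t : ℤ) (ω : Ω) : causal f δ t ω = f (past δ t ω) := rfl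

lemma coupled_eq (f : (ℕ → S) → H) (m : ℕ) (t : ℤ) (p : Ω × Ω) :
    coupled f δ m t p = f (glue m (recent δ m t p.1) (past δ t p.2)) := by
  unfold coupled
  rfl

variable [BorelSpace H] [SecondCountableTopology H]

lemma measurable_glue (m : ℕ) :
    Measurable fun p : (Fin m → S) × (ℕ → S) => glue m p.1 p.2 := by
  refine measurable_pi_lambda _ fun j => ?_
  by_cases hj : j < m
  · simpa [glue, hj] using! (measurable_pi_apply (⟨j, hj⟩ : Fin m)).comp measurable_fst
  · simpa [glue, hj] using! (measurable_pi_apply j).comp measurable_snd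

namespace IsIID

variable {f : (ℕ → S) → H}

lemma measurable_partialMean (h : IsIID P δ) (hf : Measurable f) (m : ℕ) :
    Measurable (partialMean P δ f m) := by
  have : IsProbabilityMeasure (P.map (past δ 0)) :=
    Measure.isProbabilityMeasure_map (h.measurable_past 0).aemeasurable
  exact (StronglyMeasurable.integral_prod_right'
    (hf.comp (measurable_glue m)).stronglyMeasurable).measurable

lemma measurable_project (h : IsIID P δ) (hf : Measurable f) (m : ℕ) (t : ℤ) :
    Measurable (project P δ f m t) :=
  (h.measurable_partialMean hf m).comp (h.measurable_recent m t)

lemma measurable_coupled (h : IsIID P δ) (hf : Measurable f) (m : ℕ) (t : ℤ) :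
    Measurable (coupled f δ m t) := by
  simp_rw [funext (coupled_eq f m t)]
  exact hf.comp ((measurable_glue m).comp
    (((h.measurable_recent m t).comp measurable_fst).prodMk
      ((h.measurable_past t).comp measurable_snd)))

lemma measurable_glue_pair (h : IsIID P δ) (m : ℕ) (t : ℤ) :
    Measurable fun p : Ω × Ω => glue m (recent δ m t p.1) (past δ t p.2) :=
  (measurable_glue m).comp
    (((h.measurable_recent m t).comp measurable_fst).prodMk
      ((h.measurable_past t).comp measurable_snd))

/-- The projection is the coupled variable averaged over the independent copy; Jensen's inequality
then compares the projection error with the coupling error. -/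
lemma project_eq_integral (h : IsIID P δ) (hf : Measurable f) (m : ℕ) (t : ℤ) (ω : Ω) :
    project P δ f m t ω = ∫ ω', coupled f δ m t (ω, ω') ∂P := by
  simp_rw [coupled_eq]
  rw [project, partialMean, h.map_past 0, ← h.map_past t, integral_map
    (h.measurable_past t).aemeasurable]
  exact ((hf.comp (measurable_glue m)).comp
    (measurable_const.prodMk measurable_id) : Measurable
      ((f ∘ fun p => glue m p.1 p.2) ∘ fun s => (recent δ m t ω, s))).aestronglyMeasurable

lemma memLp_law (h : IsIID P δ) (hL : MemLp (causal f δ 0) 2 P) (hf : Measurable f) :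
    MemLp f 2 (Measure.infinitePi fun _ : ℕ => P.map (δ 0)) := by
  rw [← h.map_past 0]
  exact (memLp_map_measure_iff hf.aestronglyMeasurable (h.measurable_past 0).aemeasurable).2 hL

lemma memLp_causal (h : IsIID P δ) (hL : MemLp (causal f δ 0) 2 P) (hf : Measurable f)
    (t : ℤ) : MemLp (causal f δ t) 2 P := by
  have h1 := h.memLp_law hL hf
  rw [← h.map_past t] at h1
  exact (memLp_map_measure_iff hf.aestronglyMeasurable (h.measurable_past t).aemeasurable).1 h1

lemma memLp_coupled (h : IsIID P δ) (hL : MemLp (causal f δ 0) 2 P) (hf : Measurable f)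
    (m : ℕ) (t : ℤ) : MemLp (coupled f δ m t) 2 (P.prod P) := by
  have h1 := h.memLp_law hL hf
  rw [← h.map_glue m t] at h1
  have h2 := (memLp_map_measure_iff hf.aestronglyMeasurable
    (h.measurable_glue_pair m t).aemeasurable).1 h1
  simp_rw [funext (coupled_eq f m t)]
  exact h2

lemma integral_coupled (h : IsIID P δ) (hf : Measurable f) (m : ℕ) (t : ℤ) :
    ∫ p, coupled f δ m t p ∂(P.prod P) = ∫ ω, causal f δ 0 ω ∂P := by
  simp_rw [coupled_eq, causal_eq]
  rw [← integral_map (h.measurable_past 0).aemeasurable hf.aestronglyMeasurable, h.map_past,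
    ← h.map_glue m t,
    integral_map (h.measurable_glue_pair m t).aemeasurable hf.aestronglyMeasurable]

lemma integrable_coupling_error (h : IsIID P δ) (hL : MemLp (causal f δ 0) 2 P) (hf : Measurable f)
    (m : ℕ) (t : ℤ) :
    Integrable (fun p => ‖causal f δ t p.1 - coupled f δ m t p‖ ^ 2) (P.prod P) :=
  integrable_norm_sq (((h.memLp_causal hL hf t).comp_fst P).sub (h.memLp_coupled hL hf m t))

lemma approxError_sq (m : ℕ) (t : ℤ) : approxError P f δ m t ^ 2
    = ∫ p, ‖causal f δ t p.1 - coupled f δ m t p‖ ^ 2 ∂(P.prod P) :=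
  Real.sq_sqrt (integral_nonneg fun _ => by positivity)

variable [CompleteSpace H]

lemma memLp_project (h : IsIID P δ) (hL : MemLp (causal f δ 0) 2 P) (hf : Measurable f) (m : ℕ)
    (t : ℤ) : MemLp (project P δ f m t) 2 P := by
  rw [memLp_two_iff_integrable_sq_norm (h.measurable_project hf m t).aestronglyMeasurable]
  have h1 := h.memLp_coupled hL hf m t
  have h2 := integrable_norm_sq h1
  refine h2.integral_prod_left.mono'
    ((h.measurable_project hf m t).norm.pow_const 2).aestronglyMeasurable ?_
  filter_upwards [h2.prod_right_ae] with ω hω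
  rw [h.project_eq_integral hf, Real.norm_of_nonneg (by positivity)]
  exact norm_integral_sq_le ((memLp_two_iff_integrable_sq_norm
    ((h.measurable_coupled hf m t).comp measurable_prodMk_left).aestronglyMeasurable).2 hω)

lemma integral_project (h : IsIID P δ) (hL : MemLp (causal f δ 0) 2 P) (hf : Measurable f) (m : ℕ)
    (t : ℤ) : ∫ ω, project P δ f m t ω ∂P = ∫ ω, causal f δ 0 ω ∂P := by
  rw [← h.integral_coupled hf m t,
    integral_prod _ ((h.memLp_coupled hL hf m t).integrable one_le_two)]
  exact integral_congr_ae (ae_of_all _ fun ω => h.project_eq_integral hf m t ω)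

lemma integral_causal (h : IsIID P δ) (hf : Measurable f) (t : ℤ) :
    ∫ ω, causal f δ t ω ∂P = ∫ ω, causal f δ 0 ω ∂P := by
  simp_rw [causal_eq]
  rw [← integral_map (h.measurable_past 0).aemeasurable hf.aestronglyMeasurable, h.map_past,
    ← integral_map (h.measurable_past t).aemeasurable hf.aestronglyMeasurable, h.map_past]

/-- Both terms are fixed functionals of the past, whose law does not depend on time. All later rates
can thus be taken at time zero. -/
lemma integral_sub_project_sq_eq (h : IsIID P δ) (hf : Measurable f) (m : ℕ) (t : ℤ) :
    ∫ ω, ‖causal f δ t ω - project P δ f m t ω‖ ^ 2 ∂P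
      = ∫ ω, ‖causal f δ 0 ω - project P δ f m 0 ω‖ ^ 2 ∂P := by
  have key : ∀ t, ∫ ω, ‖causal f δ t ω - project P δ f m t ω‖ ^ 2 ∂P
      = ∫ s, ‖f s - partialMean P δ f m (fun j : Fin m => s j)‖ ^ 2
          ∂(Measure.infinitePi fun _ : ℕ => P.map (δ 0)) := by
    intro t
    rw [← h.map_past t, integral_map (h.measurable_past t).aemeasurable]
    · rfl
    · refine ((hf.sub ((h.measurable_partialMean hf m).comp ?_)).norm.pow_const 2).aestronglyMeasurable
      fun_prop
  rw [key t, key 0]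

/-- Jensen's inequality: the projection error is the average of the coupling error over the second
factor. -/
lemma integral_sub_project_sq_le (h : IsIID P δ) (hL : MemLp (causal f δ 0) 2 P)
    (hf : Measurable f) (m : ℕ) (t : ℤ) :
    ∫ ω, ‖causal f δ t ω - project P δ f m t ω‖ ^ 2 ∂P ≤ approxError P f δ m 0 ^ 2 := by
  rw [h.integral_sub_project_sq_eq hf m t, approxError_sq,
    integral_prod _ (h.integrable_coupling_error hL hf m 0)]
  refine integral_mono_ae (integrable_norm_sq
    ((h.memLp_causal hL hf 0).sub (h.memLp_project hL hf m 0)))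
    (h.integrable_coupling_error hL hf m 0).integral_prod_left ?_
  filter_upwards [(h.integrable_coupling_error hL hf m 0).prod_right_ae,
    ((h.memLp_coupled hL hf m 0).integrable one_le_two).prod_right_ae] with ω h1 h2
  have h3 : causal f δ 0 ω - project P δ f m 0 ω
      = ∫ ω', (causal f δ 0 ω - coupled f δ m 0 (ω, ω')) ∂P := by
    rw [integral_sub (integrable_const _) h2, h.project_eq_integral hf]; simp
  rw [h3]
  exact norm_integral_sq_le ((memLp_two_iff_integrable_sq_norm (measurable_const.sub
    ((h.measurable_coupled hf m 0).comp measurable_prodMk_left)).aestronglyMeasurable).2 h1)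

/-- Independence turns the expected inner product into the inner product of the means, so it is
enough that one of them vanishes. -/
lemma integral_inner_eq_zero (h : IsIID P δ) {A B : Set ℤ} (hAB : Disjoint A B) {X Y : Ω → H}
    (hX : Measurable[innovField δ A] X) (hY : Measurable[innovField δ B] Y) (hX2 : MemLp X 2 P)
    (hY2 : MemLp Y 2 P) (h0 : ∫ ω, X ω ∂P = 0) : ∫ ω, inner ℝ (X ω) (Y ω) ∂P = 0 := by
  have h1 := (h.indepFun hAB hX hY).integral_bilin (hX2.integrable one_le_two)
    (hY2.integrable one_le_two) (innerSL ℝ)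
  refine Eq.trans h1 ?_
  rw [h0, map_zero]
  rfl

lemma measurable_project_field (h : IsIID P δ) (hf : Measurable f) {m : ℕ} {t : ℤ} {A : Set ℤ}
    (hA : Set.Ioc (t - m) t ⊆ A) : Measurable[innovField δ A] (project P δ f m t) :=
  (h.measurable_partialMean hf m).comp (measurable_recent_field hA)

/-- For `d > m` the later projection on `m` innovations may be replaced by the one on `d`
innovations. Their difference is a function of the innovations in `(t, t + d]`, hence independent of
the centered error at time `t`, which depends on innovations up to `t`. What remains is an error of
size `ρ(d)` instead of `ρ(m)`. -/
lemma abs_integral_inner_sub_project_le (h : IsIID P δ) (hL : MemLp (causal f δ 0) 2 P)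
    (hf : Measurable f) (m : ℕ) (t : ℤ) (d : ℕ) :
    |∫ ω, inner ℝ (causal f δ t ω - project P δ f m t ω)
        (causal f δ (t + d) ω - project P δ f m (t + d) ω) ∂P|
      ≤ approxError P f δ m 0 * if d ≤ m then approxError P f δ m 0 else approxError P f δ d 0 := by
  have hD : ∀ m t, MemLp (fun ω => causal f δ t ω - project P δ f m t ω) 2 P := fun m t =>
    (h.memLp_causal hL hf t).sub (h.memLp_project hL hf m t)
  have hn : ∀ m, 0 ≤ approxError P f δ m 0 := fun m => Real.sqrt_nonneg _
  have hs : ∀ m t, √(∫ ω, ‖causal f δ t ω - project P δ f m t ω‖ ^ 2 ∂P) ≤ approxError P f δ m 0 :=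
    fun m t => (Real.sqrt_le_sqrt (h.integral_sub_project_sq_le hL hf m t)).trans_eq
      (Real.sqrt_sq (hn m))
  split_ifs with hd
  · refine (abs_integral_inner_le (hD m t) (hD m (t + d))).trans ?_
    gcongr <;> first | apply hs | apply hn
  · have h2 : MemLp (fun ω => project P δ f d (t + d) ω - project P δ f m (t + d) ω) 2 P :=
      (h.memLp_project hL hf d _).sub (h.memLp_project hL hf m _)
    have h3 : ∫ ω, inner ℝ (causal f δ t ω - project P δ f m t ω)
        (project P δ f d (t + d) ω - project P δ f m (t + d) ω) ∂P = 0 := by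
      have hAB : Disjoint (Set.Iic t) (Set.Ioc t (t + d)) := by
        rw [Set.disjoint_left]
        intro i hi hi'
        exact absurd hi'.1 (not_lt.2 hi)
      refine h.integral_inner_eq_zero hAB ?_ ?_ (hD m t) h2 ?_
      · exact (hf.comp measurable_past_field).sub
          (h.measurable_project_field hf fun i hi => hi.2)
      · refine (h.measurable_project_field hf ?_).sub (h.measurable_project_field hf ?_)
        · simp
        · refine fun i hi => ⟨lt_of_le_of_lt ?_ hi.1, hi.2⟩
          omega
      · rw [integral_sub ((h.memLp_causal hL hf t).integrable one_le_two)
          ((h.memLp_project hL hf m t).integrable one_le_two), h.integral_project hL hf,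
          h.integral_causal hf, sub_self]
    have h4 : ∫ ω, inner ℝ (causal f δ t ω - project P δ f m t ω)
        (causal f δ (t + d) ω - project P δ f m (t + d) ω) ∂P
        = ∫ ω, inner ℝ (causal f δ t ω - project P δ f m t ω)
        (causal f δ (t + d) ω - project P δ f d (t + d) ω) ∂P := by
      rw [← add_zero (∫ ω, inner ℝ (causal f δ t ω - project P δ f m t ω)
        (causal f δ (t + d) ω - project P δ f d (t + d) ω) ∂P), ← h3,
        ← integral_add (integrable_inner (hD m t) (hD d (t + d)))
          (integrable_inner (hD m t) h2)]
      congr 1 with ω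
      rw [← inner_add_right, sub_add_sub_cancel]
    rw [h4]
    refine (abs_integral_inner_le (hD m t) (hD d (t + d))).trans ?_
    gcongr <;> first | apply hs | apply hn

/-- Weighted sums of the causal process are uniformly approximated by weighted sums of the
projections on the last `m` innovations. -/
theorem exists_integral_sub_project_le (h : IsIID P δ) (hL : MemLp (causal f δ 0) 2 P)
    (hf : Measurable f) (hsum : Summable fun m : ℕ => approxError P f δ (m + 1) 0)
    (hrate : Tendsto (fun m : ℕ => (m : ℝ) * approxError P f δ m 0) atTop (𝓝 0)) {η : ℝ}
    (hη : 0 < η) :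
    ∃ m : ℕ, ∀ (F : Finset ℤ) (a : ℤ → ℝ),
      ∫ ω, ‖∑ t ∈ F, a t • (causal f δ t ω - project P δ f m t ω)‖ ^ 2 ∂P
        ≤ η * ∑ t ∈ F, a t ^ 2 := by
  set ρ : ℕ → ℝ := fun m => approxError P f δ m 0 with hρ
  have hn : ∀ m, 0 ≤ ρ m := fun m => Real.sqrt_nonneg _
  have hs : Summable ρ := (summable_nat_add_iff 1).1 hsum
  have hρ0 : Tendsto ρ atTop (𝓝 0) := hs.tendsto_atTop_zero
  -- Twice the sum of the covariance bounds: `m + 1` lags contribute `ρ m ^ 2` each, and the longer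
  -- ones at most `ρ m * ∑' d, ρ d`. The first product tends to zero because `m * ρ m` and `ρ m` do.
  have hlim : Tendsto (fun m : ℕ => 2 * ((m : ℝ) * ρ m * ρ m + ρ m * ρ m + ρ m * ∑' d, ρ d)) atTop
      (𝓝 0) := by
    simpa using (((hrate.mul hρ0).add (hρ0.mul hρ0)).add (hρ0.mul_const (∑' d, ρ d))).const_mul 2
  obtain ⟨m, hm⟩ := (hlim.eventually (gt_mem_nhds hη)).exists
  refine ⟨m, fun F a => ?_⟩
  have hz : ∀ d ∉ Finset.range (m + 1), (if d < m + 1 then ρ m * ρ m else 0) = 0 := by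
    intro d hd; rw [if_neg (by simpa using hd)]
  have hs1 : Summable fun d : ℕ => if d < m + 1 then ρ m * ρ m else 0 :=
    summable_of_ne_finset_zero hz
  have key := integral_norm_sq_sum_le (μ := P) F (p := id) Function.injective_id a
    (X := fun t ω => causal f δ t ω - project P δ f m t ω)
    (fun t _ => (h.memLp_causal hL hf t).sub (h.memLp_project hL hf m t))
    (r := fun d => (if d < m + 1 then ρ m * ρ m else 0) + ρ m * ρ d)
    (fun d => add_nonneg (by split_ifs <;> simp [mul_nonneg (hn m) (hn m)])
      (mul_nonneg (hn m) (hn d)))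
    (hs1.add (hs.mul_left _)) ?_
  · refine key.trans ?_
    have hpos : 0 ≤ ∑ t ∈ F, a t ^ 2 := Finset.sum_nonneg fun _ _ => sq_nonneg _
    refine mul_le_mul_of_nonneg_right ?_ hpos
    rw [hs1.tsum_add (hs.mul_left _), tsum_mul_left, tsum_eq_sum hz,
      Finset.sum_congr rfl (g := fun _ => ρ m * ρ m)
        (fun d hd => by rw [if_pos (by simpa using hd)])]
    simp only [Finset.sum_const, Finset.card_range, nsmul_eq_mul]
    push_cast
    nlinarith [hm.le]
  · have hle : ∀ (t : ℤ) (d : ℕ), |∫ ω, inner ℝ (causal f δ t ω - project P δ f m t ω)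
        (causal f δ (t + d) ω - project P δ f m (t + d) ω) ∂P|
        ≤ (if d < m + 1 then ρ m * ρ m else 0) + ρ m * ρ d := by
      intro t d
      refine (h.abs_integral_inner_sub_project_le hL hf m t d).trans ?_
      by_cases hd : d ≤ m
      · rw [if_pos hd, if_pos (by omega)]
        exact le_add_of_nonneg_right (mul_nonneg (hn m) (hn d))
      · rw [if_neg hd, if_neg (by omega), zero_add]
    intro s _ t _
    rcases le_total s t with hst | hst
    · obtain ⟨d, rfl⟩ := Int.le.dest hst
      have e : (id s - id (s + (d : ℤ))).natAbs = d := by simp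
      rw [e]; exact hle s d
    · obtain ⟨d, rfl⟩ := Int.le.dest hst
      have e : (id (t + (d : ℤ)) - id t).natAbs = d := by simp
      rw [e]
      simp_rw [real_inner_comm (causal f δ t _ - _)]
      exact hle t d

end IsIID

end Projection

/-! ### Reduction to functionals with finitely many values -/

section FiniteRange

variable {Ω S H : Type*} [MeasurableSpace Ω] [MeasurableSpace S] {P : Measure Ω}
  [IsProbabilityMeasure P] {δ : ℤ → Ω → S} [NormedAddCommGroup H] [InnerProductSpace ℝ H]
  [MeasurableSpace H] [BorelSpace H] [SecondCountableTopology H] [CompleteSpace H]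

lemma integral_norm_sq_lt_of_eLpNorm_lt {α : Type*} [MeasurableSpace α] {μ : Measure α} {X : α → H}
    (hX : MemLp X 2 μ) {η : ℝ} (hη : 0 < η) (h : eLpNorm X 2 μ < ENNReal.ofReal (√η)) :
    ∫ a, ‖X a‖ ^ 2 ∂μ < η := by
  rw [hX.eLpNorm_eq_integral_rpow_norm two_ne_zero ENNReal.ofNat_ne_top,
    ENNReal.ofReal_lt_ofReal_iff (Real.sqrt_pos.2 hη)] at h
  have h1 : √(∫ a, ‖X a‖ ^ 2 ∂μ) < √η := by
    simpa [Real.sqrt_eq_rpow] using h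
  exact (Real.sqrt_lt_sqrt_iff (integral_nonneg fun _ => by positivity)).1 h1

namespace IsIID

lemma memLp_comp_recent_iff (h : IsIID P δ) {m : ℕ} {G : (Fin m → S) → H} (hG : Measurable G)
    (t : ℤ) : MemLp (fun ω => G (recent δ m t ω)) 2 P
      ↔ MemLp G 2 (Measure.infinitePi fun _ : Fin m => P.map (δ 0)) := by
  rw [← h.map_recent m t]
  exact (memLp_map_measure_iff hG.aestronglyMeasurable (h.measurable_recent m t).aemeasurable).symm

lemma integral_comp_recent (h : IsIID P δ) {m : ℕ} {E : Type*} [NormedAddCommGroup E]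
    [NormedSpace ℝ E] {G : (Fin m → S) → E} (hG : StronglyMeasurable G) (t : ℤ) :
    ∫ ω, G (recent δ m t ω) ∂P = ∫ u, G u ∂(Measure.infinitePi fun _ : Fin m => P.map (δ 0)) := by
  rw [← h.map_recent m t, integral_map (h.measurable_recent m t).aemeasurable
    hG.aestronglyMeasurable]

/-- A centered square integrable functional of `m` innovations is approximated by centered
functionals with finitely many values. -/
theorem exists_finite_range_approx_recent (h : IsIID P δ) {m : ℕ} {G : (Fin m → S) → H}
    (hG : Measurable G) (hL : MemLp (fun ω => G (recent δ m 0 ω)) 2 P)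
    (h0 : ∫ ω, G (recent δ m 0 ω) ∂P = 0) {η : ℝ} (hη : 0 < η) :
    ∃ (Q : Finset H) (ψ : Q → (Fin m → S) → ℝ), (∀ q, Measurable (ψ q)) ∧
      (∀ q u, |ψ q u| ≤ 1) ∧ (∀ q t, ∫ ω, ψ q (recent δ m t ω) ∂P = 0) ∧
      ∀ (F : Finset ℤ) (a : ℤ → ℝ),
        ∫ ω, ‖∑ t ∈ F, a t • (G (recent δ m t ω)
          - ∑ q, ψ q (recent δ m t ω) • (q : H))‖ ^ 2 ∂P ≤ η * ∑ t ∈ F, a t ^ 2 := by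
  classical
  set ν := Measure.infinitePi fun _ : Fin m => P.map (δ 0) with hν
  have : IsProbabilityMeasure (P.map (δ 0)) :=
    Measure.isProbabilityMeasure_map (h.measurable 0).aemeasurable
  have hLν : MemLp G 2 ν := (h.memLp_comp_recent_iff hG 0).1 hL
  -- Centering costs a factor 4 and the range of dependence a factor `2 * m`, so the final constant
  -- is `η * m / (m + 1)`. The shift by one admits `m = 0`.
  set κ := η / (8 * (m + 1)) with hκ
  have hκ0 : 0 < κ := by positivity
  obtain ⟨φ, hφ, hφL⟩ := hLν.exists_simpleFunc_eLpNorm_sub_lt ENNReal.ofNat_ne_top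
    (ε := ENNReal.ofReal (√κ)) (by simpa using hκ0)
  have hZ : ∫ u, ‖G u - φ u‖ ^ 2 ∂ν < κ :=
    integral_norm_sq_lt_of_eLpNorm_lt (hLν.sub hφL) hκ0 hφ
  set c : H → ℝ := fun q => ∫ u, (if φ u = q then (1 : ℝ) else 0) ∂ν with hc
  have hind : ∀ q, Measurable fun u => if φ u = q then (1 : ℝ) else 0 := fun q =>
    Measurable.ite (φ.measurableSet_fiber q) measurable_const measurable_const
  have hindi : ∀ q, Integrable (fun u => if φ u = q then (1 : ℝ) else 0) ν := fun q =>
    Integrable.of_bound (hind q).aestronglyMeasurable 1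
      (ae_of_all _ fun u => by split_ifs <;> simp)
  have hc0 : ∀ q, 0 ≤ c q := fun q => integral_nonneg fun u => by
    simp only [Pi.zero_apply]; split_ifs <;> simp
  have hc1 : ∀ q, c q ≤ 1 := fun q => by
    have := integral_mono (hindi q) (integrable_const 1) (fun u => by
      change (if φ u = q then (1 : ℝ) else 0) ≤ 1
      split_ifs <;> simp)
    simpa using this
  -- The indicator of a value of the simple function minus its probability, so that `V` below is `φ`
  -- minus its mean.
  let ψ : φ.range → (Fin m → S) → ℝ := fun q u => (if φ u = q then (1 : ℝ) else 0) - c q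
  have hψm : ∀ q, Measurable (ψ q) := fun q => (hind q).sub_const _
  have hψ1 : ∀ q u, |ψ q u| ≤ 1 := fun q u => by
    have h1 := hc0 q
    have h2 := hc1 q
    simp only [ψ]
    split_ifs <;> rw [abs_le] <;> constructor <;> linarith
  have hψ0 : ∀ q t, ∫ ω, ψ q (recent δ m t ω) ∂P = 0 := fun q t => by
    rw [h.integral_comp_recent (hψm q).stronglyMeasurable]
    simp only [ψ]
    rw [integral_sub (hindi q) (integrable_const _)]
    simp [hc]
  set V : (Fin m → S) → H := fun u => ∑ q : φ.range, ψ q u • (q : H) with hV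
  have hVm : Measurable V := Finset.measurable_sum _ fun q _ => (hψm q).smul_const _
  have hVeq : ∀ u, V u = φ u - ∑ q : φ.range, c q • (q : H) := by
    intro u
    simp only [hV, ψ, sub_smul, Finset.sum_sub_distrib, ite_smul, one_smul, zero_smul]
    congr 1
    rw [Finset.sum_coe_sort φ.range (fun q => if φ u = q then q else 0)]
    rw [Finset.sum_ite_eq]
    simp
  have hVL : MemLp V 2 ν := by
    refine MemLp.of_bound hVm.aestronglyMeasurable (∑ q : φ.range, 1 * ‖(q : H)‖)
      (ae_of_all _ fun u => (norm_sum_le _ _).trans (Finset.sum_le_sum fun q _ => ?_))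
    rw [norm_smul]
    gcongr
    exact hψ1 q u
  have hV0 : ∫ u, V u ∂ν = 0 := by
    simp only [hV]
    rw [integral_finsetSum _ fun q _ => ?_]
    · refine Finset.sum_eq_zero fun q _ => ?_
      rw [integral_smul_const, ← h.integral_comp_recent (hψm q).stronglyMeasurable 0, hψ0, zero_smul]
    · refine Integrable.smul_const ?_ _
      exact (hindi q).sub (integrable_const _)
  have hG0 : ∫ u, G u ∂ν = 0 := by
    rw [← h0, ← h.integral_comp_recent hG.stronglyMeasurable 0]
  have hE : ∫ u, ‖G u - V u‖ ^ 2 ∂ν ≤ 4 * κ := by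
    have hZL : MemLp (fun u => G u - φ u) 2 ν := hLν.sub hφL
    -- As `G` is centered, the mean of `φ` is, up to sign, the mean of the error `G - φ`. By Jensen,
    -- subtracting it adds no more than the error already made: `2 * κ + 2 * κ`.
    have hm : ∫ u, (G u - φ u) ∂ν = - ∑ q : φ.range, c q • (q : H) := by
      have h1 : ∫ u, (G u - V u) ∂ν = 0 := by
        rw [integral_sub (hLν.integrable one_le_two) (hVL.integrable one_le_two), hG0, hV0,
          sub_zero]
      have h2 : ∀ u, G u - V u = (G u - φ u) + ∑ q : φ.range, c q • (q : H) := by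
        intro u; rw [hVeq]; abel
      simp_rw [h2] at h1
      rw [integral_add (hZL.integrable one_le_two) (integrable_const _)] at h1
      simp only [integral_const, probReal_univ, one_smul] at h1
      exact eq_neg_of_add_eq_zero_left h1
    have h3 : ∀ u, G u - V u = (G u - φ u) + (∑ q : φ.range, c q • (q : H)) := by
      intro u; rw [hVeq]; abel
    simp_rw [h3]
    refine (integral_norm_add_sq_le hZL (memLp_const _)).trans ?_
    have h4 := norm_integral_sq_le hZL
    rw [hm, norm_neg] at h4
    simp only [integral_const, probReal_univ, one_smul]
    linarith
  refine ⟨φ.range, ψ, hψm, hψ1, hψ0, fun F a => ?_⟩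
  have hGV : Measurable fun u => G u - V u := hG.sub hVm
  have hEL : ∀ t, MemLp (fun ω => G (recent δ m t ω) - V (recent δ m t ω)) 2 P := fun t =>
    (h.memLp_comp_recent_iff hGV t).2 (hLν.sub hVL)
  refine (integral_norm_sq_sum_le_of_range (μ := P) F (p := id) Function.injective_id a
    (X := fun t ω => G (recent δ m t ω) - V (recent δ m t ω)) (fun t _ => hEL t)
    (C := 4 * κ) (fun t _ => ?_) m fun s _ t _ hst => ?_).trans ?_
  · rw [h.integral_comp_recent (G := fun u => ‖G u - V u‖ ^ 2)
      (hGV.norm.pow_const 2).stronglyMeasurable]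
    exact hE
  · refine h.integral_inner_eq_zero (A := Set.Ioc (s - m) s) (B := Set.Ioc (t - m) t) ?_
      (hGV.comp (measurable_recent_field le_rfl)) (hGV.comp (measurable_recent_field le_rfl))
      (hEL s) (hEL t) ?_
    · rw [Set.disjoint_left]
      intro i hi hi'
      simp only [Set.mem_Ioc, id_eq] at hi hi' hst
      omega
    · rw [h.integral_comp_recent (G := fun u => G u - V u) hGV.stronglyMeasurable,
        integral_sub (hLν.integrable one_le_two) (hVL.integrable one_le_two), hG0, hV0, sub_zero]
  · refine mul_le_mul_of_nonneg_right ?_ (Finset.sum_nonneg fun _ _ => sq_nonneg _)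
    rw [hκ]
    have : (m : ℝ) / (m + 1) ≤ 1 := by
      rw [div_le_one (by positivity)]; linarith
    calc 2 * ((m : ℝ) * (4 * (η / (8 * (m + 1))))) = η * ((m : ℝ) / (m + 1)) := by
          field_simp; ring
      _ ≤ η * 1 := by gcongr
      _ = η := mul_one η

end IsIID

variable {f : (ℕ → S) → H} {Y : ℤ → Ω → H}

lemma StronglyApproximable.isIID (hdep : StronglyApproximable P Y f δ) : IsIID P δ :=
  ⟨hdep.measurable_innov, hdep.indep_innov, hdep.ident_innov⟩

lemma StronglyApproximable.memLp_causal (hdep : StronglyApproximable P Y f δ) :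
    MemLp (causal f δ 0) 2 P :=
  hdep.memLp.ae_eq (hdep.representation 0)

lemma StronglyApproximable.memLp_two (hdep : StronglyApproximable P Y f δ) (t : ℤ) :
    MemLp (Y t) 2 P :=
  (hdep.isIID.memLp_causal hdep.memLp_causal hdep.measurable_f t).ae_eq (hdep.representation t).symm

/-- A centered strongly approximable process is uniformly approximated, in the sense of second
moments of weighted sums, by functionals of finitely many innovations with finitely many values. -/
theorem StronglyApproximable.exists_finite_range_approx (hdep : StronglyApproximable P Y f δ)
    (hmean : ∀ t, ∫ ω, Y t ω ∂P = 0) {η : ℝ} (hη : 0 < η) :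
    ∃ (m : ℕ) (Q : Finset H) (ψ : Q → (Fin m → S) → ℝ), (∀ q, Measurable (ψ q)) ∧
      (∀ q u, |ψ q u| ≤ 1) ∧ (∀ q t, ∫ ω, ψ q (recent δ m t ω) ∂P = 0) ∧
      ∀ (F : Finset ℤ) (a : ℤ → ℝ),
        ∫ ω, ‖∑ t ∈ F, a t • (Y t ω - ∑ q, ψ q (recent δ m t ω) • (q : H))‖ ^ 2 ∂P
          ≤ η * ∑ t ∈ F, a t ^ 2 := by
  have h := hdep.isIID
  have hf := hdep.measurable_f
  have hL := hdep.memLp_causal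
  -- Two errors of `η / 4`, each doubled by `‖x + y‖² ≤ 2‖x‖² + 2‖y‖²`.
  obtain ⟨m, hm⟩ := h.exists_integral_sub_project_le hL hf (hdep.summable_approx 0) (hdep.rate 0)
    (η := η / 4) (by positivity)
  have h0 : ∫ ω, causal f δ 0 ω ∂P = 0 := by
    rw [← hmean 0]; exact (integral_congr_ae (hdep.representation 0)).symm
  obtain ⟨Q, ψ, hψm, hψ1, hψ0, hψ⟩ := h.exists_finite_range_approx_recent
    (h.measurable_partialMean hf m) (h.memLp_project hL hf m 0)
    ((h.integral_project hL hf m 0).trans h0) (η := η / 4) (by positivity)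
  refine ⟨m, Q, ψ, hψm, hψ1, hψ0, fun F a => ?_⟩
  have hVL : ∀ t, MemLp (fun ω => ∑ q, ψ q (recent δ m t ω) • (q : H)) 2 P := by
    intro t
    have hVm : Measurable fun u => ∑ q, ψ q u • (q : H) :=
      Finset.measurable_sum _ fun q _ => (hψm q).smul_const _
    refine MemLp.of_bound (hVm.comp (h.measurable_recent m t)).aestronglyMeasurable
      (∑ q : Q, 1 * ‖(q : H)‖)
      (ae_of_all _ fun u => (norm_sum_le _ _).trans (Finset.sum_le_sum fun q _ => ?_))
    rw [norm_smul]
    gcongr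
    exact hψ1 q _
  have h1 : MemLp (fun ω => ∑ t ∈ F, a t • (causal f δ t ω - project P δ f m t ω)) 2 P :=
    memLp_finsetSum _ fun t _ =>
      ((h.memLp_causal hL hf t).sub (h.memLp_project hL hf m t)).const_smul (a t)
  have h2 : MemLp (fun ω => ∑ t ∈ F, a t • (project P δ f m t ω
      - ∑ q, ψ q (recent δ m t ω) • (q : H))) 2 P :=
    memLp_finsetSum _ fun t _ => ((h.memLp_project hL hf m t).sub (hVL t)).const_smul (a t)
  have h3 : ∀ᵐ ω ∂P, ∀ t, Y t ω = causal f δ t ω := ae_all_iff.2 hdep.representation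
  calc _ = ∫ ω, ‖(∑ t ∈ F, a t • (causal f δ t ω - project P δ f m t ω))
        + ∑ t ∈ F, a t • (project P δ f m t ω
          - ∑ q, ψ q (recent δ m t ω) • (q : H))‖ ^ 2 ∂P := by
        refine integral_congr_ae ?_
        filter_upwards [h3] with ω hω
        rw [← Finset.sum_add_distrib]
        congr 2
        refine Finset.sum_congr rfl fun t _ => ?_
        rw [← smul_add, sub_add_sub_cancel, hω]
    _ ≤ 2 * (η / 4 * ∑ t ∈ F, a t ^ 2) + 2 * (η / 4 * ∑ t ∈ F, a t ^ 2) := by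
        refine (integral_norm_add_sq_le h1 h2).trans ?_
        gcongr
        · exact hm F a
        · exact hψ F a
    _ = η * ∑ t ∈ F, a t ^ 2 := by ring

end FiniteRange

/-! ### Windows -/

section Windows

/-- Each unit shift telescopes to a difference of two values in `[0, 1]`. -/
lemma sum_range_shift_sub_le {G : ℤ → ℝ} (hG0 : ∀ t, 0 ≤ G t) (hG1 : ∀ t, G t ≤ 1) (b d : ℕ) :
    ∑ i ∈ Finset.range b, (G (i + d) - G i) ≤ d := by
  induction d with
  | zero => simp
  | succ d ih =>
    have h1 : ∑ i ∈ Finset.range b, (G (i + (d + 1 : ℕ)) - G (i + d)) ≤ 1 := by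
      have h2 := Finset.sum_range_sub (fun i : ℕ => G (i + d)) b
      have h3 : ∑ i ∈ Finset.range b, (G (i + (d + 1 : ℕ)) - G (i + d))
          = ∑ i ∈ Finset.range b, ((fun i : ℕ => G (i + d)) (i + 1) - (fun i : ℕ => G (i + d)) i) := by
        refine Finset.sum_congr rfl fun i _ => ?_
        push_cast
        ring_nf
      rw [h3, h2]
      linarith [hG1 ((b : ℤ) + d), hG0 (((0 : ℕ) : ℤ) + d)]
    have h4 : ∑ i ∈ Finset.range b, (G (i + (d + 1 : ℕ)) - G i)
        = ∑ i ∈ Finset.range b, (G (i + (d + 1 : ℕ)) - G (i + d))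
          + ∑ i ∈ Finset.range b, (G (i + d) - G i) := by
      rw [← Finset.sum_add_distrib]
      exact Finset.sum_congr rfl fun i _ => by ring
    rw [h4]
    push_cast at h1 ⊢
    linarith

/-- For a monotone function all increments have the same sign, so the absolute values disappear. A
negative shift is a positive one of the translated function. -/
lemma sum_range_abs_shift_sub_le {G : ℤ → ℝ} (hG : Monotone G) (hG0 : ∀ t, 0 ≤ G t)
    (hG1 : ∀ t, G t ≤ 1) (b : ℕ) (d : ℤ) :
    ∑ i ∈ Finset.range b, |G (i + d) - G i| ≤ |(d : ℝ)| := by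
  obtain ⟨k, rfl | rfl⟩ := d.eq_nat_or_neg
  · have h := sum_range_shift_sub_le hG0 hG1 b k
    refine le_of_eq_of_le (Finset.sum_congr rfl fun i _ => ?_) (h.trans (by simp))
    exact abs_of_nonneg (sub_nonneg.2 (hG (by omega)))
  · have h := sum_range_shift_sub_le (G := fun t => G (t + -(k : ℤ))) (fun t => hG0 _)
      (fun t => hG1 _) b k
    refine le_of_eq_of_le (Finset.sum_congr rfl fun i _ => ?_) (h.trans (by simp))
    rw [abs_of_nonpos (sub_nonpos.2 (hG (by omega)))]
    simp

/-- The window as a function of an integer argument. -/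
noncomputable def intWindow (w : ℝ → ℝ) (b : ℕ) (t : ℤ) : ℝ := w (((t : ℝ) + 1 / 2) / b)

lemma window_succ (w : ℝ → ℝ) (b r : ℕ) : window w b (r + 1) = intWindow w b r := by
  unfold window intWindow
  congr 2
  push_cast
  ring

lemma windowNorm_sq (w : ℝ → ℝ) (b : ℕ) :
    windowNorm w b ^ 2 = ∑ r ∈ Finset.range b, intWindow w b r ^ 2 := by
  rw [windowNorm, Real.sq_sqrt (Finset.sum_nonneg fun _ _ => sq_nonneg _)]
  simp_rw [← window_succ]
  rw [Finset.range_eq_Ico, Finset.sum_Ico_add' (fun t => window w b t ^ 2) 0 b 1]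
  rfl

lemma windowNorm_nonneg (w : ℝ → ℝ) (b : ℕ) : 0 ≤ windowNorm w b := Real.sqrt_nonneg _

namespace IsTaper

variable {w : ℝ → ℝ}

lemma intWindow_eq_zero (hw : IsTaper w) {b : ℕ} (hb : 1 ≤ b) {t : ℤ} (ht : t < 0 ∨ (b : ℤ) ≤ t) :
    intWindow w b t = 0 := by
  have hb' : (0 : ℝ) < b := by exact_mod_cast hb
  refine hw.eq_zero _ fun h => ?_
  have h1 := h.1
  have h2 := h.2
  rw [le_div_iff₀ hb'] at h1
  rw [div_le_one hb'] at h2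
  rcases ht with ht | ht
  · have : (t : ℝ) ≤ -1 := by exact_mod_cast (by omega : t ≤ -1)
    linarith
  · have : (b : ℝ) ≤ t := by exact_mod_cast ht
    linarith

lemma monotone_left (hw : IsTaper w) : Monotone fun τ => w (min τ (1 / 2)) := by
  intro x y hxy
  dsimp only
  by_cases hx : 0 ≤ min x (1 / 2)
  · exact hw.mono ⟨hx, min_le_right _ _⟩ ⟨hx.trans (min_le_min_right _ hxy), min_le_right _ _⟩
      (min_le_min_right _ hxy)
  · rw [hw.eq_zero _ fun h => hx h.1]
    exact (hw.mem_Icc _).1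

/-- Unimodality in additive form: the first term increases and the second decreases in `τ`, which
exhibits the window as a function of bounded variation. -/
lemma eq_left_add_right (hw : IsTaper w) (τ : ℝ) :
    w τ = w (min τ (1 / 2)) + w (min (1 - τ) (1 / 2)) - w (1 / 2) := by
  rcases le_total τ (1 / 2) with h | h
  · rw [min_eq_left h, min_eq_right (by linarith)]; ring
  · rw [min_eq_right h, min_eq_left (by linarith), hw.symm]; ring

/-- The window is, up to a constant, a difference of two monotone functions with values in `[0, 1]`,
each of which contributes `|d|`. The bound is independent of `b`. -/
lemma sum_abs_shift_sub_le (hw : IsTaper w) (b : ℕ) (d : ℤ) :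
    ∑ i ∈ Finset.range b, |intWindow w b (i + d) - intWindow w b i| ≤ 2 * |(d : ℝ)| := by
  set G₁ : ℤ → ℝ := fun t => w (min (((t : ℝ) + 1 / 2) / b) (1 / 2)) with hG₁
  -- The reflection `1 - w` turns the decreasing part into an increasing one without leaving `[0,
  -- 1]`.
  set G₂ : ℤ → ℝ := fun t => 1 - w (min (1 - ((t : ℝ) + 1 / 2) / b) (1 / 2)) with hG₂
  have hdiv : ∀ s t : ℤ, s ≤ t → ((s : ℝ) + 1 / 2) / b ≤ ((t : ℝ) + 1 / 2) / b := by
    intro s t hst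
    have : (s : ℝ) ≤ t := by exact_mod_cast hst
    gcongr
  have hm₁ : Monotone G₁ := fun s t hst => hw.monotone_left (hdiv s t hst)
  have hm₂ : Monotone G₂ := fun s t hst =>
    sub_le_sub_left (hw.monotone_left (sub_le_sub_left (hdiv s t hst) 1)) 1
  have hA := sum_range_abs_shift_sub_le hm₁ (fun t => (hw.mem_Icc _).1)
    (fun t => (hw.mem_Icc _).2) b d
  have hB := sum_range_abs_shift_sub_le hm₂ (fun t => sub_nonneg.2 (hw.mem_Icc _).2)
    (fun t => sub_le_self _ (hw.mem_Icc _).1) b d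
  have hW : ∀ t, intWindow w b t = G₁ t - G₂ t + (1 - w (1 / 2)) := by
    intro t
    rw [intWindow, hw.eq_left_add_right]
    simp only [hG₁, hG₂]
    ring
  rw [two_mul]
  refine le_trans ?_ (add_le_add hA hB)
  rw [← Finset.sum_add_distrib]
  refine Finset.sum_le_sum fun i _ => ?_
  rw [hW, hW]
  refine le_trans (le_of_eq ?_) (abs_sub _ _)
  congr 1
  ring

/-- By monotonicity the window is at least `c = w (1 / 2 - θ) > 0` on `[1/2 - θ, 1/2]`, and this
interval contains at least `θ * b - 2` of the grid points, the 2 accounting for rounding at both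
ends. -/
lemma tendsto_windowNorm_sq (hw : IsTaper w) :
    Tendsto (fun b : ℕ => windowNorm w b ^ 2) atTop atTop := by
  obtain ⟨ε, hε, hpos⟩ := Metric.eventually_nhds_iff.1 hw.pos_near_half
  -- `ε / 2` places `1 / 2 - θ` where the window is positive, and `1 / 4` keeps it inside `[0,
  -- 1/2]`.
  set θ := min (ε / 2) (1 / 4) with hθ
  have hθ0 : 0 < θ := by positivity
  have hθ1 : θ ≤ ε / 2 := min_le_left _ _
  have hθ2 : θ ≤ 1 / 4 := min_le_right _ _
  have hc : 0 < w (1 / 2 - θ) := hpos (by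
    rw [Real.dist_eq, abs_lt]; constructor <;> linarith)
  set c := w (1 / 2 - θ)
  have hlow : ∀ b : ℕ, 1 ≤ b → c ^ 2 * (θ * b - 2) ≤ windowNorm w b ^ 2 := by
    intro b hb
    have hb' : (0 : ℝ) < b := by exact_mod_cast hb
    rw [windowNorm_sq]
    set A := ⌈(1 / 2 - θ) * b⌉₊
    set B := ⌊(b : ℝ) / 2⌋₊
    have hBb : B ≤ b := by
      have : (B : ℝ) ≤ (b : ℝ) / 2 := Nat.floor_le (by positivity)
      exact_mod_cast (by linarith : (B : ℝ) ≤ b)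
    have hA : (A : ℝ) < (1 / 2 - θ) * b + 1 := Nat.ceil_lt_add_one (by
      apply mul_nonneg <;> linarith)
    have hB : (b : ℝ) / 2 < B + 1 := Nat.lt_floor_add_one _
    have hsub : Finset.Ico A B ⊆ Finset.range b := by
      intro i hi
      rw [Finset.mem_Ico] at hi
      rw [Finset.mem_range]
      omega
    calc c ^ 2 * (θ * b - 2) ≤ ∑ r ∈ Finset.Ico A B, c ^ 2 := by
          rw [Finset.sum_const, Nat.card_Ico, nsmul_eq_mul, mul_comm]
          gcongr
          have h : (B : ℝ) ≤ ((B - A : ℕ) : ℝ) + A := by exact_mod_cast (by omega : B ≤ B - A + A)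
          linarith
      _ ≤ ∑ r ∈ Finset.Ico A B, intWindow w b r ^ 2 := by
          refine Finset.sum_le_sum fun r hr => ?_
          rw [Finset.mem_Ico] at hr
          gcongr
          have h1 : (1 / 2 - θ) * b ≤ r := (Nat.le_ceil _).trans (by exact_mod_cast hr.1)
          have h2 : (r : ℝ) + 1 ≤ (b : ℝ) / 2 :=
            le_trans (by exact_mod_cast hr.2) (Nat.floor_le (by positivity : (0 : ℝ) ≤ (b : ℝ) / 2))
          refine hw.mono ⟨by linarith, by linarith⟩ ⟨?_, ?_⟩ ?_
          · positivity
          · rw [div_le_iff₀ hb']; push_cast; linarith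
          · rw [le_div_iff₀ hb']; push_cast; linarith
      _ ≤ _ := Finset.sum_le_sum_of_subset_of_nonneg hsub fun _ _ _ => sq_nonneg _
  have hlim : Tendsto (fun b : ℕ => c ^ 2 * (θ * b - 2)) atTop atTop := by
    refine Tendsto.const_mul_atTop (by positivity) ?_
    exact tendsto_atTop_add_const_right _ (-2 : ℝ) (Tendsto.const_mul_atTop hθ0 tendsto_natCast_atTop_atTop)
  exact tendsto_atTop_mono' _ ((eventually_ge_atTop 1).mono fun b hb => hlow b hb) hlim

/-- The autocorrelation of a normalized window at a fixed lag tends to one. -/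
theorem tendsto_autocorrelation (hw : IsTaper w) (d : ℤ) :
    Tendsto (fun b : ℕ => ∑ r ∈ Finset.range b,
      intWindow w b r / windowNorm w b * (intWindow w b (r + d) / windowNorm w b)) atTop (𝓝 1) := by
  have h1 : Tendsto (fun b : ℕ => 2 * |(d : ℝ)| * (windowNorm w b ^ 2)⁻¹) atTop (𝓝 0) := by
    simpa using (tendsto_inv_atTop_zero.comp hw.tendsto_windowNorm_sq).const_mul (2 * |(d : ℝ)|)
  rw [tendsto_iff_norm_sub_tendsto_zero]
  refine squeeze_zero' (Eventually.of_forall fun _ => norm_nonneg _) ?_ h1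
  filter_upwards [hw.tendsto_windowNorm_sq.eventually_gt_atTop 0] with b hb
  -- At lag zero the autocorrelation is exactly one, so the error is a sum of window increments
  -- divided by the squared norm: a bounded numerator over a diverging denominator.
  have h2 : ∑ r ∈ Finset.range b,
      intWindow w b r / windowNorm w b * (intWindow w b (r + d) / windowNorm w b) - 1
      = (∑ r ∈ Finset.range b, intWindow w b r * (intWindow w b (r + d) - intWindow w b r))
        * (windowNorm w b ^ 2)⁻¹ := by
    have h3 : (1 : ℝ) = (∑ r ∈ Finset.range b, intWindow w b r ^ 2) * (windowNorm w b ^ 2)⁻¹ := by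
      rw [← windowNorm_sq, mul_inv_cancel₀ hb.ne']
    nth_rw 1 [h3]
    rw [Finset.sum_mul, Finset.sum_mul, ← Finset.sum_sub_distrib]
    refine Finset.sum_congr rfl fun r _ => ?_
    rw [div_eq_mul_inv, div_eq_mul_inv, ← inv_pow]
    ring
  rw [h2, norm_mul, Real.norm_of_nonneg (inv_nonneg.2 hb.le)]
  gcongr
  refine (norm_sum_le _ _).trans (le_trans (Finset.sum_le_sum fun r _ => ?_)
    (hw.sum_abs_shift_sub_le b d))
  rw [norm_mul, Real.norm_eq_abs, Real.norm_eq_abs, abs_of_nonneg (show 0 ≤ intWindow w b r from (hw.mem_Icc _).1)]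
  exact mul_le_of_le_one_left (abs_nonneg _) (hw.mem_Icc _).2

end IsTaper

/-- Equality holds unless the norm vanishes, in which case division by zero makes the sum zero. All
bounds on block sums that are uniform in `b` rest on this. -/
lemma sum_sq_div_windowNorm_le (w : ℝ → ℝ) (b : ℕ) :
    ∑ r ∈ Finset.range b, (intWindow w b r / windowNorm w b) ^ 2 ≤ 1 := by
  simp_rw [div_pow]
  rw [← Finset.sum_div, ← windowNorm_sq]
  exact div_self_le_one _

/-- The rectangular window. -/
noncomputable def rectangle : ℝ → ℝ := Set.indicator (Set.Icc 0 1) 1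

/-- The scaled sample mean is a single block with this window, so the variance limit for tapered
block sums also covers it. -/
lemma isTaper_rectangle : IsTaper rectangle where
  mem_Icc τ := by
    unfold rectangle
    by_cases h : τ ∈ Set.Icc (0 : ℝ) 1 <;> simp [h]
  eq_zero τ h := by simp [rectangle, h]
  pos_near_half := by
    filter_upwards [Icc_mem_nhds (show (0 : ℝ) < 1 / 2 by norm_num) (by norm_num : (1 : ℝ) / 2 < 1)]
      with τ hτ
    simp [rectangle, hτ]
  symm τ := by
    unfold rectangle
    have : (1 - τ ∈ Set.Icc (0 : ℝ) 1) ↔ τ ∈ Set.Icc (0 : ℝ) 1 := by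
      simp only [Set.mem_Icc]; constructor <;> rintro ⟨h1, h2⟩ <;> constructor <;> linarith
    by_cases h : τ ∈ Set.Icc (0 : ℝ) 1
    · rw [Set.indicator_of_mem h, Set.indicator_of_mem (this.2 h)]; rfl
    · rw [Set.indicator_of_notMem h, Set.indicator_of_notMem (mt this.1 h)]
  mono := by
    intro x hx y hy _
    unfold rectangle
    have hx' : x ∈ Set.Icc (0 : ℝ) 1 := ⟨hx.1, by linarith [hx.2]⟩
    have hy' : y ∈ Set.Icc (0 : ℝ) 1 := ⟨hy.1, by linarith [hy.2]⟩
    rw [Set.indicator_of_mem hx', Set.indicator_of_mem hy']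
    simp

lemma intWindow_rectangle {b r : ℕ} (hr : r < b) : intWindow rectangle b r = 1 := by
  unfold intWindow rectangle
  have hr' : (r : ℝ) + 1 ≤ b := by exact_mod_cast hr
  have hb : (0 : ℝ) < b := by have : (0 : ℝ) ≤ r := by positivity
                              linarith
  rw [Set.indicator_of_mem]
  · rfl
  · constructor
    · positivity
    · rw [div_le_one hb]; push_cast; linarith

lemma windowNorm_rectangle (b : ℕ) : windowNorm rectangle b = √b := by
  rw [← Real.sqrt_sq (windowNorm_nonneg _ b), windowNorm_sq,
    Finset.sum_congr rfl (g := fun _ => (1 : ℝ))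
      (fun r hr => by rw [intWindow_rectangle (Finset.mem_range.1 hr), one_pow])]
  simp

end Windows

/-! ### Moments of bounded functionals of finitely many innovations -/

section ScalarMoments

variable {Ω S : Type*} [MeasurableSpace Ω] [MeasurableSpace S] {P : Measure Ω}
  [IsProbabilityMeasure P] {δ : ℤ → Ω → S} {m : ℕ} {ψ : (Fin m → S) → ℝ} {K : ℝ}

/-- A bounded measurable function of `m` innovations with expectation zero. -/
structure CenteredFunctional (P : Measure Ω) (δ : ℤ → Ω → S) {m : ℕ} (ψ : (Fin m → S) → ℝ)
    (K : ℝ) : Prop where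
  measurable : Measurable ψ
  bound : ∀ u, |ψ u| ≤ K
  centered : ∀ t, ∫ ω, ψ (recent δ m t ω) ∂P = 0

/-- The autocovariance at lag `d`. -/
noncomputable def autocov (P : Measure Ω) (δ : ℤ → Ω → S) {m : ℕ} (ψ : (Fin m → S) → ℝ)
    (d : ℤ) : ℝ :=
  ∫ ω, ψ (recent δ m 0 ω) * ψ (recent δ m d ω) ∂P

/-- The sum of the autocovariances over all lags smaller than the range of dependence. -/
noncomputable def longRunVar (P : Measure Ω) (δ : ℤ → Ω → S) {m : ℕ} (ψ : (Fin m → S) → ℝ) : ℝ :=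
  ∑ d ∈ Finset.Ioo (-(m : ℤ)) m, autocov P δ ψ d

lemma sum_range_eq_sum_Ico_int (b : ℕ) (F : ℤ → ℝ) :
    ∑ r ∈ Finset.range b, F r = ∑ t ∈ Finset.Ico (0 : ℤ) b, F t := by
  rw [← Finset.sum_image (s := Finset.range b) (g := fun r : ℕ => (r : ℤ)) (f := F)
    (fun i _ j _ hij => by simpa using hij)]
  congr 1
  ext t
  simp only [Finset.mem_image, Finset.mem_range, Finset.mem_Ico]
  constructor
  · rintro ⟨r, hr, rfl⟩
    omega
  · rintro ⟨h1, h2⟩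
    exact ⟨t.toNat, by omega, by omega⟩

namespace CenteredFunctional

lemma bound_nonneg (hψ : CenteredFunctional P δ ψ K) : 0 ≤ K := by
  have : Nonempty Ω := nonempty_of_isProbabilityMeasure P
  exact (abs_nonneg _).trans (hψ.bound (recent δ m 0 (Classical.arbitrary Ω)))

lemma measurable_comp (hψ : CenteredFunctional P δ ψ K) (h : IsIID P δ) (t : ℤ) :
    Measurable fun ω => ψ (recent δ m t ω) :=
  hψ.measurable.comp (h.measurable_recent m t)

lemma measurable_field (hψ : CenteredFunctional P δ ψ K) {t : ℤ} {A : Set ℤ}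
    (hA : Set.Ioc (t - m) t ⊆ A) : Measurable[innovField δ A] fun ω => ψ (recent δ m t ω) :=
  hψ.measurable.comp (measurable_recent_field hA)

lemma memLp (hψ : CenteredFunctional P δ ψ K) (h : IsIID P δ) (t : ℤ) (p : ℝ≥0∞) :
    MemLp (fun ω => ψ (recent δ m t ω)) p P :=
  MemLp.of_bound (hψ.measurable_comp h t).aestronglyMeasurable K
    (ae_of_all _ fun _ => hψ.bound _)

lemma integral_mul_eq_autocov (hψ : CenteredFunctional P δ ψ K) (h : IsIID P δ) (s t : ℤ) :
    ∫ ω, ψ (recent δ m s ω) * ψ (recent δ m t ω) ∂P = autocov P δ ψ (t - s) := by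
  have h1 := (h.identDistrib_shift (F := fun x : ℤ → S =>
    ψ (fun j : Fin m => x (0 - (j : ℤ))) * ψ (fun j : Fin m => x (t - s - (j : ℤ)))) (by
      refine (hψ.measurable.comp ?_).mul (hψ.measurable.comp ?_) <;> fun_prop) s).integral_eq
  refine Eq.trans ?_ h1
  congr 1 with ω
  congr 2
  · ext j; simp [recent, sub_eq_add_neg]
  · ext j
    simp only [recent]
    congr 1
    ring

lemma integral_mul_eq_zero (hψ : CenteredFunctional P δ ψ K) (h : IsIID P δ) {s t : ℤ}
    (hst : s + m ≤ t) : ∫ ω, ψ (recent δ m s ω) * ψ (recent δ m t ω) ∂P = 0 := by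
  have hd : Disjoint (Set.Ioc (s - m) s) (Set.Ioc (t - m) t) := by
    rw [Set.disjoint_left]
    intro i hi hi'
    simp only [Set.mem_Ioc] at hi hi'
    omega
  have h1 := (h.indepFun hd (hψ.measurable_field le_rfl)
    (hψ.measurable_field le_rfl)).integral_fun_mul_eq_mul_integral
    (hψ.measurable_comp h s).aestronglyMeasurable (hψ.measurable_comp h t).aestronglyMeasurable
  rw [h1, hψ.centered s, zero_mul]

lemma autocov_eq_zero (hψ : CenteredFunctional P δ ψ K) (h : IsIID P δ) {d : ℤ}
    (hd : d ∉ Finset.Ioo (-(m : ℤ)) m) : autocov P δ ψ d = 0 := by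
  rw [Finset.mem_Ioo] at hd
  rcases le_or_gt (m : ℤ) d with h1 | h1
  · exact hψ.integral_mul_eq_zero h (by omega)
  · rw [autocov]
    simp_rw [mul_comm (ψ (recent δ m 0 _))]
    exact hψ.integral_mul_eq_zero h (by omega)

/-- The double sum is grouped by lag. Weights that vanish outside the block let every row run over
the same set of lags; by stationarity the result does not depend on `s`. -/
lemma integral_weighted_sum_sq (hψ : CenteredFunctional P δ ψ K) (h : IsIID P δ) {a : ℤ → ℝ} (b : ℕ)
    (ha : ∀ t : ℤ, t < 0 ∨ (b : ℤ) ≤ t → a t = 0) (s : ℤ) :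
    ∫ ω, (∑ r ∈ Finset.range b, a r * ψ (recent δ m (s + r) ω)) ^ 2 ∂P
      = ∑ d ∈ Finset.Ioo (-(m : ℤ)) m, autocov P δ ψ d * ∑ r ∈ Finset.range b, a r * a (r + d) := by
  have h1 := integral_norm_sq_sum_eq (μ := P) (Finset.range b) (fun r => a r)
    (X := fun r ω => ψ (recent δ m (s + (r : ℤ)) ω)) fun r _ => hψ.memLp h _ 2
  simp only [smul_eq_mul, Real.norm_eq_abs, sq_abs] at h1
  rw [h1]
  have h2 : ∀ i ∈ Finset.range b, ∑ j ∈ Finset.range b, a i * a j *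
      ∫ ω, inner ℝ (ψ (recent δ m (s + (i : ℤ)) ω)) (ψ (recent δ m (s + (j : ℤ)) ω)) ∂P
      = ∑ d ∈ Finset.Ioo (-(m : ℤ)) m, autocov P δ ψ d * (a i * a (i + d)) := by
    intro i hi
    have h3 : ∀ j : ℕ, ∫ ω, inner ℝ (ψ (recent δ m (s + (i : ℤ)) ω)) (ψ (recent δ m (s + (j : ℤ)) ω)) ∂P
        = autocov P δ ψ ((j : ℤ) - i) := by
      intro j
      rw [← add_sub_add_left_eq_sub (j : ℤ) i s, ← hψ.integral_mul_eq_autocov h]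
      congr 1 with ω
      simp [mul_comm]
    simp_rw [h3]
    rw [sum_range_eq_sum_Ico_int b (fun t => a i * a t * autocov P δ ψ (t - i))]
    -- Both index sets are compared through their union: outside the block the weight vanishes,
    -- outside the range of dependence the autocovariance does.
    have hsub1 : Finset.Ico (0 : ℤ) b ⊆ Finset.Ico (0 : ℤ) b ∪
        (Finset.Ioo (-(m : ℤ)) m).image (fun d => (i : ℤ) + d) := Finset.subset_union_left
    have hsub2 : (Finset.Ioo (-(m : ℤ)) m).image (fun d => (i : ℤ) + d) ⊆ Finset.Ico (0 : ℤ) b ∪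
        (Finset.Ioo (-(m : ℤ)) m).image (fun d => (i : ℤ) + d) := Finset.subset_union_right
    rw [Finset.sum_subset hsub1, ← Finset.sum_subset hsub2, Finset.sum_image]
    · refine Finset.sum_congr rfl fun d _ => ?_
      rw [add_sub_cancel_left]; ring
    · intro x _ y _ hxy; simpa using hxy
    · intro t _ ht
      rw [hψ.autocov_eq_zero h, mul_zero]
      intro hmem
      exact ht (Finset.mem_image.2 ⟨t - i, hmem, by ring⟩)
    · intro t _ ht
      rw [ha t (by simp only [Finset.mem_Ico] at ht; omega)]
      ring
  rw [Finset.sum_congr rfl h2, Finset.sum_comm]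
  simp_rw [Finset.mul_sum]

/-- The variance of tapered sums converges to the long run variance. -/
theorem tendsto_integral_taper_sum_sq (hψ : CenteredFunctional P δ ψ K) (h : IsIID P δ) {w : ℝ → ℝ}
    (hw : IsTaper w) (s : ℕ → ℤ) :
    Tendsto (fun b : ℕ => ∫ ω, (∑ r ∈ Finset.range b,
      intWindow w b r / windowNorm w b * ψ (recent δ m (s b + r) ω)) ^ 2 ∂P) atTop
      (𝓝 (longRunVar P δ ψ)) := by
  have h1 : Tendsto (fun b : ℕ => ∑ d ∈ Finset.Ioo (-(m : ℤ)) m, autocov P δ ψ d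
      * ∑ r ∈ Finset.range b, intWindow w b r / windowNorm w b *
        (intWindow w b (r + d) / windowNorm w b)) atTop (𝓝 (longRunVar P δ ψ)) := by
    have : longRunVar P δ ψ = ∑ d ∈ Finset.Ioo (-(m : ℤ)) m, autocov P δ ψ d * 1 := by
      simp [longRunVar]
    rw [this]
    exact tendsto_finsetSum _ fun d _ => (hw.tendsto_autocorrelation d).const_mul _
  refine h1.congr' ?_
  filter_upwards [eventually_ge_atTop 1] with b hb
  rw [hψ.integral_weighted_sum_sq h (a := fun t => intWindow w b t / windowNorm w b) b
    fun t ht => by rw [hw.intWindow_eq_zero hb ht, zero_div]]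

lemma integral_inner_eq_zero (hψ : CenteredFunctional P δ ψ K) (h : IsIID P δ) {s t : ℤ}
    (hst : s + m ≤ t) : ∫ ω, inner ℝ (ψ (recent δ m s ω)) (ψ (recent δ m t ω)) ∂P = 0 := by
  rw [← hψ.integral_mul_eq_zero h hst]
  congr 1 with ω
  simp [mul_comm]

lemma integral_sq_le (hψ : CenteredFunctional P δ ψ K) (h : IsIID P δ) (t : ℤ) :
    ∫ ω, ‖ψ (recent δ m t ω)‖ ^ 2 ∂P ≤ K ^ 2 := by
  have := integral_mono (integrable_norm_sq (hψ.memLp h t 2)) (integrable_const (K ^ 2)) fun ω =>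
    pow_le_pow_left₀ (norm_nonneg _) (hψ.bound (recent δ m t ω)) 2
  simpa using this

lemma integral_sum_sq_le (hψ : CenteredFunctional P δ ψ K) (h : IsIID P δ) (F : Finset ℤ)
    (a : ℤ → ℝ) : ∫ ω, (∑ t ∈ F, a t * ψ (recent δ m t ω)) ^ 2 ∂P
      ≤ 2 * (m * K ^ 2) * ∑ t ∈ F, a t ^ 2 := by
  have h1 := integral_norm_sq_sum_le_of_range (μ := P) F (p := id) Function.injective_id a
    (X := fun t ω => ψ (recent δ m t ω)) (fun t _ => hψ.memLp h t 2)
    (fun t _ => hψ.integral_sq_le h t) m (fun s _ t _ hst => hψ.integral_inner_eq_zero h hst)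
  simpa using h1

/-- Fourth moment bound for sums of independent terms. -/
lemma integral_sum_pow_four_le_of_separated (hψ : CenteredFunctional P δ ψ K) (h : IsIID P δ)
    (a : ℤ → ℝ) (F : Finset ℤ) (hF : ∀ s ∈ F, ∀ t ∈ F, s < t → s + m ≤ t) :
    ∫ ω, (∑ t ∈ F, a t * ψ (recent δ m t ω)) ^ 2 ∂P ≤ K ^ 2 * ∑ t ∈ F, a t ^ 2 ∧
    ∫ ω, (∑ t ∈ F, a t * ψ (recent δ m t ω)) ^ 4 ∂P ≤ 3 * K ^ 4 * (∑ t ∈ F, a t ^ 2) ^ 2 := by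
  -- The largest index `t` is separated from all others, so its term `Z` is independent of the
  -- partial sum `X`. As both are centered, the mixed terms with a first power vanish, leaving `E X⁴
  -- + 6 a² E X² E Z² + a⁴ E Z⁴`. The middle term requires the second moment bound, which is why
  -- both bounds are carried through the induction.
  induction F using Finset.induction_on_max with
  | empty => simp
  | insert t F hmax ih =>
    have htF : t ∉ F := fun ht => lt_irrefl _ (hmax t ht)
    obtain ⟨ih2, ih4⟩ := ih fun s hs u hu =>
      hF s (Finset.mem_insert_of_mem hs) u (Finset.mem_insert_of_mem hu)
    set X : Ω → ℝ := fun ω => ∑ t ∈ F, a t * ψ (recent δ m t ω) with hX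
    set Z : Ω → ℝ := fun ω => ψ (recent δ m t ω) with hZ
    set A := ∑ t ∈ F, a t ^ 2 with hA
    have hA0 : 0 ≤ A := Finset.sum_nonneg fun _ _ => sq_nonneg _
    have hK := hψ.bound_nonneg
    have hXf : Measurable[innovField δ (Set.Iic (t - m))] X := by
      refine Finset.measurable_sum _ fun s hs => (hψ.measurable_field ?_).const_mul _
      have := hF s (Finset.mem_insert_of_mem hs) t (Finset.mem_insert_self _ _) (hmax s hs)
      intro i hi
      have := hi.2
      simp only [Set.mem_Iic]
      omega
    have hZf : Measurable[innovField δ (Set.Ioc (t - m) t)] Z := hψ.measurable_field le_rfl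
    have hXZ : IndepFun X Z P := by
      refine h.indepFun ?_ hXf hZf
      rw [Set.disjoint_left]
      intro i hi hi'
      exact absurd hi'.1 (not_lt.2 hi)
    have hXm : Measurable X := hXf.mono (h.innovField_le _) le_rfl
    have hZm : Measurable Z := hψ.measurable_comp h t
    have hXb : ∀ ω, |X ω| ≤ ∑ t ∈ F, |a t| * K := fun ω => by
      refine (Finset.abs_sum_le_sum_abs _ _).trans (Finset.sum_le_sum fun s _ => ?_)
      rw [abs_mul]
      exact mul_le_mul_of_nonneg_left (hψ.bound _) (abs_nonneg _)
    have hZb : ∀ ω, |Z ω| ≤ K := fun ω => hψ.bound _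
    have hint : ∀ p q : ℕ, Integrable (fun ω => X ω ^ p * Z ω ^ q) P := fun p q => by
      refine Integrable.of_bound ((hXm.pow_const p).mul (hZm.pow_const q)).aestronglyMeasurable
        ((∑ t ∈ F, |a t| * K) ^ p * K ^ q) (ae_of_all _ fun ω => ?_)
      rw [norm_mul, norm_pow, norm_pow, Real.norm_eq_abs, Real.norm_eq_abs]
      gcongr
      · exact hXb ω
      · exact hZb ω
    have hmul : ∀ p q : ℕ, ∫ ω, X ω ^ p * Z ω ^ q ∂P = (∫ ω, X ω ^ p ∂P) * ∫ ω, Z ω ^ q ∂P := by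
      intro p q
      exact (hXZ.comp (measurable_id.pow_const p)
        (measurable_id.pow_const q)).integral_fun_mul_eq_mul_integral
        (hXm.pow_const p).aestronglyMeasurable (hZm.pow_const q).aestronglyMeasurable
    have hZ0 : ∫ ω, Z ω ∂P = 0 := hψ.centered t
    have hX0 : ∫ ω, X ω ∂P = 0 := by
      rw [hX, integral_finsetSum _ fun s _ => ((hψ.memLp h s 1).integrable le_rfl).const_mul _]
      exact Finset.sum_eq_zero fun s _ => by rw [integral_const_mul, hψ.centered, mul_zero]
    have hZp : ∀ q : ℕ, ∫ ω, Z ω ^ q ∂P ≤ K ^ q := by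
      intro q
      have h1 : Integrable (fun ω => Z ω ^ q) P := by simpa using hint 0 q
      have := integral_mono h1 (integrable_const (K ^ q)) fun ω =>
        (le_abs_self _).trans ((abs_pow _ _).le.trans (pow_le_pow_left₀ (abs_nonneg _) (hZb ω) q))
      simpa using this
    have hX2 : 0 ≤ ∫ ω, X ω ^ 2 ∂P := integral_nonneg fun _ => sq_nonneg _
    have e10 : ∫ ω, X ω * Z ω ∂P = 0 := by simpa [hZ0] using hmul 1 1
    have e31 : ∫ ω, X ω ^ 3 * Z ω ∂P = 0 := by simpa [hZ0] using hmul 3 1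
    have e13 : ∫ ω, X ω * Z ω ^ 3 ∂P = 0 := by simpa [hX0] using hmul 1 3
    have e22 := hmul 2 2
    have i20 : Integrable (fun ω => X ω ^ 2) P := by simpa using hint 2 0
    have i40 : Integrable (fun ω => X ω ^ 4) P := by simpa using hint 4 0
    have i02 : Integrable (fun ω => Z ω ^ 2) P := by simpa using hint 0 2
    have i04 : Integrable (fun ω => Z ω ^ 4) P := by simpa using hint 0 4
    have i11 : Integrable (fun ω => X ω * Z ω) P := by simpa using hint 1 1
    have i31 : Integrable (fun ω => X ω ^ 3 * Z ω) P := by simpa using hint 3 1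
    have i13 : Integrable (fun ω => X ω * Z ω ^ 3) P := by simpa using hint 1 3
    have i22 := hint 2 2
    have hsum : ∀ ω, ∑ s ∈ insert t F, a s * ψ (recent δ m s ω) = X ω + a t * Z ω := fun ω => by
      rw [Finset.sum_insert htF, add_comm]
    simp_rw [hsum]
    rw [Finset.sum_insert htF]
    have E2 : ∫ ω, (X ω + a t * Z ω) ^ 2 ∂P
        = (∫ ω, X ω ^ 2 ∂P) + a t ^ 2 * ∫ ω, Z ω ^ 2 ∂P := by
      have : ∀ ω, (X ω + a t * Z ω) ^ 2
          = X ω ^ 2 + 2 * a t * (X ω * Z ω) + a t ^ 2 * Z ω ^ 2 := fun ω => by ring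
      simp_rw [this]
      have j1 : Integrable (fun ω => X ω ^ 2 + 2 * a t * (X ω * Z ω)) P :=
        i20.add (i11.const_mul _)
      rw [integral_add j1 (i02.const_mul _),
        integral_add i20 (i11.const_mul _), integral_const_mul, integral_const_mul, e10]
      ring
    have E4 : ∫ ω, (X ω + a t * Z ω) ^ 4 ∂P
        = (∫ ω, X ω ^ 4 ∂P) + 6 * a t ^ 2 * ((∫ ω, X ω ^ 2 ∂P) * ∫ ω, Z ω ^ 2 ∂P)
          + a t ^ 4 * ∫ ω, Z ω ^ 4 ∂P := by
      have : ∀ ω, (X ω + a t * Z ω) ^ 4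
          = (X ω ^ 4 + 6 * a t ^ 2 * (X ω ^ 2 * Z ω ^ 2) + a t ^ 4 * Z ω ^ 4)
            + (4 * a t * (X ω ^ 3 * Z ω) + 4 * a t ^ 3 * (X ω * Z ω ^ 3)) := fun ω => by ring
      simp_rw [this]
      have j1 : Integrable (fun ω => X ω ^ 4 + 6 * a t ^ 2 * (X ω ^ 2 * Z ω ^ 2)) P :=
        i40.add (i22.const_mul _)
      have j2 : Integrable (fun ω => X ω ^ 4 + 6 * a t ^ 2 * (X ω ^ 2 * Z ω ^ 2)
          + a t ^ 4 * Z ω ^ 4) P := j1.add (i04.const_mul _)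
      have j3 : Integrable (fun ω => 4 * a t * (X ω ^ 3 * Z ω)
          + 4 * a t ^ 3 * (X ω * Z ω ^ 3)) P := (i31.const_mul _).add (i13.const_mul _)
      rw [integral_add j2 j3, integral_add j1 (i04.const_mul _),
        integral_add i40 (i22.const_mul _), integral_add (i31.const_mul _) (i13.const_mul _),
        integral_const_mul, integral_const_mul, integral_const_mul, integral_const_mul,
        e31, e13, e22]
      ring
    rw [E2, E4]
    have hz2 := hZp 2
    have hz4 := hZp 4
    have hz20 : 0 ≤ ∫ ω, Z ω ^ 2 ∂P := integral_nonneg fun _ => sq_nonneg _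
    constructor
    · nlinarith [sq_nonneg (a t)]
    · have h5 : (∫ ω, X ω ^ 2 ∂P) * ∫ ω, Z ω ^ 2 ∂P ≤ (K ^ 2 * A) * K ^ 2 :=
        mul_le_mul ih2 hz2 hz20 (by positivity)
      have h6 : 6 * a t ^ 2 * ((∫ ω, X ω ^ 2 ∂P) * ∫ ω, Z ω ^ 2 ∂P)
          ≤ 6 * a t ^ 2 * ((K ^ 2 * A) * K ^ 2) := by gcongr
      have h7 : a t ^ 4 * ∫ ω, Z ω ^ 4 ∂P ≤ a t ^ 4 * K ^ 4 := by gcongr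
      have h8 : 0 ≤ a t ^ 4 * K ^ 4 := by positivity
      nlinarith

/-- Fourth moment bound for weighted sums. -/
theorem integral_sum_pow_four_le (hψ : CenteredFunctional P δ ψ K) (h : IsIID P δ)
    (a : ℤ → ℝ) (F : Finset ℤ) :
    ∫ ω, (∑ t ∈ F, a t * ψ (recent δ m t ω)) ^ 4 ∂P
      ≤ (m + 1) ^ 4 * (3 * K ^ 4) * (∑ t ∈ F, a t ^ 2) ^ 2 := by
  -- Distinct times in one residue class modulo `m + 1` are separated by the range of dependence.
  -- Recombining the `m + 1` classes by two applications of the quadratic mean inequality costs `(m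
  -- + 1) ^ 3`, and summing their bounds another factor `m + 1`.
  set M : ℤ := (m : ℤ) + 1 with hM
  have hMpos : 0 < M := by omega
  set R := Finset.Ico (0 : ℤ) M with hR
  set G : ℤ → Finset ℤ := fun q => F.filter fun t => t % M = q with hG
  set A := ∑ t ∈ F, a t ^ 2 with hA
  have hcard : R.card = m + 1 := by simp [hR, hM]
  have hsplit : ∀ g : ℤ → ℝ, ∑ t ∈ F, g t = ∑ q ∈ R, ∑ t ∈ G q, g t := by
    intro g
    refine (Finset.sum_fiberwise_of_maps_to (fun t _ => ?_) g).symm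
    rw [hR, Finset.mem_Ico]
    exact ⟨Int.emod_nonneg _ hMpos.ne', Int.emod_lt_of_pos _ hMpos⟩
  have hsep : ∀ q, ∀ s ∈ G q, ∀ t ∈ G q, s < t → s + m ≤ t := by
    intro q s hs t ht hst
    have h1 := (Finset.mem_filter.1 hs).2
    have h2 := (Finset.mem_filter.1 ht).2
    have h3 : M ∣ t - s := Int.ModEq.dvd (show s ≡ t [ZMOD M] by rw [Int.ModEq, h1, h2])
    have h4 := Int.le_of_dvd (by omega) h3
    omega
  have hGA : ∀ q, ∑ t ∈ G q, a t ^ 2 ≤ A := fun q =>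
    Finset.sum_le_sum_of_subset_of_nonneg (Finset.filter_subset _ _) fun _ _ _ => sq_nonneg _
  have hK := hψ.bound_nonneg
  have hint : ∀ q, Integrable (fun ω => (∑ t ∈ G q, a t * ψ (recent δ m t ω)) ^ 4) P := by
    intro q
    refine Integrable.of_bound ((Finset.measurable_sum _ fun s _ =>
      (hψ.measurable_comp h s).const_mul _).pow_const 4).aestronglyMeasurable
      ((∑ t ∈ G q, |a t| * K) ^ 4) (ae_of_all _ fun ω => ?_)
    rw [norm_pow]
    gcongr
    refine (norm_sum_le _ _).trans (Finset.sum_le_sum fun s _ => ?_)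
    rw [norm_mul]
    exact mul_le_mul_of_nonneg_left (hψ.bound _) (norm_nonneg _)
  have hpt : ∀ ω, (∑ t ∈ F, a t * ψ (recent δ m t ω)) ^ 4
      ≤ (m + 1) ^ 3 * ∑ q ∈ R, (∑ t ∈ G q, a t * ψ (recent δ m t ω)) ^ 4 := by
    intro ω
    rw [hsplit]
    set x : ℤ → ℝ := fun q => ∑ t ∈ G q, a t * ψ (recent δ m t ω)
    have h1 : (∑ q ∈ R, x q) ^ 2 ≤ (m + 1) * ∑ q ∈ R, x q ^ 2 := by
      have := sq_sum_le_card_mul_sum_sq (s := R) (f := x)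
      rw [hcard] at this; exact_mod_cast this
    have h2 : (∑ q ∈ R, x q ^ 2) ^ 2 ≤ (m + 1) * ∑ q ∈ R, (x q ^ 2) ^ 2 := by
      have := sq_sum_le_card_mul_sum_sq (s := R) (f := fun q => x q ^ 2)
      rw [hcard] at this; exact_mod_cast this
    calc (∑ q ∈ R, x q) ^ 4 = ((∑ q ∈ R, x q) ^ 2) ^ 2 := by ring
      _ ≤ ((m + 1) * ∑ q ∈ R, x q ^ 2) ^ 2 := by gcongr
      _ = (m + 1) ^ 2 * (∑ q ∈ R, x q ^ 2) ^ 2 := by ring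
      _ ≤ (m + 1) ^ 2 * ((m + 1) * ∑ q ∈ R, (x q ^ 2) ^ 2) := by gcongr
      _ = (m + 1) ^ 3 * ∑ q ∈ R, x q ^ 4 := by
          have : ∀ q, (x q ^ 2) ^ 2 = x q ^ 4 := fun q => by ring
          simp_rw [this]; ring
  calc _ ≤ ∫ ω, (m + 1) ^ 3 * ∑ q ∈ R, (∑ t ∈ G q, a t * ψ (recent δ m t ω)) ^ 4 ∂P := by
        refine integral_mono_of_nonneg (ae_of_all _ fun ω => by positivity)
          ((integrable_finsetSum _ fun q _ => hint q).const_mul _) (ae_of_all _ hpt)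
    _ = (m + 1) ^ 3 * ∑ q ∈ R, ∫ ω, (∑ t ∈ G q, a t * ψ (recent δ m t ω)) ^ 4 ∂P := by
        rw [integral_const_mul, integral_finsetSum _ fun q _ => hint q]
    _ ≤ (m + 1) ^ 3 * ∑ q ∈ R, 3 * K ^ 4 * A ^ 2 := by
        gcongr with q _
        refine (hψ.integral_sum_pow_four_le_of_separated h a (G q) (hsep q)).2.trans ?_
        have := hGA q
        have h0 : 0 ≤ ∑ t ∈ G q, a t ^ 2 := Finset.sum_nonneg fun _ _ => sq_nonneg _
        gcongr
    _ = _ := by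
        rw [Finset.sum_const, hcard, nsmul_eq_mul]
        push_cast
        ring

end CenteredFunctional

end ScalarMoments

/-! ### The bootstrap mean as a sum of independent block statistics -/

section Bootstrap

variable {H : Type*} [NormedAddCommGroup H] [InnerProductSpace ℝ H]

/-- The normalized tapered sum over the block that starts at time `i + 1`. -/
noncomputable def blockSum (w : ℝ → ℝ) (b : ℕ) (y : ℕ → H) (i : ℕ) : H :=
  ∑ r ∈ Finset.range b, (intWindow w b r / windowNorm w b) • y (i + 1 + r)

/-- The average of the block sums. -/
noncomputable def blockMean (w : ℝ → ℝ) (k b : ℕ) (y : ℕ → H) : H :=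
  (numBlocks (k * b) b : ℝ)⁻¹ • ∑ i : Fin (numBlocks (k * b) b), blockSum w b y i

/-- The uniform distribution on the block numbers. -/
noncomputable def blockLaw (k b : ℕ) : Measure (Fin (numBlocks (k * b) b)) :=
  (PMF.uniformOfFintype (Fin (numBlocks (k * b) b))).toMeasure

instance (k b : ℕ) : IsProbabilityMeasure (blockLaw k b) :=
  PMF.toMeasure.isProbabilityMeasure _

lemma drawLaw_eq (k b : ℕ) :
    (drawLaw k b : Measure (Draw k b)) = Measure.pi fun _ => blockLaw k b := rfl

lemma integral_blockLaw {E : Type*} [NormedAddCommGroup E] [NormedSpace ℝ E] [CompleteSpace E]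
    (k b : ℕ) (g : Fin (numBlocks (k * b) b) → E) :
    ∫ i, g i ∂(blockLaw k b) = (numBlocks (k * b) b : ℝ)⁻¹ • ∑ i, g i := by
  rw [blockLaw, PMF.integral_eq_sum, Finset.smul_sum]
  refine Finset.sum_congr rfl fun i _ => ?_
  rw [PMF.uniformOfFintype_apply, Fintype.card_fin, ENNReal.toReal_inv, ENNReal.toReal_natCast]

lemma integral_drawLaw_eval {E : Type*} [NormedAddCommGroup E] [NormedSpace ℝ E]
    (k b : ℕ) (j : Fin k) (g : Fin (numBlocks (k * b) b) → E) :
    ∫ I, g (I j) ∂(drawLaw k b : Measure (Draw k b)) = ∫ i, g i ∂(blockLaw k b) := by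
  rw [drawLaw_eq]
  have h := measurePreserving_eval (fun _ : Fin k => blockLaw k b) j
  have h2 := integral_map (μ := Measure.pi fun _ : Fin k => blockLaw k b)
    h.measurable.aemeasurable (f := g) (StronglyMeasurable.of_discrete).aestronglyMeasurable
  rw [h.map_eq] at h2
  exact h2.symm

/-- Positions are regrouped into draws and offsets. Centering at the sample mean contributes the
same vector for every draw, which is why it cancels in `bootDev`. -/
lemma bootMean_eq (w : ℝ → ℝ) (k b : ℕ) (y : ℕ → H) (I : Draw k b) :
    bootMean w k b y I = (((k * b : ℕ) : ℝ)⁻¹ * √b) • ∑ j, (blockSum w b y (I j)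
      - (∑ r ∈ Finset.range b, intWindow w b r / windowNorm w b) • sampleMean (k * b) y) := by
  have h1 : ∑ s, pseudoObs w k b y I s
      = ∑ j : Fin k, ∑ r : Fin b, taperedBlock w (k * b) b y (I j) r := by
    rw [← Fintype.sum_prod_type']
    exact Fintype.sum_equiv finProdFinEquiv.symm _ _ fun s => rfl
  rw [bootMean, h1, mul_smul, Finset.smul_sum (r := √b)]
  congr 1
  refine Finset.sum_congr rfl fun j _ => ?_
  rw [Finset.sum_smul, blockSum, ← Finset.sum_sub_distrib, Finset.smul_sum,
    Finset.sum_range (fun r => √b • ((intWindow w b r / windowNorm w b) • y (↑(I j) + 1 + r)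
      - (intWindow w b r / windowNorm w b) • sampleMean (k * b) y))]
  refine Finset.sum_congr rfl fun r _ => ?_
  rw [taperedBlock, window_succ, centered, ← smul_sub, smul_smul]
  congr 1
  ring

variable [CompleteSpace H]

lemma blockMean_eq_integral (w : ℝ → ℝ) (k b : ℕ) (y : ℕ → H) :
    blockMean w k b y = ∫ i, blockSum w b y (i : ℕ) ∂(blockLaw k b) := by
  rw [integral_blockLaw, blockMean]

/-- The scaled bootstrap deviation is a normalized sum of independent centered block sums. -/
theorem scaled_bootDev_eq (w : ℝ → ℝ) (k : ℕ) {b : ℕ} (hb : 1 ≤ b) (y : ℕ → H) (I : Draw k b) :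
    √((k * b : ℕ) : ℝ) • bootDev w k b y I
      = (√k)⁻¹ • ∑ j, (blockSum w b y (I j) - blockMean w k b y) := by
  set v := (∑ r ∈ Finset.range b, intWindow w b r / windowNorm w b) • sampleMean (k * b) y with hv
  have h1 : ∫ J, bootMean w k b y J ∂(drawLaw k b : Measure (Draw k b))
      = (((k * b : ℕ) : ℝ)⁻¹ * √b) • ∑ _j : Fin k, (blockMean w k b y - v) := by
    simp_rw [bootMean_eq, ← hv]
    rw [integral_smul, integral_finsetSum _ fun j _ => Integrable.of_finite]
    congr 1
    refine Finset.sum_congr rfl fun j _ => ?_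
    rw [integral_drawLaw_eval k b j (fun i => blockSum w b y (i : ℕ) - v),
      integral_sub Integrable.of_finite (integrable_const _), blockMean_eq_integral]
    simp
  rw [bootDev, h1, bootMean_eq, ← hv, ← smul_sub, ← Finset.sum_sub_distrib, smul_smul]
  congr 1
  -- The scalar factors: `√(k b) (k b)⁻¹ √b = 1 / √k`.
  · have hb0 : (0 : ℝ) < b := by exact_mod_cast hb
    rcases Nat.eq_zero_or_pos k with rfl | hk
    · simp
    have hk0 : (0 : ℝ) < k := by exact_mod_cast hk
    push_cast
    rw [Real.sqrt_mul hk0.le]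
    have e1 := Real.mul_self_sqrt hb0.le
    have e2 := Real.mul_self_sqrt hk0.le
    have e3 : √(k : ℝ) ≠ 0 := (Real.sqrt_pos.2 hk0).ne'
    field_simp
    nlinarith
  · refine Finset.sum_congr rfl fun j _ => ?_
    abel

lemma blockSum_sum_smul {κ : Type*} [Fintype κ] (w : ℝ → ℝ) (b : ℕ) (ξ : κ → ℕ → ℝ) (x : κ → H)
    (i : ℕ) : blockSum w b (fun t => ∑ q, ξ q t • x q) i = ∑ q, blockSum w b (ξ q) i • x q := by
  simp only [blockSum, Finset.smul_sum, Finset.sum_smul, smul_eq_mul, smul_smul]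
  rw [Finset.sum_comm]

lemma blockSum_sub (w : ℝ → ℝ) (b : ℕ) (y z : ℕ → H) (i : ℕ) :
    blockSum w b (fun t => y t - z t) i = blockSum w b y i - blockSum w b z i := by
  simp only [blockSum, smul_sub, Finset.sum_sub_distrib]

lemma blockSum_add (w : ℝ → ℝ) (b : ℕ) (y z : ℕ → H) (i : ℕ) :
    blockSum w b (fun t => y t + z t) i = blockSum w b y i + blockSum w b z i := by
  simp only [blockSum, smul_add, Finset.sum_add_distrib]

lemma scaled_bootDev_sum_smul {κ : Type*} [Fintype κ] (w : ℝ → ℝ) (k : ℕ) {b : ℕ} (hb : 1 ≤ b)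
    (ξ : κ → ℕ → ℝ) (x : κ → H) (I : Draw k b) :
    √((k * b : ℕ) : ℝ) • bootDev w k b (fun t => ∑ q, ξ q t • x q) I
      = ∑ q, (√((k * b : ℕ) : ℝ) • bootDev w k b (ξ q) I) • x q := by
  simp_rw [scaled_bootDev_eq w k hb, blockMean, blockSum_sum_smul]
  rw [Finset.sum_comm]
  simp only [smul_eq_mul, Finset.smul_sum, ← Finset.sum_smul, smul_smul, ← sub_smul,
    ← Finset.sum_sub_distrib]
  rw [Finset.sum_comm]
  refine Finset.sum_congr rfl fun q _ => ?_
  rw [← Finset.sum_smul, ← Finset.mul_sum]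

/-- Linearity in the data: the error of approximating one series by another is itself a bootstrap
deviation. -/
lemma scaled_bootDev_sub (w : ℝ → ℝ) (k : ℕ) {b : ℕ} (hb : 1 ≤ b) (y z : ℕ → H) (I : Draw k b) :
    √((k * b : ℕ) : ℝ) • bootDev w k b y I - √((k * b : ℕ) : ℝ) • bootDev w k b z I
      = √((k * b : ℕ) : ℝ) • bootDev w k b (fun t => y t - z t) I := by
  simp_rw [scaled_bootDev_eq w k hb, blockMean, blockSum_sub, ← smul_sub,
    ← Finset.sum_sub_distrib]
  congr 1
  refine Finset.sum_congr rfl fun j _ => ?_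
  rw [Finset.sum_sub_distrib, smul_sub]
  abel

lemma scaled_bootDev_add (w : ℝ → ℝ) (k : ℕ) {b : ℕ} (hb : 1 ≤ b) (y z : ℕ → H) (I : Draw k b) :
    √((k * b : ℕ) : ℝ) • bootDev w k b y I + √((k * b : ℕ) : ℝ) • bootDev w k b z I
      = √((k * b : ℕ) : ℝ) • bootDev w k b (fun t => y t + z t) I := by
  simp_rw [scaled_bootDev_eq w k hb, blockMean, blockSum_add, ← smul_add,
    ← Finset.sum_add_distrib]
  congr 1
  refine Finset.sum_congr rfl fun j _ => ?_
  rw [Finset.sum_add_distrib, smul_add]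
  abel

lemma integral_norm_sq_sub_integral {α : Type*} [MeasurableSpace α] {μ : Measure α}
    [IsProbabilityMeasure μ] {X : α → H} (hX : MemLp X 2 μ) :
    ∫ a, ‖X a - ∫ a', X a' ∂μ‖ ^ 2 ∂μ = ∫ a, ‖X a‖ ^ 2 ∂μ - ‖∫ a, X a ∂μ‖ ^ 2 := by
  set v := ∫ a, X a ∂μ with hv
  have h1 : ∀ a, ‖X a - v‖ ^ 2 = ‖X a‖ ^ 2 - 2 * inner ℝ (X a) v + ‖v‖ ^ 2 := fun a =>
    norm_sub_sq_real _ _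
  have hi : Integrable (fun a => inner ℝ (X a) v) μ :=
    (hX.inner_const v).integrable one_le_two
  have h2 : Integrable (fun a => ‖X a‖ ^ 2 - 2 * inner ℝ (X a) v) μ :=
    (integrable_norm_sq hX).sub (hi.const_mul _)
  simp_rw [h1]
  rw [integral_add h2 (integrable_const _), integral_sub (integrable_norm_sq hX) (hi.const_mul _),
    integral_const_mul]
  have h3 : ∫ a, inner ℝ (X a) v ∂μ = ‖v‖ ^ 2 := by
    simp_rw [real_inner_comm v]
    rw [integral_inner (hX.integrable one_le_two), ← hv, real_inner_self_eq_norm_sq]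
  rw [h3]
  simp
  ring

/-- The conditional second moment of the scaled bootstrap deviation. -/
theorem integral_norm_sq_scaled_bootDev (w : ℝ → ℝ) {k b : ℕ} (hk : 1 ≤ k) (hb : 1 ≤ b)
    (y : ℕ → H) :
    ∫ I, ‖√((k * b : ℕ) : ℝ) • bootDev w k b y I‖ ^ 2 ∂(drawLaw k b : Measure (Draw k b))
      = (numBlocks (k * b) b : ℝ)⁻¹ * ∑ i : Fin (numBlocks (k * b) b), ‖blockSum w b y i‖ ^ 2
        - ‖blockMean w k b y‖ ^ 2 := by
  -- Independence of the `H`-valued summands needs a σ-algebra on `H`; the conclusion does not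
  -- depend on it.
  let _ : MeasurableSpace H := borel H
  have : BorelSpace H := ⟨rfl⟩
  set g : Fin (numBlocks (k * b) b) → H := fun i => blockSum w b y i - blockMean w k b y with hg
  have hL : ∀ j : Fin k, MemLp (fun I : Draw k b => g (I j)) 2
      (drawLaw k b : Measure (Draw k b)) := fun j => MemLp.of_discrete
  have hg0 : ∫ i, g i ∂(blockLaw k b) = 0 := by
    rw [hg, integral_sub Integrable.of_finite (integrable_const _), blockMean_eq_integral]
    simp
  have h1 := integral_norm_sq_sum_eq (μ := (drawLaw k b : Measure (Draw k b))) Finset.univ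
    (fun _ : Fin k => (√k)⁻¹) (X := fun j (I : Draw k b) => g (I j)) (fun j _ => hL j)
  simp_rw [← Finset.smul_sum] at h1
  simp_rw [scaled_bootDev_eq w k hb]
  refine h1.trans ?_
  have hoff : ∀ i j : Fin k, i ≠ j → ∫ I : Draw k b, inner ℝ (g (I i)) (g (I j))
      ∂(drawLaw k b : Measure (Draw k b)) = 0 := by
    intro i j hij
    have hind : iIndepFun (fun (i : Fin k) (I : Draw k b) => g (I i))
        (Measure.pi fun _ : Fin k => blockLaw k b) :=
      iIndepFun_pi (X := fun _ => g) fun _ => Measurable.of_discrete.aemeasurable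
    have h2 := (hind.indepFun hij).integral_bilin Integrable.of_finite Integrable.of_finite
      (innerSL ℝ)
    rw [drawLaw_eq]
    refine Eq.trans h2 ?_
    have h3 := integral_drawLaw_eval k b i g
    rw [drawLaw_eq] at h3
    rw [h3, hg0, map_zero]
    rfl
  have hdiag : ∀ i : Fin k, ∫ I : Draw k b, inner ℝ (g (I i)) (g (I i))
      ∂(drawLaw k b : Measure (Draw k b)) = ∫ i, ‖g i‖ ^ 2 ∂(blockLaw k b) := by
    intro i
    rw [← integral_drawLaw_eval k b i (fun i => ‖g i‖ ^ 2)]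
    simp_rw [real_inner_self_eq_norm_sq]
  have hrow : ∀ i : Fin k, ∑ j : Fin k, (√(k : ℝ))⁻¹ * (√k)⁻¹ *
      ∫ I : Draw k b, inner ℝ (g (I i)) (g (I j)) ∂(drawLaw k b : Measure (Draw k b))
      = (k : ℝ)⁻¹ * ∫ i, ‖g i‖ ^ 2 ∂(blockLaw k b) := by
    intro i
    rw [Finset.sum_eq_single i (fun j _ hij => by rw [hoff i j hij.symm, mul_zero]) (by simp),
      hdiag, ← mul_inv, Real.mul_self_sqrt (by positivity)]
  simp_rw [hrow]
  have hk0 : (k : ℝ) ≠ 0 := by exact_mod_cast (by omega : k ≠ 0)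
  have hvar := integral_norm_sq_sub_integral (μ := blockLaw k b)
    (X := fun i : Fin (numBlocks (k * b) b) => blockSum w b y (i : ℕ)) MemLp.of_discrete
  rw [← blockMean_eq_integral] at hvar
  rw [Finset.sum_const, Finset.card_univ, Fintype.card_fin, nsmul_eq_mul, ← mul_assoc,
    mul_inv_cancel₀ hk0, one_mul, hvar, integral_blockLaw, smul_eq_mul]

lemma integral_norm_sq_scaled_bootDev_le (w : ℝ → ℝ) {k b : ℕ} (hk : 1 ≤ k) (hb : 1 ≤ b)
    (y : ℕ → H) :
    ∫ I, ‖√((k * b : ℕ) : ℝ) • bootDev w k b y I‖ ^ 2 ∂(drawLaw k b : Measure (Draw k b))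
      ≤ (numBlocks (k * b) b : ℝ)⁻¹
        * ∑ i : Fin (numBlocks (k * b) b), ‖blockSum w b y i‖ ^ 2 := by
  rw [integral_norm_sq_scaled_bootDev w hk hb]
  exact sub_le_self _ (sq_nonneg _)

/-- The conditional variance of the scaled bootstrap deviation of real observations. -/
noncomputable def bootVar (w : ℝ → ℝ) (k b : ℕ) (y : ℕ → ℝ) : ℝ :=
  ∫ I, (√((k * b : ℕ) : ℝ) • bootDev w k b y I) ^ 2 ∂(drawLaw k b : Measure (Draw k b))

lemma bootVar_eq (w : ℝ → ℝ) {k b : ℕ} (hk : 1 ≤ k) (hb : 1 ≤ b) (y : ℕ → ℝ) :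
    bootVar w k b y = (numBlocks (k * b) b : ℝ)⁻¹
      * ∑ i : Fin (numBlocks (k * b) b), blockSum w b y i ^ 2 - blockMean w k b y ^ 2 := by
  have h := integral_norm_sq_scaled_bootDev w hk hb y
  simp only [Real.norm_eq_abs, sq_abs] at h
  exact h

lemma bootVar_eq_integral_blockLaw (w : ℝ → ℝ) {k b : ℕ} (hk : 1 ≤ k) (hb : 1 ≤ b) (y : ℕ → ℝ) :
    bootVar w k b y = ∫ i : Fin (numBlocks (k * b) b),
      (blockSum w b y i - blockMean w k b y) ^ 2 ∂(blockLaw k b) := by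
  have hvar := integral_norm_sq_sub_integral (μ := blockLaw k b)
    (X := fun i : Fin (numBlocks (k * b) b) => blockSum w b y (i : ℕ)) MemLp.of_discrete
  rw [← blockMean_eq_integral, integral_blockLaw k b (fun i => ‖blockSum w b y i‖ ^ 2)] at hvar
  simp only [Real.norm_eq_abs, sq_abs] at hvar
  rw [hvar, bootVar_eq w hk hb, smul_eq_mul]

/-- Given the data, the draws are independent with a common law, so the characteristic function is a
power. -/
lemma integral_exp_scaled_bootDev (w : ℝ → ℝ) (k : ℕ) {b : ℕ} (hb : 1 ≤ b) (y : ℕ → ℝ) :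
    ∫ I, Complex.exp ((√((k * b : ℕ) : ℝ) • bootDev w k b y I : ℝ) * Complex.I)
        ∂(drawLaw k b : Measure (Draw k b))
      = (∫ i : Fin (numBlocks (k * b) b), Complex.exp
        (((√k)⁻¹ * (blockSum w b y i - blockMean w k b y) : ℝ) * Complex.I) ∂(blockLaw k b)) ^ k := by
  have h := integral_fintype_prod_eq_pow (ι := Fin k) (μ := blockLaw k b)
    (fun i : Fin (numBlocks (k * b) b) => Complex.exp
        (((√k)⁻¹ * (blockSum w b y i - blockMean w k b y) : ℝ) * Complex.I))
  rw [Fintype.card_fin] at h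
  rw [← h, drawLaw_eq]
  congr 1 with I
  rw [scaled_bootDev_eq w k hb, ← Complex.exp_sum, ← Finset.sum_mul, smul_eq_mul, Finset.mul_sum]
  push_cast
  rfl

end Bootstrap

/-! ### Consistency of the bootstrap variance for bounded functionals of finitely many innovations -/

/-- The asymptotic regime: the block length grows, but more slowly than the number of blocks. -/
structure BlockRegime (k b : ℕ → ℕ) : Prop where
  one_le_k : ∀ j, 1 ≤ k j
  one_le_b : ∀ j, 1 ≤ b j
  tendsto_b : Tendsto b atTop atTop
  tendsto_ratio : Tendsto (fun j => √(b j : ℝ) / √(k j)) atTop (𝓝 0)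

namespace BlockRegime

variable {k b : ℕ → ℕ}

lemma comp (h : BlockRegime k b) {φ : ℕ → ℕ} (hφ : Tendsto φ atTop atTop) :
    BlockRegime (k ∘ φ) (b ∘ φ) where
  one_le_k _ := h.one_le_k _
  one_le_b _ := h.one_le_b _
  tendsto_b := h.tendsto_b.comp hφ
  tendsto_ratio := h.tendsto_ratio.comp hφ

lemma tendsto_inv_k (h : BlockRegime k b) : Tendsto (fun j => (k j : ℝ)⁻¹) atTop (𝓝 0) := by
  have h1 : Tendsto (fun j => (√(b j : ℝ) / √(k j)) ^ 2) atTop (𝓝 0) := by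
    simpa using h.tendsto_ratio.pow 2
  refine squeeze_zero (fun j => by positivity) (fun j => ?_) h1
  rw [div_pow, Real.sq_sqrt (by positivity), Real.sq_sqrt (by positivity), inv_eq_one_div]
  have : (1 : ℝ) ≤ b j := by exact_mod_cast h.one_le_b j
  gcongr

lemma tendsto_k (h : BlockRegime k b) : Tendsto k atTop atTop := by
  have h1 : Tendsto (fun j => (k j : ℝ)⁻¹) atTop (𝓝[>] 0) :=
    tendsto_nhdsWithin_iff.2 ⟨h.tendsto_inv_k, Eventually.of_forall fun j => by
      have : (0 : ℝ) < k j := by exact_mod_cast h.one_le_k j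
      simpa using this⟩
  have h2 := h1.inv_tendsto_nhdsGT_zero
  exact tendsto_natCast_atTop_iff.1 (h2.congr fun j => by simp)

lemma tendsto_n (h : BlockRegime k b) : Tendsto (fun j => k j * b j) atTop atTop :=
  h.tendsto_k.atTop_mul_atTop₀ h.tendsto_b

/-- Once `k ≥ 2`, the number of blocks is at least `k * b / 2`, so the ratio is of order `1 / k`. It
controls the variance of averages over overlapping blocks, whose range of dependence is `b + m`. -/
lemma tendsto_range_div_numBlocks (h : BlockRegime k b) (m : ℕ) :
    Tendsto (fun j => ((b j + m : ℕ) : ℝ) / numBlocks (k j * b j) (b j)) atTop (𝓝 0) := by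
  have h1 : Tendsto (fun j => 2 * (1 + (m : ℝ)) * (k j : ℝ)⁻¹) atTop (𝓝 0) := by
    simpa using h.tendsto_inv_k.const_mul (2 * (1 + (m : ℝ)))
  refine squeeze_zero' (Eventually.of_forall fun j => by positivity) ?_ h1
  filter_upwards [h.tendsto_k.eventually_ge_atTop 2] with j hj
  have hb : (1 : ℝ) ≤ b j := by exact_mod_cast h.one_le_b j
  have hk : (2 : ℝ) ≤ k j := by exact_mod_cast hj
  have hle : b j ≤ k j * b j := Nat.le_mul_of_pos_left _ (by omega)
  have hN : (numBlocks (k j * b j) (b j) : ℝ) = k j * b j - b j + 1 := by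
    rw [numBlocks]; push_cast [Nat.cast_sub hle]; ring
  have hN2 : (k j : ℝ) * b j / 2 ≤ numBlocks (k j * b j) (b j) := by rw [hN]; nlinarith
  have hpos : (0 : ℝ) < k j * b j / 2 := by positivity
  refine (div_le_div_of_nonneg_left (by positivity) hpos hN2).trans ?_
  rw [div_le_iff₀ hpos]
  push_cast
  have : 2 * (1 + (m : ℝ)) * (k j : ℝ)⁻¹ * (k j * b j / 2) = (1 + m) * b j := by
    field_simp
  rw [this]
  nlinarith [(Nat.cast_nonneg m : (0 : ℝ) ≤ m)]

end BlockRegime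

section ScalarBootstrap

variable {Ω S : Type*} [MeasurableSpace Ω] [MeasurableSpace S] {P : Measure Ω}
  [IsProbabilityMeasure P] {δ : ℤ → Ω → S} {m : ℕ} {ψ : (Fin m → S) → ℝ} {K : ℝ}

/-- The observed stretch of the scalar process `ψ (δ_t, …, δ_{t-m+1})`. -/
def scalarObs (δ : ℤ → Ω → S) {m : ℕ} (ψ : (Fin m → S) → ℝ) (ω : Ω) (t : ℕ) : ℝ :=
  ψ (recent δ m (t : ℤ) ω)

namespace CenteredFunctional

lemma blockSum_scalarObs (w : ℝ → ℝ) (b i : ℕ) (ω : Ω) :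
    blockSum w b (scalarObs δ ψ ω) i = ∑ r ∈ Finset.range b,
      intWindow w b r / windowNorm w b * ψ (recent δ m ((i + 1 : ℤ) + r) ω) := by
  simp [blockSum, scalarObs]

lemma measurable_blockSum_field (hψ : CenteredFunctional P δ ψ K) (w : ℝ → ℝ) (b i : ℕ) :
    Measurable[innovField δ (Set.Ioc (i + 1 - m : ℤ) (i + b))]
      fun ω => blockSum w b (scalarObs δ ψ ω) i := by
  simp_rw [blockSum_scalarObs]
  refine Finset.measurable_sum _ fun r hr => (hψ.measurable_field fun t ht => ?_).const_mul _
  simp only [Finset.mem_range, Set.mem_Ioc] at *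
  omega

lemma measurable_blockSum (hψ : CenteredFunctional P δ ψ K) (h : IsIID P δ) (w : ℝ → ℝ)
    (b i : ℕ) : Measurable fun ω => blockSum w b (scalarObs δ ψ ω) i :=
  (hψ.measurable_blockSum_field w b i).mono (h.innovField_le _) le_rfl

/-- Cauchy–Schwarz with normalized weights. Against the factor `1 / √k` of the bootstrap, this makes
the summands uniformly small in the regime `√b / √k → 0`. -/
lemma abs_blockSum_le (hψ : CenteredFunctional P δ ψ K) (w : ℝ → ℝ) (b i : ℕ) (ω : Ω) :
    |blockSum w b (scalarObs δ ψ ω) i| ≤ K * √b := by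
  set c : ℕ → ℝ := fun r => intWindow w b r / windowNorm w b
  have hK := hψ.bound_nonneg
  have h1 : |blockSum w b (scalarObs δ ψ ω) i| ≤ K * ∑ r ∈ Finset.range b, |c r| := by
    rw [blockSum_scalarObs, Finset.mul_sum]
    refine (Finset.abs_sum_le_sum_abs _ _).trans (Finset.sum_le_sum fun r _ => ?_)
    rw [abs_mul, mul_comm]
    exact mul_le_mul_of_nonneg_right (hψ.bound _) (abs_nonneg _)
  refine h1.trans (mul_le_mul_of_nonneg_left (Real.le_sqrt_of_sq_le ?_) hK)
  have h2 := sq_sum_le_card_mul_sum_sq (s := Finset.range b) (f := fun r => |c r|)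
  simp only [sq_abs, Finset.card_range] at h2
  exact h2.trans (mul_le_of_le_one_right (by positivity) (sum_sq_div_windowNorm_le w b))

lemma memLp_blockSum (hψ : CenteredFunctional P δ ψ K) (h : IsIID P δ) (w : ℝ → ℝ)
    (b i : ℕ) (p : ℝ≥0∞) : MemLp (fun ω => blockSum w b (scalarObs δ ψ ω) i) p P :=
  MemLp.of_bound (hψ.measurable_blockSum h w b i).aestronglyMeasurable (K * √b)
    (ae_of_all _ fun ω => hψ.abs_blockSum_le w b i ω)

lemma memLp_blockSum_sq (hψ : CenteredFunctional P δ ψ K) (h : IsIID P δ) (w : ℝ → ℝ)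
    (b i : ℕ) (p : ℝ≥0∞) : MemLp (fun ω => blockSum w b (scalarObs δ ψ ω) i ^ 2) p P :=
  MemLp.of_bound ((hψ.measurable_blockSum h w b i).pow_const 2).aestronglyMeasurable
    ((K * √b) ^ 2) (ae_of_all _ fun ω => by
      rw [norm_pow]
      exact pow_le_pow_left₀ (norm_nonneg _) (hψ.abs_blockSum_le w b i ω) 2)

lemma integral_blockSum (hψ : CenteredFunctional P δ ψ K) (h : IsIID P δ) (w : ℝ → ℝ)
    (b i : ℕ) : ∫ ω, blockSum w b (scalarObs δ ψ ω) i ∂P = 0 := by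
  simp_rw [blockSum_scalarObs]
  rw [integral_finsetSum _ fun s _ => ((hψ.memLp h _ 1).integrable le_rfl).const_mul _]
  exact Finset.sum_eq_zero fun s _ => by rw [integral_const_mul, hψ.centered, mul_zero]

lemma blockSum_scalarObs_image (w : ℝ → ℝ) (b i : ℕ) (ω : Ω) :
    blockSum w b (scalarObs δ ψ ω) i
      = ∑ t ∈ (Finset.range b).image (fun r : ℕ => (i + 1 : ℤ) + (r : ℤ)),
        intWindow w b (t - (i + 1 : ℤ)) / windowNorm w b * ψ (recent δ m t ω) := by
  rw [Finset.sum_image (fun i _ j _ hij => by simpa using hij), blockSum_scalarObs]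
  simp

lemma integral_blockSum_sq_le (hψ : CenteredFunctional P δ ψ K) (h : IsIID P δ) (w : ℝ → ℝ)
    (b i : ℕ) : ∫ ω, blockSum w b (scalarObs δ ψ ω) i ^ 2 ∂P ≤ 2 * (m * K ^ 2) := by
  simp_rw [blockSum_scalarObs_image]
  refine (hψ.integral_sum_sq_le h _ _).trans (mul_le_of_le_one_right (by positivity) ?_)
  rw [Finset.sum_image (fun i _ j _ hij => by simpa using hij)]
  simpa using sum_sq_div_windowNorm_le w b

lemma integral_blockSum_pow_four_le (hψ : CenteredFunctional P δ ψ K) (h : IsIID P δ) (w : ℝ → ℝ)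
    (b i : ℕ) :
    ∫ ω, blockSum w b (scalarObs δ ψ ω) i ^ 4 ∂P ≤ (m + 1) ^ 4 * (3 * K ^ 4) := by
  simp_rw [blockSum_scalarObs_image]
  refine (hψ.integral_sum_pow_four_le h _ _).trans (mul_le_of_le_one_right (by positivity) ?_)
  rw [Finset.sum_image (fun i _ j _ hij => by simpa using hij)]
  have h1 := sum_sq_div_windowNorm_le w b
  have h0 : 0 ≤ ∑ r ∈ Finset.range b, (intWindow w b r / windowNorm w b) ^ 2 :=
    Finset.sum_nonneg fun _ _ => sq_nonneg _
  have h2 := pow_le_one₀ (n := 2) h0 h1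
  simpa only [add_sub_cancel_left] using h2

/-- The variance of a tapered block sum. -/
noncomputable def blockVar (P : Measure Ω) (δ : ℤ → Ω → S) {m : ℕ} (ψ : (Fin m → S) → ℝ)
    (w : ℝ → ℝ) (b : ℕ) : ℝ :=
  ∫ ω, blockSum w b (scalarObs δ ψ ω) 0 ^ 2 ∂P

lemma integral_blockSum_sq (hψ : CenteredFunctional P δ ψ K) (h : IsIID P δ) {w : ℝ → ℝ}
    (hw : IsTaper w) {b : ℕ} (hb : 1 ≤ b) (i : ℕ) :
    ∫ ω, blockSum w b (scalarObs δ ψ ω) i ^ 2 ∂P = blockVar P δ ψ w b := by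
  have key : ∀ i : ℕ, ∫ ω, blockSum w b (scalarObs δ ψ ω) i ^ 2 ∂P = _ := fun i => by
    simp_rw [blockSum_scalarObs]
    exact hψ.integral_weighted_sum_sq h (a := fun t => intWindow w b t / windowNorm w b) b
      (fun t ht => by rw [hw.intWindow_eq_zero hb ht, zero_div]) _
  rw [key, blockVar, key]

lemma tendsto_blockVar (hψ : CenteredFunctional P δ ψ K) (h : IsIID P δ) {w : ℝ → ℝ}
    (hw : IsTaper w) : Tendsto (blockVar P δ ψ w) atTop (𝓝 (longRunVar P δ ψ)) := by
  have h1 := hψ.tendsto_integral_taper_sum_sq h hw (fun _ => 1)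
  refine h1.congr fun b => ?_
  rw [blockVar]
  simp_rw [blockSum_scalarObs]
  simp

/-- It is a limit of variances. -/
lemma longRunVar_nonneg (hψ : CenteredFunctional P δ ψ K) (h : IsIID P δ) :
    0 ≤ longRunVar P δ ψ :=
  ge_of_tendsto' (hψ.tendsto_blockVar h isTaper_rectangle) fun _ =>
    integral_nonneg fun _ => sq_nonneg _

lemma disjoint_block_ranges {i j b : ℕ} (hij : (i : ℤ) + (b + m : ℕ) ≤ j) :
    Disjoint (Set.Ioc (i + 1 - m : ℤ) (i + b)) (Set.Ioc (j + 1 - m : ℤ) (j + b)) := by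
  rw [Set.disjoint_left]
  intro t ht ht'
  simp only [Set.mem_Ioc] at ht ht'
  push_cast at hij
  omega

/-- Blocks starting at least `b + m` apart use disjoint innovations, so averaging `N` of them leaves
a variance of order `(b + m) / N`. -/
lemma integral_sq_mean_blockSum_le (hψ : CenteredFunctional P δ ψ K) (h : IsIID P δ) (w : ℝ → ℝ)
    (b N : ℕ) :
    ∫ ω, ((N : ℝ)⁻¹ * ∑ i : Fin N, blockSum w b (scalarObs δ ψ ω) i) ^ 2 ∂P
      ≤ 2 * (2 * (m * K ^ 2)) * (((b + m : ℕ) : ℝ) / N) := by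
  have h1 := integral_norm_sq_sum_le_of_range (μ := P) (Finset.univ : Finset (Fin N))
    (p := fun i => ((i : ℕ) : ℤ)) (fun i j hij => by simpa [Fin.ext_iff] using hij)
    (fun _ => (N : ℝ)⁻¹) (X := fun i ω => blockSum w b (scalarObs δ ψ ω) i)
    (fun i _ => hψ.memLp_blockSum h w b i 2) (C := 2 * (m * K ^ 2))
    (fun i _ => by simpa using hψ.integral_blockSum_sq_le h w b i) (b + m)
    (fun i _ j _ hij => h.integral_inner_eq_zero (disjoint_block_ranges hij)
      (hψ.measurable_blockSum_field w b i) (hψ.measurable_blockSum_field w b j)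
      (hψ.memLp_blockSum h w b i 2) (hψ.memLp_blockSum h w b j 2) (hψ.integral_blockSum h w b i))
  simp only [smul_eq_mul, Real.norm_eq_abs, sq_abs, ← Finset.mul_sum, Finset.sum_const,
    Finset.card_univ, Fintype.card_fin, nsmul_eq_mul] at h1
  refine h1.trans (le_of_eq ?_)
  rcases Nat.eq_zero_or_pos N with rfl | hN
  · simp
  · have : (N : ℝ) ≠ 0 := by positivity
    field_simp

/-- The same argument for squared block sums; the fourth moment bound keeps their variance bounded
uniformly in `b`. -/
lemma integral_sq_mean_blockSum_sq_le (hψ : CenteredFunctional P δ ψ K) (h : IsIID P δ)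
    {w : ℝ → ℝ} (hw : IsTaper w) {b : ℕ} (hb : 1 ≤ b) (N : ℕ) :
    ∫ ω, ((N : ℝ)⁻¹ * ∑ i : Fin N, (blockSum w b (scalarObs δ ψ ω) i ^ 2 - blockVar P δ ψ w b)) ^ 2
        ∂P ≤ 2 * ((m + 1) ^ 4 * (3 * K ^ 4)) * (((b + m : ℕ) : ℝ) / N) := by
  set v := blockVar P δ ψ w b with hv
  set Z : ℕ → Ω → ℝ := fun i ω => blockSum w b (scalarObs δ ψ ω) i ^ 2 - v with hZ
  have hsq : ∀ i, MemLp (fun ω => blockSum w b (scalarObs δ ψ ω) i ^ 2) 2 P := fun i =>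
    hψ.memLp_blockSum_sq h w b i 2
  have hE : ∀ i, ∫ ω, blockSum w b (scalarObs δ ψ ω) i ^ 2 ∂P = v := fun i =>
    hψ.integral_blockSum_sq h hw hb i
  have hZL : ∀ i, MemLp (Z i) 2 P := fun i => (hsq i).sub (memLp_const _)
  have hZf : ∀ i : ℕ, Measurable[innovField δ (Set.Ioc (i + 1 - m : ℤ) (i + b))] (Z i) := fun i =>
    ((hψ.measurable_blockSum_field w b i).pow_const 2).sub_const _
  have hZ0 : ∀ i, ∫ ω, Z i ω ∂P = 0 := fun i => by
    rw [hZ]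
    dsimp only
    rw [integral_sub ((hsq i).integrable one_le_two) (integrable_const _), hE]
    simp
  have hZ2 : ∀ i, ∫ ω, ‖Z i ω‖ ^ 2 ∂P ≤ (m + 1) ^ 4 * (3 * K ^ 4) := fun i => by
    have h2 := integral_norm_sq_sub_integral (hsq i)
    rw [hE] at h2
    refine h2.le.trans ((sub_le_self _ (sq_nonneg _)).trans ?_)
    simp only [norm_pow, Real.norm_eq_abs, sq_abs, ← pow_mul]
    exact hψ.integral_blockSum_pow_four_le h w b i
  have h1 := integral_norm_sq_sum_le_of_range (μ := P) (Finset.univ : Finset (Fin N))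
    (p := fun i => ((i : ℕ) : ℤ)) (fun i j hij => by simpa [Fin.ext_iff] using hij)
    (fun _ => (N : ℝ)⁻¹) (X := fun i => Z i)
    (fun i _ => hZL i) (fun i _ => hZ2 i) (b + m)
    (fun i _ j _ hij => h.integral_inner_eq_zero (disjoint_block_ranges hij)
      (hZf i) (hZf j) (hZL i) (hZL j) (hZ0 i))
  simp only [smul_eq_mul, Real.norm_eq_abs, sq_abs, ← Finset.mul_sum, Finset.sum_const,
    Finset.card_univ, Fintype.card_fin, nsmul_eq_mul] at h1
  refine h1.trans (le_of_eq ?_)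
  rcases Nat.eq_zero_or_pos N with rfl | hN
  · simp
  · have : (N : ℝ) ≠ 0 := by positivity
    field_simp

/-- Explicit bound for the mean absolute error of the bootstrap variance. -/
lemma integral_abs_bootVar_sub_le (hψ : CenteredFunctional P δ ψ K) (h : IsIID P δ)
    {w : ℝ → ℝ} (hw : IsTaper w) {k b : ℕ} (hk : 1 ≤ k) (hb : 1 ≤ b) (v : ℝ) :
    Integrable (fun ω => bootVar w k b (scalarObs δ ψ ω)) P ∧
    ∫ ω, |bootVar w k b (scalarObs δ ψ ω) - v| ∂P
      ≤ √(2 * ((m + 1) ^ 4 * (3 * K ^ 4)) * (((b + m : ℕ) : ℝ) / numBlocks (k * b) b))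
        + |blockVar P δ ψ w b - v|
        + 2 * (2 * (m * K ^ 2)) * (((b + m : ℕ) : ℝ) / numBlocks (k * b) b) := by
  set N := numBlocks (k * b) b with hN
  have hN0 : (N : ℝ) ≠ 0 := by
    have : 0 < N := Nat.succ_pos _
    positivity
  set u := blockVar P δ ψ w b with hu
  set A : Ω → ℝ := fun ω => (N : ℝ)⁻¹ * ∑ i : Fin N, (blockSum w b (scalarObs δ ψ ω) i ^ 2 - u)
    with hA
  set B : Ω → ℝ := fun ω => (N : ℝ)⁻¹ * ∑ i : Fin N, blockSum w b (scalarObs δ ψ ω) i with hB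
  have hAL : MemLp A 2 P := by
    have h1 : MemLp (fun ω => ∑ i : Fin N, (blockSum w b (scalarObs δ ψ ω) i ^ 2 - u)) 2 P :=
      memLp_finsetSum _ fun i _ => MemLp.sub (hψ.memLp_blockSum_sq h w b i 2) (memLp_const _)
    exact h1.const_mul _
  have hBL : MemLp B 2 P := by
    have h1 : MemLp (fun ω => ∑ i : Fin N, blockSum w b (scalarObs δ ψ ω) i) 2 P :=
      memLp_finsetSum _ fun (i : Fin N) _ => hψ.memLp_blockSum h w b i 2
    exact h1.const_mul _
  -- Fluctuation of the averaged squares, bias of the block variance, and square of the averaged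
  -- block sums.
  have hdecomp : ∀ ω, bootVar w k b (scalarObs δ ψ ω) - v = A ω + (u - v) - B ω ^ 2 := fun ω => by
    rw [bootVar_eq w hk hb, blockMean, hA, hB]
    simp only [Finset.sum_sub_distrib, Finset.sum_const, Finset.card_univ, Fintype.card_fin,
      nsmul_eq_mul, smul_eq_mul, ← hN]
    field_simp
    ring
  have hA1 : Integrable A P := hAL.integrable one_le_two
  have hB2 : Integrable (fun ω => B ω ^ 2) P := by simpa using integrable_norm_sq hBL
  have hint : Integrable (fun ω => bootVar w k b (scalarObs δ ψ ω) - v) P := by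
    simp_rw [hdecomp]
    exact (hA1.add (integrable_const _)).sub hB2
  refine ⟨(hint.add (integrable_const v)).congr (ae_of_all _ fun ω => sub_add_cancel _ _), ?_⟩
  have hpt : ∀ ω, |bootVar w k b (scalarObs δ ψ ω) - v| ≤ |A ω| + |u - v| + B ω ^ 2 := fun ω => by
    rw [hdecomp]
    refine (abs_sub _ _).trans ?_
    rw [abs_of_nonneg (sq_nonneg (B ω))]
    gcongr
    exact abs_add_le _ _
  have i1 : Integrable (fun ω => |A ω| + |u - v|) P := hA1.abs.add (integrable_const _)
  refine (integral_mono hint.abs (i1.add hB2) hpt).trans ?_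
  simp only [Pi.add_apply]
  rw [integral_add i1 hB2, integral_add hA1.abs (integrable_const _)]
  gcongr
  · refine Real.le_sqrt_of_sq_le ?_
    refine le_trans ?_ (hψ.integral_sq_mean_blockSum_sq_le h hw hb N)
    have h3 := norm_integral_sq_le hAL.norm
    simpa only [Real.norm_eq_abs, sq_abs] using h3
  · simp
  · exact hψ.integral_sq_mean_blockSum_le h w b N

/-- The bootstrap variance converges in mean to the long run variance. -/
theorem tendsto_integral_abs_bootVar_sub (hψ : CenteredFunctional P δ ψ K) (h : IsIID P δ)
    {w : ℝ → ℝ} (hw : IsTaper w) {k b : ℕ → ℕ} (hkb : BlockRegime k b) :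
    Tendsto (fun j => ∫ ω, |bootVar w (k j) (b j) (scalarObs δ ψ ω) - longRunVar P δ ψ| ∂P)
      atTop (𝓝 0) := by
  have h1 := hkb.tendsto_range_div_numBlocks m
  have h2 := ((h1.const_mul (2 * ((m + 1) ^ 4 * (3 * K ^ 4)))).sqrt.add
    (((hψ.tendsto_blockVar h hw).comp hkb.tendsto_b).sub_const (longRunVar P δ ψ)).abs).add
    (h1.const_mul (2 * (2 * (m * K ^ 2))))
  simp only [mul_zero, Real.sqrt_zero, sub_self, abs_zero, add_zero] at h2
  exact squeeze_zero (fun j => integral_nonneg fun _ => abs_nonneg _) (fun j =>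
    (hψ.integral_abs_bootVar_sub_le h hw (hkb.one_le_k j) (hkb.one_le_b j) _).2) h2

/-- The variance of the scaled sample mean converges to the long run variance. -/
theorem tendsto_integral_scaledMean_sq (hψ : CenteredFunctional P δ ψ K) (h : IsIID P δ) :
    Tendsto (fun n : ℕ => ∫ ω, (√(n : ℝ) * sampleMean n (scalarObs δ ψ ω)) ^ 2 ∂P)
      atTop (𝓝 (longRunVar P δ ψ)) := by
  -- For `n ≥ 1`, the scaled mean is the block sum of length `n` with the rectangular window.
  refine (hψ.tendsto_blockVar h isTaper_rectangle).congr' ?_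
  filter_upwards [eventually_ge_atTop 1] with n hn
  rw [blockVar]
  congr 1 with ω
  congr 1
  have hn0 : (0 : ℝ) < n := by exact_mod_cast hn
  rw [blockSum, windowNorm_rectangle, sampleMean, smul_eq_mul, ← mul_assoc, Finset.mul_sum,
    Finset.range_eq_Ico, show Finset.Icc 1 n = Finset.Ico (0 + 1) (n + 1) from rfl,
    ← Finset.sum_Ico_add']
  refine Finset.sum_congr rfl fun r hr => ?_
  rw [intWindow_rectangle (Finset.mem_Ico.1 hr).2, smul_eq_mul, zero_add, add_comm 1 r]
  congr 1
  rw [← div_eq_mul_inv, Real.sqrt_div_self', one_div]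

end CenteredFunctional

end ScalarBootstrap

/-! ### Central limit theorems for characteristic functions -/

lemma norm_pow_sub_pow_le_mul {z u : ℂ} (hz : ‖z‖ ≤ 1) (hu : ‖u‖ ≤ 1) (k : ℕ) :
    ‖z ^ k - u ^ k‖ ≤ k * ‖z - u‖ := by
  induction k with
  | zero => simp
  | succ k ih =>
    have h1 : z ^ (k + 1) - u ^ (k + 1) = (z ^ k - u ^ k) * z + u ^ k * (z - u) := by ring
    rw [h1]
    refine (norm_add_le _ _).trans ?_
    rw [norm_mul, norm_mul, norm_pow]
    have h2 : ‖z ^ k - u ^ k‖ * ‖z‖ ≤ k * ‖z - u‖ * 1 := by gcongr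
    have h3 : ‖u‖ ^ k * ‖z - u‖ ≤ 1 * ‖z - u‖ := by
      gcongr
      exact pow_le_one₀ (norm_nonneg _) hu
    push_cast
    linarith

lemma norm_exp_mul_I_sub_le {x : ℝ} (hx : |x| ≤ 1) :
    ‖Complex.exp (x * Complex.I) - (1 + x * Complex.I - ((x ^ 2 / 2 : ℝ) : ℂ))‖ ≤ |x| ^ 3 := by
  have hn : ‖(x : ℂ) * Complex.I‖ = |x| := by simp
  have h1 := Complex.exp_bound (x := x * Complex.I) (by rw [hn]; exact hx) (n := 3) (by norm_num)
  rw [hn] at h1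
  have h2 : ∑ i ∈ Finset.range 3, ((x : ℂ) * Complex.I) ^ i / (i.factorial : ℂ)
      = 1 + x * Complex.I - ((x ^ 2 / 2 : ℝ) : ℂ) := by
    simp only [Finset.sum_range_succ, Finset.sum_range_zero, Nat.factorial, mul_pow, Complex.I_sq]
    push_cast
    ring
  rw [h2] at h1
  refine h1.trans (mul_le_of_le_one_right (by positivity) ?_)
  norm_num [Nat.factorial]

lemma norm_exp_mul_I_sub_exp_mul_I_le (x y : ℝ) :
    ‖Complex.exp (x * Complex.I) - Complex.exp (y * Complex.I)‖ ≤ |x - y| := by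
  have h1 : Complex.exp (x * Complex.I) - Complex.exp (y * Complex.I)
      = Complex.exp (y * Complex.I) * (Complex.exp (Complex.I * ((x - y : ℝ) : ℂ)) - 1) := by
    rw [mul_sub, ← Complex.exp_add, mul_one]
    congr 2
    push_cast
    ring
  rw [h1, norm_mul, Complex.norm_exp_ofReal_mul_I, one_mul]
  exact Real.norm_exp_I_mul_ofReal_sub_one_le

section CharFun

variable {α : Type*} [MeasurableSpace α] {μ : Measure α} [IsProbabilityMeasure μ]

lemma integrable_exp_mul_I {Z : α → ℝ} (hZ : Measurable Z) :
    Integrable (fun a => Complex.exp (Z a * Complex.I)) μ := by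
  refine Integrable.of_bound (C := 1) (by fun_prop) (ae_of_all _ fun a => ?_)
  rw [Complex.norm_exp_ofReal_mul_I]

lemma norm_integral_exp_mul_I_le {Z : α → ℝ} :
    ‖∫ a, Complex.exp (Z a * Complex.I) ∂μ‖ ≤ 1 := by
  refine (norm_integral_le_of_norm_le_const (C := 1) (ae_of_all _ fun a => ?_)).trans (by simp)
  rw [Complex.norm_exp_ofReal_mul_I]

lemma norm_integral_exp_sub_integral_exp_le {X Y : α → ℝ} (hX : MemLp X 2 μ) (hY : MemLp Y 2 μ)
    (hXm : Measurable X) (hYm : Measurable Y) :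
    ‖∫ a, Complex.exp (X a * Complex.I) ∂μ - ∫ a, Complex.exp (Y a * Complex.I) ∂μ‖
      ≤ √(∫ a, (X a - Y a) ^ 2 ∂μ) := by
  rw [← integral_sub (integrable_exp_mul_I hXm) (integrable_exp_mul_I hYm)]
  have hd : MemLp (fun a => X a - Y a) 2 μ := hX.sub hY
  have h1 : ‖∫ a, (Complex.exp (X a * Complex.I) - Complex.exp (Y a * Complex.I)) ∂μ‖
      ≤ ∫ a, |X a - Y a| ∂μ :=
    norm_integral_le_of_norm_le (hd.integrable one_le_two).abs
      (ae_of_all _ fun a => norm_exp_mul_I_sub_exp_mul_I_le _ _)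
  refine h1.trans (Real.le_sqrt_of_sq_le ?_)
  simpa only [Real.norm_eq_abs, sq_abs] using norm_integral_sq_le hd.norm

/-- Quantitative central limit theorem: the characteristic function of a sum of `k` independent
copies of a small centered variable is close to the Gaussian one. -/
theorem norm_integral_exp_pow_sub_le {Z : α → ℝ} (hZ : Measurable Z) {M : ℝ} (hM1 : M ≤ 1)
    (hM : ∀ a, |Z a| ≤ M) (h0 : ∫ a, Z a ∂μ = 0) {s : ℝ} (hs0 : 0 ≤ s) (hs : s ≤ 2) (k : ℕ) :
    ‖(∫ a, Complex.exp (Z a * Complex.I) ∂μ) ^ k - (Real.exp (-(k * s / 2)) : ℂ)‖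
      ≤ k * (M * ∫ a, Z a ^ 2 ∂μ + |∫ a, Z a ^ 2 ∂μ - s| + s ^ 2) := by
  have hbdd : ∀ p : ℕ, Integrable (fun a => Z a ^ p) μ := fun p =>
    Integrable.of_bound (hZ.pow_const p).aestronglyMeasurable (M ^ p) (ae_of_all _ fun a => by
      rw [norm_pow]
      exact pow_le_pow_left₀ (norm_nonneg _) (hM a) p)
  have hi1 : Integrable Z μ := by simpa using hbdd 1
  set v := ∫ a, Z a ^ 2 ∂μ with hv
  have hu : (Real.exp (-(k * s / 2)) : ℂ) = (Real.exp (-(s / 2)) : ℂ) ^ k := by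
    rw [← Complex.ofReal_pow, ← Real.exp_nat_mul]
    congr 2
    ring
  have hu1 : ‖(Real.exp (-(s / 2)) : ℂ)‖ ≤ 1 := by
    rw [Complex.norm_real, Real.norm_eq_abs, abs_of_pos (Real.exp_pos _)]
    exact Real.exp_le_one_iff.2 (by linarith)
  rw [hu]
  refine (norm_pow_sub_pow_le_mul norm_integral_exp_mul_I_le hu1 k).trans
    (mul_le_mul_of_nonneg_left ?_ (Nat.cast_nonneg k))
  have hlin : Integrable (fun a => (1 : ℂ) + Z a * Complex.I) μ :=
    (integrable_const _).add (hi1.ofReal.mul_const _)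
  have hquad : Integrable (fun a => ((Z a ^ 2 / 2 : ℝ) : ℂ)) μ := ((hbdd 2).div_const 2).ofReal
  have htaylor : Integrable (fun a => (1 : ℂ) + Z a * Complex.I - ((Z a ^ 2 / 2 : ℝ) : ℂ)) μ :=
    hlin.sub hquad
  have hE : ∫ a, ((1 : ℂ) + Z a * Complex.I - ((Z a ^ 2 / 2 : ℝ) : ℂ)) ∂μ
      = ((1 - v / 2 : ℝ) : ℂ) := by
    rw [integral_sub hlin hquad, integral_add (integrable_const _) (hi1.ofReal.mul_const _),
      integral_mul_const, integral_complex_ofReal, integral_complex_ofReal, integral_div, h0, ← hv]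
    simp
  -- The Taylor remainder is at most `|Z|³ ≤ M * Z²`; the linear term integrates to zero.
  have t1 : ‖∫ a, Complex.exp (Z a * Complex.I) ∂μ - ((1 - v / 2 : ℝ) : ℂ)‖ ≤ M * v := by
    rw [← hE, ← integral_sub (integrable_exp_mul_I hZ) htaylor, hv, ← integral_const_mul]
    refine norm_integral_le_of_norm_le ((hbdd 2).const_mul M) (ae_of_all _ fun a => ?_)
    refine (norm_exp_mul_I_sub_le ((hM a).trans hM1)).trans ?_
    rw [pow_succ', ← sq_abs (Z a)]
    exact mul_le_mul_of_nonneg_right (hM a) (sq_nonneg _)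
  -- The bound `|exp x - 1 - x| ≤ x²` at `x = -(s / 2)` requires `s ≤ 2`.
  have t2 : ‖((1 - v / 2 : ℝ) : ℂ) - (Real.exp (-(s / 2)) : ℂ)‖ ≤ |v - s| + s ^ 2 := by
    rw [← Complex.ofReal_sub, Complex.norm_real, Real.norm_eq_abs]
    have h1 := Real.abs_exp_sub_one_sub_id_le (x := -(s / 2)) (by rw [abs_neg, abs_of_nonneg] <;> linarith)
    have h2 : 1 - v / 2 - Real.exp (-(s / 2))
        = -(v - s) / 2 - (Real.exp (-(s / 2)) - 1 - -(s / 2)) := by ring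
    rw [h2]
    refine (abs_sub _ _).trans ?_
    rw [abs_div, abs_neg, abs_two]
    have := abs_nonneg (v - s)
    nlinarith
  have h3 := norm_add_le (∫ a, Complex.exp (Z a * Complex.I) ∂μ - ((1 - v / 2 : ℝ) : ℂ))
    (((1 - v / 2 : ℝ) : ℂ) - (Real.exp (-(s / 2)) : ℂ))
  rw [sub_add_sub_cancel] at h3
  linarith

end CharFun

/-- The characteristic function of the scaled bootstrap deviation is close to the Gaussian one. -/
theorem norm_integral_exp_scaled_bootDev_sub_le (w : ℝ → ℝ) {k b : ℕ} (hk : 1 ≤ k) (hb : 1 ≤ b)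
    {y : ℕ → ℝ} {C : ℝ} (hC : ∀ i, |blockSum w b y i| ≤ C) (hCk : 2 * C ≤ √k) {σ : ℝ} (hσ : 0 ≤ σ)
    (hσk : σ ≤ 2 * k) :
    ‖∫ I, Complex.exp ((√((k * b : ℕ) : ℝ) • bootDev w k b y I : ℝ) * Complex.I)
        ∂(drawLaw k b : Measure (Draw k b)) - (Real.exp (-(σ / 2)) : ℂ)‖
      ≤ 2 * C / √k * bootVar w k b y + |bootVar w k b y - σ| + σ ^ 2 * (k : ℝ)⁻¹ := by
  have hk0 : (0 : ℝ) < k := by exact_mod_cast hk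
  have hsk : 0 < √(k : ℝ) := Real.sqrt_pos.2 hk0
  rw [integral_exp_scaled_bootDev w k hb]
  set N := numBlocks (k * b) b with hN
  set Z : Fin N → ℝ := fun i => (√k)⁻¹ * (blockSum w b y i - blockMean w k b y) with hZ
  have hmean : |blockMean w k b y| ≤ C := by
    rw [blockMean_eq_integral]
    have h1 := norm_integral_le_of_norm_le_const (μ := blockLaw k b) (C := C)
      (f := fun i : Fin N => blockSum w b y (i : ℕ)) (ae_of_all _ fun i => hC i)
    simpa using h1
  have h2 : ∫ i, Z i ^ 2 ∂(blockLaw k b) = (k : ℝ)⁻¹ * bootVar w k b y := by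
    rw [bootVar_eq_integral_blockLaw w hk hb, ← integral_const_mul]
    congr 1 with i
    rw [hZ]
    simp only [mul_pow, inv_pow, Real.sq_sqrt hk0.le]
  -- A block sum and the block mean are each at most `C`, whence `2 * C / √k`; every draw carries
  -- the share `σ / k` of the limiting variance.
  have hmain := norm_integral_exp_pow_sub_le (μ := blockLaw k b) (Z := Z) Measurable.of_discrete
    (M := 2 * C / √k) ((div_le_one hsk).2 hCk) (fun i => by
      rw [hZ]
      simp only [abs_mul, abs_inv, abs_of_pos hsk]
      rw [inv_mul_eq_div]
      gcongr
      refine (abs_sub _ _).trans ?_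
      linarith [hC i]) (by
      rw [hZ]
      dsimp only
      rw [integral_const_mul, integral_sub Integrable.of_finite (integrable_const _),
        ← blockMean_eq_integral]
      simp) (s := (k : ℝ)⁻¹ * σ) (by positivity) (by
      rw [inv_mul_le_iff₀ hk0]; linarith) k
  have e1 : (k : ℝ) * ((k : ℝ)⁻¹ * σ) / 2 = σ / 2 := by field_simp
  rw [e1, h2] at hmain
  refine hmain.trans (le_of_eq ?_)
  rw [← mul_sub, abs_mul, abs_of_pos (inv_pos.2 hk0)]
  field_simp

/-! ### Central limit theorem for the mean by blocks and gaps -/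

section ScalarCLT

variable {Ω S : Type*} [MeasurableSpace Ω] [MeasurableSpace S] {P : Measure Ω}
  [IsProbabilityMeasure P] {δ : ℤ → Ω → S} {m : ℕ} {ψ : (Fin m → S) → ℝ} {K : ℝ}

lemma sum_range_mul_eq (f : ℕ → ℝ) (k b : ℕ) :
    ∑ t ∈ Finset.range (k * b), f t = ∑ i ∈ Finset.range k, ∑ r ∈ Finset.range b, f (i * b + r) := by
  induction k with
  | zero => simp
  | succ k ih => rw [Finset.sum_range_succ, ← ih, Nat.succ_mul, Finset.sum_range_add]

namespace CenteredFunctional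

/-- The law of a block sum does not depend on the position of the block. -/
lemma integral_comp_blockSum (hψ : CenteredFunctional P δ ψ K) (h : IsIID P δ) (w : ℝ → ℝ)
    (b i : ℕ) {G : ℝ → ℂ} (hG : Measurable G) :
    ∫ ω, G (blockSum w b (scalarObs δ ψ ω) i) ∂P
      = ∫ ω, G (blockSum w b (scalarObs δ ψ ω) 0) ∂P := by
  have h1 := (h.identDistrib_shift (F := fun x : ℤ → S =>
    G (∑ r ∈ Finset.range b, intWindow w b r / windowNorm w b *
      ψ (fun j : Fin m => x ((1 : ℤ) + r - (j : ℤ))))) (by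
      refine hG.comp (Finset.measurable_sum _ fun r _ => (hψ.measurable.comp ?_).const_mul _)
      fun_prop) i).integral_eq
  refine Eq.trans ?_ (h1.trans ?_)
  · simp_rw [blockSum_scalarObs]
    congr 1 with ω
    congr 1
    refine Finset.sum_congr rfl fun r _ => ?_
    congr 2
    ext j
    simp only [recent]
    congr 1
    ring
  · simp_rw [blockSum_scalarObs]
    congr 1 with ω

/-- Blocks that are separated by the range of dependence are independent. -/
lemma integral_exp_sum_blockSum (hψ : CenteredFunctional P δ ψ K) (h : IsIID P δ) (w : ℝ → ℝ)
    (ℓ : ℕ) (c : ℝ) (k : ℕ) :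
    ∫ ω, Complex.exp ((∑ i ∈ Finset.range k,
        c * blockSum w ℓ (scalarObs δ ψ ω) (i * (ℓ + m)) : ℝ) * Complex.I) ∂P
      = (∫ ω, Complex.exp ((c * blockSum w ℓ (scalarObs δ ψ ω) 0 : ℝ) * Complex.I) ∂P) ^ k := by
  induction k with
  | zero => simp
  | succ k ih =>
    set X : Ω → ℂ := fun ω => Complex.exp ((∑ i ∈ Finset.range k,
        c * blockSum w ℓ (scalarObs δ ψ ω) (i * (ℓ + m)) : ℝ) * Complex.I) with hX
    set Z : Ω → ℂ := fun ω =>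
      Complex.exp ((c * blockSum w ℓ (scalarObs δ ψ ω) (k * (ℓ + m)) : ℝ) * Complex.I) with hZ
    have hmeas : Measurable fun x : ℝ => Complex.exp (x * Complex.I) := by fun_prop
    have hXf : Measurable[innovField δ (Set.Iic ((k * (ℓ + m) : ℕ) - m : ℤ))] X := by
      refine hmeas.comp (Finset.measurable_sum _ fun i hi => ((hψ.measurable_blockSum_field w ℓ
        (i * (ℓ + m))).mono ?_ le_rfl).const_mul _)
      refine innovField_mono fun t ht => ?_
      have h1 : (i + 1) * (ℓ + m) ≤ k * (ℓ + m) :=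
        Nat.mul_le_mul_right _ (Finset.mem_range.1 hi)
      have h2 := ht.2
      simp only [Set.mem_Iic]
      zify at h1
      push_cast at h2 ⊢
      linarith
    have hZf : Measurable[innovField δ (Set.Ioc ((k * (ℓ + m) : ℕ) + 1 - m : ℤ)
        ((k * (ℓ + m) : ℕ) + ℓ))] Z :=
      hmeas.comp ((hψ.measurable_blockSum_field w ℓ (k * (ℓ + m))).const_mul _)
    have hind : IndepFun X Z P := by
      refine h.indepFun ?_ hXf hZf
      rw [Set.disjoint_left]
      intro t ht ht'
      simp only [Set.mem_Iic, Set.mem_Ioc] at ht ht'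
      omega
    have hsplit : ∀ ω, Complex.exp ((∑ i ∈ Finset.range (k + 1),
        c * blockSum w ℓ (scalarObs δ ψ ω) (i * (ℓ + m)) : ℝ) * Complex.I) = X ω * Z ω := fun ω => by
      rw [Finset.sum_range_succ, hX, hZ, ← Complex.exp_add]
      congr 1
      push_cast
      ring
    simp_rw [hsplit]
    rw [hind.integral_fun_mul_eq_mul_integral
      (hXf.mono (h.innovField_le _) le_rfl).aestronglyMeasurable
      (hZf.mono (h.innovField_le _) le_rfl).aestronglyMeasurable, ih, pow_succ]
    congr 1
    exact hψ.integral_comp_blockSum h w ℓ _ (G := fun x => Complex.exp ((c * x : ℝ) * Complex.I))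
      (by fun_prop)

lemma measurable_sampleMean (hψ : CenteredFunctional P δ ψ K) (h : IsIID P δ) (n : ℕ) :
    Measurable fun ω => sampleMean n (scalarObs δ ψ ω) := by
  have h1 : Measurable fun ω => ∑ t ∈ Finset.Icc 1 n, scalarObs δ ψ ω t :=
    Finset.measurable_sum _ fun t _ => hψ.measurable_comp h t
  exact h1.const_mul ((n : ℝ)⁻¹)

lemma memLp_sampleMean (hψ : CenteredFunctional P δ ψ K) (h : IsIID P δ) (n : ℕ) (p : ℝ≥0∞) :
    MemLp (fun ω => sampleMean n (scalarObs δ ψ ω)) p P := by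
  have h1 : MemLp (fun ω => ∑ t ∈ Finset.Icc 1 n, scalarObs δ ψ ω t) p P :=
    memLp_finsetSum _ fun t _ => hψ.memLp h t p
  exact h1.const_mul ((n : ℝ)⁻¹)

/-- Removing the last `m` observations of every block changes the scaled mean by little. -/
lemma integral_sq_scaledMean_sub_le (hψ : CenteredFunctional P δ ψ K) (h : IsIID P δ) {k ℓ : ℕ}
    (hk : 1 ≤ k) (hℓ : 1 ≤ ℓ) :
    ∫ ω, (√((k * (ℓ + m) : ℕ) : ℝ) * sampleMean (k * (ℓ + m)) (scalarObs δ ψ ω)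
        - ∑ i ∈ Finset.range k, (√((k * (ℓ + m) : ℕ) : ℝ))⁻¹ * √ℓ *
          blockSum rectangle ℓ (scalarObs δ ψ ω) (i * (ℓ + m))) ^ 2 ∂P
      ≤ 2 * (m * K ^ 2) * (m ^ 2 * ((ℓ + m : ℕ) : ℝ)⁻¹) := by
  set b := ℓ + m with hb
  have hb0 : (0 : ℝ) < b := by rw [hb]; positivity
  have hk0 : (0 : ℝ) < k := by exact_mod_cast hk
  have hn0 : (0 : ℝ) < (k * b : ℕ) := by push_cast; positivity
  have hℓ0 : (0 : ℝ) < ℓ := by exact_mod_cast hℓ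
  set c : ℝ := (√((k * b : ℕ) : ℝ))⁻¹ with hc
  -- The omitted observations are collected by their position `r` in the gap. Each of the `m` sums
  -- has `k` weights equal to `1 / √(k b)`, hence squared weights adding up to `1 / b`.
  set R : ℕ → Ω → ℝ := fun r ω => ∑ i ∈ Finset.range k,
    c * ψ (recent δ m ((i * b + (ℓ + r) + 1 : ℕ) : ℤ) ω) with hR
  have hdecomp : ∀ ω, √((k * b : ℕ) : ℝ) * sampleMean (k * b) (scalarObs δ ψ ω)
      - ∑ i ∈ Finset.range k, c * √ℓ * blockSum rectangle ℓ (scalarObs δ ψ ω) (i * b)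
      = ∑ r ∈ Finset.range m, R r ω := by
    intro ω
    have h1 : √((k * b : ℕ) : ℝ) * sampleMean (k * b) (scalarObs δ ψ ω)
        = ∑ t ∈ Finset.range (k * b), c * scalarObs δ ψ ω (t + 1) := by
      rw [sampleMean, smul_eq_mul, ← mul_assoc, ← div_eq_mul_inv, Real.sqrt_div_self', one_div,
        ← hc, Finset.mul_sum, Finset.range_eq_Ico,
        show Finset.Icc 1 (k * b) = Finset.Ico (0 + 1) (k * b + 1) from rfl, ← Finset.sum_Ico_add']
    have h2 : ∀ i, c * √ℓ * blockSum rectangle ℓ (scalarObs δ ψ ω) (i * b)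
        = ∑ r ∈ Finset.range ℓ, c * scalarObs δ ψ ω (i * b + r + 1) := by
      intro i
      rw [blockSum, windowNorm_rectangle, Finset.mul_sum]
      refine Finset.sum_congr rfl fun r hr => ?_
      rw [intWindow_rectangle (Finset.mem_range.1 hr), smul_eq_mul, add_right_comm]
      have : √(ℓ : ℝ) ≠ 0 := (Real.sqrt_pos.2 hℓ0).ne'
      field_simp
    rw [h1, sum_range_mul_eq, hR]
    simp_rw [h2]
    rw [← Finset.sum_sub_distrib, Finset.sum_comm]
    refine Finset.sum_congr rfl fun i _ => ?_
    rw [hb, Finset.sum_range_add, add_sub_cancel_left]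
    rfl
  have hRL : ∀ r, MemLp (R r) 2 P := fun r =>
    memLp_finsetSum _ fun i _ => (hψ.memLp h _ 2).const_mul _
  have hR2 : ∀ r, ∫ ω, R r ω ^ 2 ∂P ≤ 2 * (m * K ^ 2) * (b : ℝ)⁻¹ := by
    intro r
    have h1 := integral_norm_sq_sum_le_of_range (μ := P) (Finset.range k)
      (p := fun i => ((i * b + (ℓ + r) + 1 : ℕ) : ℤ)) (fun i j hij => by
        have h2 : i * b = j * b := by
          have := Int.ofNat_inj.1 hij
          omega
        exact Nat.eq_of_mul_eq_mul_right (by omega) h2)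
      (fun _ => c) (X := fun i ω => ψ (recent δ m ((i * b + (ℓ + r) + 1 : ℕ) : ℤ) ω))
      (fun i _ => hψ.memLp h _ 2) (fun i _ => hψ.integral_sq_le h _) m
      (fun i _ j _ hij => hψ.integral_inner_eq_zero h hij)
    simp only [smul_eq_mul, Real.norm_eq_abs, sq_abs, Finset.sum_const, Finset.card_range,
      nsmul_eq_mul] at h1
    refine h1.trans (le_of_eq ?_)
    rw [hc, inv_pow, Real.sq_sqrt hn0.le]
    push_cast
    field_simp
  simp_rw [hdecomp]
  have hpt : ∀ ω, (∑ r ∈ Finset.range m, R r ω) ^ 2 ≤ m * ∑ r ∈ Finset.range m, R r ω ^ 2 :=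
    fun ω => by
      have := sq_sum_le_card_mul_sum_sq (s := Finset.range m) (f := fun r => R r ω)
      rwa [Finset.card_range] at this
  have hi : ∀ r, Integrable (fun ω => R r ω ^ 2) P := fun r => by
    simpa using integrable_norm_sq (hRL r)
  calc ∫ ω, (∑ r ∈ Finset.range m, R r ω) ^ 2 ∂P
      ≤ ∫ ω, m * ∑ r ∈ Finset.range m, R r ω ^ 2 ∂P :=
        integral_mono_of_nonneg (ae_of_all _ fun ω => sq_nonneg _)
          ((integrable_finsetSum _ fun r _ => hi r).const_mul _) (ae_of_all _ hpt)
    _ = m * ∑ r ∈ Finset.range m, ∫ ω, R r ω ^ 2 ∂P := by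
        rw [integral_const_mul, integral_finsetSum _ fun r _ => hi r]
    _ ≤ m * ∑ r ∈ Finset.range m, 2 * (m * K ^ 2) * (b : ℝ)⁻¹ := by
        gcongr with r _
        exact hR2 r
    _ = _ := by
        rw [Finset.sum_const, Finset.card_range, nsmul_eq_mul]
        ring

/-- Central limit theorem for bounded functionals of finitely many innovations. -/
theorem tendsto_integral_exp_scaledMean (hψ : CenteredFunctional P δ ψ K) (h : IsIID P δ)
    {k b : ℕ → ℕ} (hkb : BlockRegime k b) :
    Tendsto (fun j => ∫ ω, Complex.exp ((√((k j * b j : ℕ) : ℝ)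
        * sampleMean (k j * b j) (scalarObs δ ψ ω) : ℝ) * Complex.I) ∂P) atTop
      (𝓝 (Real.exp (-(longRunVar P δ ψ / 2)) : ℂ)) := by
  set σ := longRunVar P δ ψ with hσ
  have hσ0 : 0 ≤ σ := hψ.longRunVar_nonneg h
  have hK := hψ.bound_nonneg
  -- Each block of length `b` gives up its last `m` observations, which makes the remaining pieces
  -- independent. The truncated subtraction is harmless because eventually `m < b`.
  set ℓ : ℕ → ℕ := fun j => b j - m with hℓ
  -- `k` times the variance of one rescaled block; it tends to the long run variance since `ℓ / b →
  -- 1`.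
  set v : ℕ → ℝ := fun j => (ℓ j : ℝ) / b j * blockVar P δ ψ rectangle (ℓ j) with hv
  have hbinv : Tendsto (fun j => ((b j : ℕ) : ℝ)⁻¹) atTop (𝓝 0) :=
    tendsto_inv_atTop_zero.comp (tendsto_natCast_atTop_atTop.comp hkb.tendsto_b)
  have hev : ∀ᶠ j in atTop, m + 1 ≤ b j := hkb.tendsto_b.eventually_ge_atTop _
  have hvlim : Tendsto v atTop (𝓝 σ) := by
    have h1 : Tendsto (fun j => 1 - m * ((b j : ℕ) : ℝ)⁻¹) atTop (𝓝 1) := by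
      simpa using (hbinv.const_mul (m : ℝ)).const_sub 1
    have h2 : Tendsto (fun j => (ℓ j : ℝ) / b j) atTop (𝓝 1) := by
      refine h1.congr' ?_
      filter_upwards [hev] with j hj
      have hb0 : (b j : ℝ) ≠ 0 := by have := hkb.one_le_b j; positivity
      rw [hℓ]
      push_cast [Nat.cast_sub (show m ≤ b j by omega)]
      field_simp
    have h3 : Tendsto ℓ atTop atTop := by
      refine tendsto_atTop.2 fun B => ?_
      filter_upwards [hkb.tendsto_b.eventually_ge_atTop (B + m)] with j hj
      simp only [hℓ]
      omega
    simpa using h2.mul ((hψ.tendsto_blockVar h isTaper_rectangle).comp h3)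
  set M : ℕ → ℝ := fun j => K * (√(b j : ℝ) / √(k j)) with hM
  have hMlim : Tendsto M atTop (𝓝 0) := by simpa using hkb.tendsto_ratio.const_mul K
  set err : ℕ → ℝ := fun j => √(2 * (m * K ^ 2) * (m ^ 2 * ((b j : ℕ) : ℝ)⁻¹))
    + (M j * v j + |v j - σ| + σ ^ 2 * (k j : ℝ)⁻¹) with herr
  have herrlim : Tendsto err atTop (𝓝 0) := by
    have h1 := ((hbinv.const_mul ((m : ℝ) ^ 2)).const_mul (2 * (m * K ^ 2))).sqrt.add
      (((hMlim.mul hvlim).add (hvlim.sub_const σ).abs).add (hkb.tendsto_inv_k.const_mul (σ ^ 2)))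
    simpa using h1
  rw [tendsto_iff_norm_sub_tendsto_zero]
  refine squeeze_zero' (Eventually.of_forall fun j => norm_nonneg _) ?_ herrlim
  filter_upwards [hev, hMlim.eventually_le_const zero_lt_one,
    (hkb.tendsto_inv_k.const_mul σ).eventually_le_const (u := 2) (by simp)] with j hj hMj hkj
  have hbj : b j = ℓ j + m := by simp only [hℓ]; omega
  have hℓ1 : 1 ≤ ℓ j := by simp only [hℓ]; omega
  have hk1 := hkb.one_le_k j
  have hk0 : (0 : ℝ) < k j := by exact_mod_cast hk1
  have hb0 : (0 : ℝ) < b j := by exact_mod_cast hkb.one_le_b j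
  have hn0 : (0 : ℝ) < (k j * b j : ℕ) := by push_cast; positivity
  set c : ℝ := (√((k j * b j : ℕ) : ℝ))⁻¹ * √(ℓ j) with hc
  have hc0 : 0 ≤ c := by positivity
  have hc2 : c ^ 2 = (k j : ℝ)⁻¹ * ((ℓ j : ℝ) / b j) := by
    rw [hc, mul_pow, inv_pow, Real.sq_sqrt hn0.le, Real.sq_sqrt (by positivity)]
    push_cast
    field_simp
  have hcb : c * (K * √(ℓ j)) ≤ M j := by
    have hle : (ℓ j : ℝ) ≤ b j := by rw [hbj]; push_cast; linarith [(Nat.cast_nonneg m : (0:ℝ) ≤ m)]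
    have h1 : √((k j * b j : ℕ) : ℝ) = √(k j) * √(b j) := by
      push_cast; exact Real.sqrt_mul hk0.le _
    have h2 : 0 < √(k j : ℝ) := Real.sqrt_pos.2 hk0
    have h3 : 0 < √(b j : ℝ) := Real.sqrt_pos.2 hb0
    rw [hc, hM, h1]
    have h4 : √(ℓ j : ℝ) * √(ℓ j) = ℓ j := Real.mul_self_sqrt (by positivity)
    have h5 : √(b j : ℝ) * √(b j) = b j := Real.mul_self_sqrt hb0.le
    have h6 : (√(k j : ℝ) * √(b j))⁻¹ * √(ℓ j) * (K * √(ℓ j))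
        = K * ((√(ℓ j : ℝ) * √(ℓ j)) / √(b j) / √(k j)) := by field_simp
    rw [h6, h4]
    refine mul_le_mul_of_nonneg_left (div_le_div_of_nonneg_right ?_ h2.le) hK
    rw [div_le_iff₀ h3, h5]
    exact hle
  have s1 : ‖∫ ω, Complex.exp ((√((k j * b j : ℕ) : ℝ)
        * sampleMean (k j * b j) (scalarObs δ ψ ω) : ℝ) * Complex.I) ∂P
      - ∫ ω, Complex.exp ((∑ i ∈ Finset.range (k j),
        c * blockSum rectangle (ℓ j) (scalarObs δ ψ ω) (i * b j) : ℝ) * Complex.I) ∂P‖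
      ≤ √(2 * (m * K ^ 2) * (m ^ 2 * ((b j : ℕ) : ℝ)⁻¹)) := by
    refine (norm_integral_exp_sub_integral_exp_le ((hψ.memLp_sampleMean h _ 2).const_mul _)
      (memLp_finsetSum _ fun i _ => (hψ.memLp_blockSum h rectangle (ℓ j) _ 2).const_mul _)
      ((hψ.measurable_sampleMean h _).const_mul _)
      (Finset.measurable_sum _ fun i _ =>
        (hψ.measurable_blockSum h rectangle (ℓ j) _).const_mul _)).trans
      (Real.sqrt_le_sqrt ?_)
    have := hψ.integral_sq_scaledMean_sub_le h hk1 hℓ1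
    rw [← hbj] at this
    exact this
  have s2 : ‖∫ ω, Complex.exp ((∑ i ∈ Finset.range (k j),
        c * blockSum rectangle (ℓ j) (scalarObs δ ψ ω) (i * b j) : ℝ) * Complex.I) ∂P
      - (Real.exp (-(σ / 2)) : ℂ)‖ ≤ M j * v j + |v j - σ| + σ ^ 2 * (k j : ℝ)⁻¹ := by
    have e0 := hψ.integral_exp_sum_blockSum h rectangle (ℓ j) c (k j)
    rw [← hbj] at e0
    rw [e0]
    have e2 : ∫ ω, (c * blockSum rectangle (ℓ j) (scalarObs δ ψ ω) 0) ^ 2 ∂P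
        = (k j : ℝ)⁻¹ * v j := by
      simp_rw [mul_pow]
      rw [integral_const_mul, hc2, mul_assoc]
      rfl
    have hmain := norm_integral_exp_pow_sub_le (μ := P)
      (Z := fun ω => c * blockSum rectangle (ℓ j) (scalarObs δ ψ ω) 0)
      ((hψ.measurable_blockSum h rectangle (ℓ j) 0).const_mul _) hMj
      (fun ω => by
        rw [abs_mul, abs_of_nonneg hc0]
        exact (mul_le_mul_of_nonneg_left (hψ.abs_blockSum_le _ _ _ _) hc0).trans hcb)
      (by rw [integral_const_mul, hψ.integral_blockSum h, mul_zero])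
      (s := (k j : ℝ)⁻¹ * σ) (by positivity) (by linarith) (k j)
    have e1 : (k j : ℝ) * ((k j : ℝ)⁻¹ * σ) / 2 = σ / 2 := by field_simp
    rw [e1, e2] at hmain
    refine hmain.trans (le_of_eq ?_)
    rw [← mul_sub, abs_mul, abs_of_pos (inv_pos.2 hk0)]
    field_simp
  rw [← sub_add_sub_cancel _ (∫ ω, Complex.exp ((∑ i ∈ Finset.range (k j),
        c * blockSum rectangle (ℓ j) (scalarObs δ ψ ω) (i * b j) : ℝ) * Complex.I) ∂P)]
  exact (norm_add_le _ _).trans (add_le_add s1 s2)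

end CenteredFunctional

end ScalarCLT

/-! ### Joint second moments -/

/-- The conditional covariance of the scaled bootstrap deviations of two real series. -/
noncomputable def bootProd (w : ℝ → ℝ) (k b : ℕ) (y z : ℕ → ℝ) : ℝ :=
  ∫ I, (√((k * b : ℕ) : ℝ) • bootDev w k b y I) * (√((k * b : ℕ) : ℝ) • bootDev w k b z I)
    ∂(drawLaw k b : Measure (Draw k b))

/-- Polarization. Sums and differences of centered functionals are again centered functionals, so
convergence of variances gives convergence of covariances; `longRunCov` follows the same pattern. -/
lemma bootProd_eq (w : ℝ → ℝ) (k : ℕ) {b : ℕ} (hb : 1 ≤ b) (y z : ℕ → ℝ) :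
    bootProd w k b y z
      = (bootVar w k b (fun t => y t + z t) - bootVar w k b (fun t => y t - z t)) / 4 := by
  rw [bootVar, bootVar, ← integral_sub Integrable.of_finite Integrable.of_finite, ← integral_div,
    bootProd]
  congr 1 with I
  rw [← scaled_bootDev_add w k hb, ← scaled_bootDev_sub w k hb]
  ring

lemma sum_mul_sq {κ : Type*} [Fintype κ] (c T : κ → ℝ) :
    (∑ q, c q * T q) ^ 2 = ∑ q, ∑ q', c q * c q' * (T q * T q') := by
  rw [sq, Finset.sum_mul_sum]
  refine Finset.sum_congr rfl fun q _ => Finset.sum_congr rfl fun q' _ => by ring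

lemma scaled_bootDev_linComb {κ : Type*} [Fintype κ] (w : ℝ → ℝ) (k : ℕ) {b : ℕ} (hb : 1 ≤ b)
    (c : κ → ℝ) (ξ : κ → ℕ → ℝ) (I : Draw k b) :
    √((k * b : ℕ) : ℝ) • bootDev w k b (fun t => ∑ q, c q * ξ q t) I
      = ∑ q, c q * (√((k * b : ℕ) : ℝ) • bootDev w k b (ξ q) I) := by
  have h := scaled_bootDev_sum_smul w k hb ξ c I
  simp only [smul_eq_mul] at h ⊢
  simp_rw [mul_comm (c _)]
  exact h

lemma bootVar_linComb {κ : Type*} [Fintype κ] (w : ℝ → ℝ) (k : ℕ) {b : ℕ} (hb : 1 ≤ b)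
    (c : κ → ℝ) (ξ : κ → ℕ → ℝ) :
    bootVar w k b (fun t => ∑ q, c q * ξ q t)
      = ∑ q, ∑ q', c q * c q' * bootProd w k b (ξ q) (ξ q') := by
  simp_rw [bootVar, scaled_bootDev_linComb w k hb, sum_mul_sq]
  rw [integral_finsetSum _ fun _ _ => Integrable.of_finite]
  refine Finset.sum_congr rfl fun q _ => ?_
  rw [integral_finsetSum _ fun _ _ => Integrable.of_finite]
  refine Finset.sum_congr rfl fun q' _ => ?_
  rw [integral_const_mul, bootProd]

section ScalarCovariance

variable {Ω S : Type*} [MeasurableSpace Ω] [MeasurableSpace S] {P : Measure Ω}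
  [IsProbabilityMeasure P] {δ : ℤ → Ω → S} {m : ℕ} {ψ φ : (Fin m → S) → ℝ} {K L : ℝ}

/-- The long run covariance. -/
noncomputable def longRunCov (P : Measure Ω) (δ : ℤ → Ω → S) {m : ℕ} (ψ φ : (Fin m → S) → ℝ) : ℝ :=
  (longRunVar P δ (fun u => ψ u + φ u) - longRunVar P δ (fun u => ψ u - φ u)) / 4

namespace CenteredFunctional

lemma add (hψ : CenteredFunctional P δ ψ K) (hφ : CenteredFunctional P δ φ L) (h : IsIID P δ) :
    CenteredFunctional P δ (fun u => ψ u + φ u) (K + L) where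
  measurable := hψ.measurable.add hφ.measurable
  bound u := (abs_add_le _ _).trans (add_le_add (hψ.bound u) (hφ.bound u))
  centered t := by
    rw [integral_add ((hψ.memLp h t 1).integrable le_rfl) ((hφ.memLp h t 1).integrable le_rfl),
      hψ.centered, hφ.centered, add_zero]

lemma sub (hψ : CenteredFunctional P δ ψ K) (hφ : CenteredFunctional P δ φ L) (h : IsIID P δ) :
    CenteredFunctional P δ (fun u => ψ u - φ u) (K + L) where
  measurable := hψ.measurable.sub hφ.measurable
  bound u := (abs_sub _ _).trans (add_le_add (hψ.bound u) (hφ.bound u))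
  centered t := by
    rw [integral_sub ((hψ.memLp h t 1).integrable le_rfl) ((hφ.memLp h t 1).integrable le_rfl),
      hψ.centered, hφ.centered, sub_zero]

lemma linComb {κ : Type*} [Fintype κ] {ψ : κ → (Fin m → S) → ℝ}
    (hψ : ∀ q, CenteredFunctional P δ (ψ q) K) (h : IsIID P δ) (c : κ → ℝ) :
    CenteredFunctional P δ (fun u => ∑ q, c q * ψ q u) (∑ q, |c q| * K) where
  measurable := Finset.measurable_sum _ fun q _ => (hψ q).measurable.const_mul _
  bound u := by
    refine (Finset.abs_sum_le_sum_abs _ _).trans (Finset.sum_le_sum fun q _ => ?_)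
    rw [abs_mul]
    exact mul_le_mul_of_nonneg_left ((hψ q).bound u) (abs_nonneg _)
  centered t := by
    rw [integral_finsetSum _ fun q _ => (((hψ q).memLp h t 1).integrable le_rfl).const_mul _]
    exact Finset.sum_eq_zero fun q _ => by rw [integral_const_mul, (hψ q).centered, mul_zero]

/-- The bootstrap covariance of two series converges in mean to the long run covariance. -/
theorem tendsto_integral_abs_bootProd_sub (hψ : CenteredFunctional P δ ψ K)
    (hφ : CenteredFunctional P δ φ L) (h : IsIID P δ) {w : ℝ → ℝ} (hw : IsTaper w) {k b : ℕ → ℕ}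
    (hkb : BlockRegime k b) :
    (∀ j, Integrable (fun ω =>
      bootProd w (k j) (b j) (scalarObs δ ψ ω) (scalarObs δ φ ω)) P) ∧
    Tendsto (fun j => ∫ ω, |bootProd w (k j) (b j) (scalarObs δ ψ ω) (scalarObs δ φ ω)
      - longRunCov P δ ψ φ| ∂P) atTop (𝓝 0) := by
  set σ₁ := longRunVar P δ (fun u => ψ u + φ u) with hσ₁
  set σ₂ := longRunVar P δ (fun u => ψ u - φ u) with hσ₂
  set A : ℕ → Ω → ℝ := fun j ω =>
    bootVar w (k j) (b j) (scalarObs δ (fun u => ψ u + φ u) ω) with hA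
  set B : ℕ → Ω → ℝ := fun j ω =>
    bootVar w (k j) (b j) (scalarObs δ (fun u => ψ u - φ u) ω) with hB
  have hAi : ∀ j, Integrable (A j) P := fun j =>
    ((hψ.add hφ h).integral_abs_bootVar_sub_le h hw (hkb.one_le_k j) (hkb.one_le_b j) 0).1
  have hBi : ∀ j, Integrable (B j) P := fun j =>
    ((hψ.sub hφ h).integral_abs_bootVar_sub_le h hw (hkb.one_le_k j) (hkb.one_le_b j) 0).1
  have heq : ∀ j ω, bootProd w (k j) (b j) (scalarObs δ ψ ω) (scalarObs δ φ ω)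
      = (A j ω - B j ω) / 4 := fun j ω => bootProd_eq w _ (hkb.one_le_b j) _ _
  have hPi : ∀ j, Integrable (fun ω =>
      bootProd w (k j) (b j) (scalarObs δ ψ ω) (scalarObs δ φ ω)) P := fun j => by
    simp_rw [heq]
    exact ((hAi j).sub (hBi j)).div_const 4
  refine ⟨hPi, ?_⟩
  have hlim := ((hψ.add hφ h).tendsto_integral_abs_bootVar_sub h hw hkb).add
    ((hψ.sub hφ h).tendsto_integral_abs_bootVar_sub h hw hkb)
  rw [add_zero] at hlim
  refine squeeze_zero (fun j => integral_nonneg fun _ => abs_nonneg _) (fun j => ?_) hlim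
  have i1 : Integrable (fun ω => |A j ω - σ₁|) P := ((hAi j).sub (integrable_const _)).abs
  have i2 : Integrable (fun ω => |B j ω - σ₂|) P := ((hBi j).sub (integrable_const _)).abs
  rw [← integral_add i1 i2]
  refine integral_mono_of_nonneg (ae_of_all _ fun ω => abs_nonneg _) (i1.add i2)
    (ae_of_all _ fun ω => ?_)
  dsimp only [Pi.add_apply]
  rw [heq, longRunCov]
  have h1 : (A j ω - B j ω) / 4 - (σ₁ - σ₂) / 4 = ((A j ω - σ₁) - (B j ω - σ₂)) / 4 := by ring
  rw [h1, abs_div, abs_of_pos (by norm_num : (0 : ℝ) < 4)]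
  have h2 := abs_sub (A j ω - σ₁) (B j ω - σ₂)
  have h3 := abs_nonneg (A j ω - σ₁)
  have h4 := abs_nonneg (B j ω - σ₂)
  linarith

/-- The covariance of the scaled sample means of two series. -/
noncomputable def meanProd (P : Measure Ω) (δ : ℤ → Ω → S) {m : ℕ} (ψ φ : (Fin m → S) → ℝ)
    (n : ℕ) : ℝ :=
  ∫ ω, (√(n : ℝ) * sampleMean n (scalarObs δ ψ ω)) * (√(n : ℝ) * sampleMean n (scalarObs δ φ ω)) ∂P

lemma sampleMean_add {E : Type*} [NormedAddCommGroup E] [InnerProductSpace ℝ E] (n : ℕ)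
    (y z : ℕ → E) : sampleMean n (fun t => y t + z t) = sampleMean n y + sampleMean n z := by
  simp only [sampleMean, Finset.sum_add_distrib, smul_add]

lemma sampleMean_sub {E : Type*} [NormedAddCommGroup E] [InnerProductSpace ℝ E] (n : ℕ)
    (y z : ℕ → E) : sampleMean n (fun t => y t - z t) = sampleMean n y - sampleMean n z := by
  simp only [sampleMean, Finset.sum_sub_distrib, smul_sub]

lemma sampleMean_sum_smul {E κ : Type*} [NormedAddCommGroup E] [InnerProductSpace ℝ E] [Fintype κ]
    (n : ℕ) (ξ : κ → ℕ → ℝ) (x : κ → E) :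
    sampleMean n (fun t => ∑ q, ξ q t • x q) = ∑ q, sampleMean n (ξ q) • x q := by
  simp only [sampleMean]
  rw [Finset.sum_comm, Finset.smul_sum]
  simp only [smul_eq_mul, mul_smul, Finset.sum_smul]

theorem tendsto_meanProd (hψ : CenteredFunctional P δ ψ K)
    (hφ : CenteredFunctional P δ φ L) (h : IsIID P δ) :
    Tendsto (meanProd P δ ψ φ) atTop (𝓝 (longRunCov P δ ψ φ)) := by
  have h1 := (((hψ.add hφ h).tendsto_integral_scaledMean_sq h).sub
    ((hψ.sub hφ h).tendsto_integral_scaledMean_sq h)).div_const 4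
  refine h1.congr fun n => ?_
  have i1 := integrable_norm_sq (((hψ.add hφ h).memLp_sampleMean h n 2).const_mul (√(n : ℝ)))
  have i2 := integrable_norm_sq (((hψ.sub hφ h).memLp_sampleMean h n 2).const_mul (√(n : ℝ)))
  simp only [Real.norm_eq_abs, sq_abs] at i1 i2
  rw [← integral_sub i1 i2, ← integral_div, meanProd]
  congr 1 with ω
  have e1 : sampleMean n (scalarObs δ (fun u => ψ u + φ u) ω)
      = sampleMean n (scalarObs δ ψ ω) + sampleMean n (scalarObs δ φ ω) := sampleMean_add n _ _
  have e2 : sampleMean n (scalarObs δ (fun u => ψ u - φ u) ω)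
      = sampleMean n (scalarObs δ ψ ω) - sampleMean n (scalarObs δ φ ω) := sampleMean_sub n _ _
  rw [e1, e2]
  ring

/-- Symmetry is inherited from the covariances of the scaled means, whose limits these are. -/
lemma longRunCov_comm (hψ : CenteredFunctional P δ ψ K) (hφ : CenteredFunctional P δ φ L)
    (h : IsIID P δ) : longRunCov P δ ψ φ = longRunCov P δ φ ψ := by
  refine tendsto_nhds_unique (hψ.tendsto_meanProd hφ h) ((hφ.tendsto_meanProd hψ h).congr ?_)
  intro n
  simp only [meanProd, mul_comm]

lemma scaledMean_linComb {κ : Type*} [Fintype κ] (ψ : κ → (Fin m → S) → ℝ) (c : κ → ℝ) (n : ℕ)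
    (ω : Ω) : √(n : ℝ) * sampleMean n (scalarObs δ (fun u => ∑ q, c q * ψ q u) ω)
      = ∑ q, c q * (√(n : ℝ) * sampleMean n (scalarObs δ (ψ q) ω)) := by
  have h := sampleMean_sum_smul n (fun q => scalarObs δ (ψ q) ω) c
  have h2 : scalarObs δ (fun u => ∑ q, c q * ψ q u) ω
      = fun t => ∑ q, scalarObs δ (ψ q) ω t • c q := by
    ext t
    simp only [scalarObs, smul_eq_mul, mul_comm]
  rw [h2, h, Finset.mul_sum]
  refine Finset.sum_congr rfl fun q _ => ?_
  rw [smul_eq_mul]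
  ring

/-- The long run variance is a quadratic form. -/
theorem longRunVar_linComb {κ : Type*} [Fintype κ] {ψ : κ → (Fin m → S) → ℝ}
    (hψ : ∀ q, CenteredFunctional P δ (ψ q) K) (h : IsIID P δ) (c : κ → ℝ) :
    longRunVar P δ (fun u => ∑ q, c q * ψ q u)
      = ∑ q, ∑ q', c q * c q' * longRunCov P δ (ψ q) (ψ q') := by
  have h1 : Tendsto (fun n => ∑ q, ∑ q', c q * c q' * meanProd P δ (ψ q) (ψ q') n) atTop
      (𝓝 (∑ q, ∑ q', c q * c q' * longRunCov P δ (ψ q) (ψ q'))) :=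
    tendsto_finsetSum _ fun q _ => tendsto_finsetSum _ fun q' _ =>
      ((hψ q).tendsto_meanProd (hψ q') h).const_mul _
  -- The quadratic identity holds for the scaled means at every `n`, so the two limits agree.
  refine tendsto_nhds_unique ((linComb hψ h c).tendsto_integral_scaledMean_sq h) (h1.congr fun n => ?_)
  have hi : ∀ q q', Integrable (fun ω => (√(n : ℝ) * sampleMean n (scalarObs δ (ψ q) ω))
      * (√(n : ℝ) * sampleMean n (scalarObs δ (ψ q') ω))) P := fun q q' =>
    (((hψ q).memLp_sampleMean h n 2).const_mul (√(n : ℝ))).integrable_mul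
      (((hψ q').memLp_sampleMean h n 2).const_mul (√(n : ℝ)))
  simp_rw [scaledMean_linComb, sum_mul_sq]
  rw [integral_finsetSum _ fun q _ => integrable_finsetSum _ fun q' _ => (hi q q').const_mul _]
  refine Finset.sum_congr rfl fun q _ => ?_
  rw [integral_finsetSum _ fun q' _ => (hi q q').const_mul _]
  refine Finset.sum_congr rfl fun q' _ => ?_
  rw [integral_const_mul, meanProd]

end CenteredFunctional

end ScalarCovariance

/-! ### Processes with uniformly bounded second moments of weighted sums -/

section SumBounds

variable {Ω S H : Type*} [MeasurableSpace Ω] [MeasurableSpace S] {P : Measure Ω}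
  [IsProbabilityMeasure P] [NormedAddCommGroup H] [InnerProductSpace ℝ H]
  {δ : ℤ → Ω → S} {m : ℕ} {D : ℤ → Ω → H} {η : ℝ}

/-- The second moments of weighted sums are bounded by a multiple of the sum of the squared
weights. -/
structure SumBound (P : Measure Ω) (D : ℤ → Ω → H) (η : ℝ) : Prop where
  memLp : ∀ t, MemLp (D t) 2 P
  bound : ∀ (F : Finset ℤ) (a : ℤ → ℝ), ∫ ω, ‖∑ t ∈ F, a t • D t ω‖ ^ 2 ∂P ≤ η * ∑ t ∈ F, a t ^ 2

namespace SumBound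

lemma nonneg (hD : SumBound P D η) : 0 ≤ η := by
  have h := hD.bound {0} fun _ => 1
  simp only [Finset.sum_singleton, one_smul, one_pow, mul_one] at h
  exact (integral_nonneg fun _ => by positivity).trans h

lemma bound_comp (hD : SumBound P D η) {ι : Type*} (F : Finset ι) {p : ι → ℤ}
    (hp : Function.Injective p) (a : ι → ℝ) :
    ∫ ω, ‖∑ i ∈ F, a i • D (p i) ω‖ ^ 2 ∂P ≤ η * ∑ i ∈ F, a i ^ 2 := by
  classical
  -- The weights are transported to times along `p`; the default value zero off the range of `p`
  -- plays no role.
  have h := hD.bound (F.image p) (Function.extend p a 0)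
  simpa only [Finset.sum_image (fun i _ j _ hij => hp hij), hp.extend_apply] using h

lemma memLp_blockSum (hD : SumBound P D η) (w : ℝ → ℝ) (b i : ℕ) :
    MemLp (fun ω => blockSum w b (obs D ω) i) 2 P :=
  memLp_finsetSum _ fun _ _ => (hD.memLp _).const_smul _

lemma integral_blockSum_le (hD : SumBound P D η) (w : ℝ → ℝ) (b i : ℕ) :
    ∫ ω, ‖blockSum w b (obs D ω) i‖ ^ 2 ∂P ≤ η := by
  refine (hD.bound_comp (Finset.range b) (p := fun r => ((i + 1 + r : ℕ) : ℤ))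
    (fun r s hrs => by simpa using hrs) (fun r => intWindow w b r / windowNorm w b)).trans ?_
  exact mul_le_of_le_one_right hD.nonneg (sum_sq_div_windowNorm_le w b)

lemma memLp_sampleMean (hD : SumBound P D η) (n : ℕ) :
    MemLp (fun ω => √(n : ℝ) • sampleMean n (obs D ω)) 2 P := by
  have h1 : MemLp (fun ω => ∑ t ∈ Finset.Icc 1 n, obs D ω t) 2 P :=
    memLp_finsetSum _ fun t _ => hD.memLp t
  exact (h1.const_smul ((n : ℝ)⁻¹)).const_smul (√(n : ℝ))

lemma integral_scaledMean_le (hD : SumBound P D η) (n : ℕ) :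
    ∫ ω, ‖√(n : ℝ) • sampleMean n (obs D ω)‖ ^ 2 ∂P ≤ η := by
  have h := hD.bound_comp (Finset.Icc 1 n) (p := fun t => (t : ℤ)) (fun r s hrs => by simpa using hrs)
    fun _ => √(n : ℝ) * (n : ℝ)⁻¹
  simp only [← Finset.smul_sum, mul_smul] at h
  refine h.trans (mul_le_of_le_one_right hD.nonneg ?_)
  rcases Nat.eq_zero_or_pos n with rfl | hn
  · simp
  have hn0 : (0 : ℝ) < n := by exact_mod_cast hn
  simp only [Finset.sum_const, Nat.card_Icc, nsmul_eq_mul, mul_pow, Real.sq_sqrt hn0.le]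
  simp only [add_tsub_cancel_right]
  field_simp
  rfl

variable [CompleteSpace H]

/-- The conditional second moment of the scaled bootstrap deviation. -/
noncomputable def bootSq (w : ℝ → ℝ) (k b : ℕ) (y : ℕ → H) : ℝ :=
  ∫ I, ‖√((k * b : ℕ) : ℝ) • bootDev w k b y I‖ ^ 2 ∂(drawLaw k b : Measure (Draw k b))

lemma bootSq_nonneg (w : ℝ → ℝ) (k b : ℕ) (y : ℕ → H) : 0 ≤ bootSq w k b y :=
  integral_nonneg fun _ => by positivity

lemma integrable_bootSq (hD : SumBound P D η) (w : ℝ → ℝ) {k b : ℕ} (hk : 1 ≤ k) (hb : 1 ≤ b) :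
    Integrable (fun ω => bootSq w k b (obs D ω)) P := by
  simp_rw [bootSq, integral_norm_sq_scaled_bootDev w hk hb]
  have h1 : MemLp (fun ω => ∑ i : Fin (numBlocks (k * b) b), blockSum w b (obs D ω) i) 2 P :=
    memLp_finsetSum _ fun i _ => hD.memLp_blockSum w b i
  have h2 : Integrable (fun ω => ‖blockMean w k b (obs D ω)‖ ^ 2) P :=
    integrable_norm_sq (h1.const_smul ((numBlocks (k * b) b : ℝ)⁻¹))
  have h3 : Integrable (fun ω =>
      ∑ i : Fin (numBlocks (k * b) b), ‖blockSum w b (obs D ω) i‖ ^ 2) P :=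
    integrable_finsetSum _ fun i _ => integrable_norm_sq (hD.memLp_blockSum w b i)
  exact (h3.const_mul _).sub h2

/-- Given the data, the second moment is at most the average of the squared block norms, and each
block is a weighted sum with `∑ a² ≤ 1`. The bound involves neither `k` nor `b`. -/
lemma integral_bootSq_le (hD : SumBound P D η) (w : ℝ → ℝ) {k b : ℕ} (hk : 1 ≤ k) (hb : 1 ≤ b) :
    ∫ ω, bootSq w k b (obs D ω) ∂P ≤ η := by
  set N := numBlocks (k * b) b with hN
  have hN0 : (0 : ℝ) < N := by have : 0 < N := Nat.succ_pos _
                               exact_mod_cast this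
  have hi : ∀ i : ℕ, Integrable (fun ω => ‖blockSum w b (obs D ω) i‖ ^ 2) P := fun i =>
    integrable_norm_sq (hD.memLp_blockSum w b i)
  calc ∫ ω, bootSq w k b (obs D ω) ∂P
      ≤ ∫ ω, (N : ℝ)⁻¹ * ∑ i : Fin N, ‖blockSum w b (obs D ω) i‖ ^ 2 ∂P :=
        integral_mono (hD.integrable_bootSq w hk hb)
          ((integrable_finsetSum _ fun i _ => hi _).const_mul _)
          fun ω => integral_norm_sq_scaled_bootDev_le w hk hb _
    _ = (N : ℝ)⁻¹ * ∑ i : Fin N, ∫ ω, ‖blockSum w b (obs D ω) i‖ ^ 2 ∂P := by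
        rw [integral_const_mul, integral_finsetSum _ fun i _ => hi _]
    _ ≤ (N : ℝ)⁻¹ * ∑ _i : Fin N, η := by
        gcongr with i _
        exact hD.integral_blockSum_le w b i
    _ = η := by
        rw [Finset.sum_const, Finset.card_univ, Fintype.card_fin, nsmul_eq_mul]
        field_simp

end SumBound

variable {κ : Type*} [Fintype κ] {ψ : κ → (Fin m → S) → ℝ} {x : κ → H} {K : ℝ}

/-- The process with components `ψ q (δ_t, …, δ_{t-m+1})` along the vectors `x q`. -/
noncomputable def combine (δ : ℤ → Ω → S) (ψ : κ → (Fin m → S) → ℝ) (x : κ → H) (t : ℤ) (ω : Ω) :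
    H := ∑ q, ψ q (recent δ m t ω) • x q

lemma obs_combine (ω : Ω) :
    obs (combine δ ψ x) ω = fun t => ∑ q, scalarObs δ (ψ q) ω t • x q := rfl

variable [CompleteSpace H] [SecondCountableTopology H] [MeasurableSpace H] [BorelSpace H]

lemma exists_sumBound_combine (h : IsIID P δ) (hψ : ∀ q, CenteredFunctional P δ (ψ q) K)
    (x : κ → H) : ∃ C, SumBound P (combine δ ψ x) C := by
  have hf : ∀ t, Measurable[innovField δ (Set.Ioc (t - m : ℤ) t)] (combine δ ψ x t) := fun t =>
    Finset.measurable_sum _ fun q _ => ((hψ q).measurable_field le_rfl).smul_const _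
  have hb : ∀ t ω, ‖combine δ ψ x t ω‖ ≤ ∑ q, K * ‖x q‖ := fun t ω =>
    (norm_sum_le _ _).trans (Finset.sum_le_sum fun q _ => by
      rw [norm_smul]
      exact mul_le_mul_of_nonneg_right ((hψ q).bound _) (norm_nonneg _))
  have hL : ∀ t, MemLp (combine δ ψ x t) 2 P := fun t =>
    MemLp.of_bound ((hf t).mono (h.innovField_le _) le_rfl).aestronglyMeasurable _
      (ae_of_all _ fun ω => hb t ω)
  refine ⟨2 * (m * (∑ q, K * ‖x q‖) ^ 2), hL, fun F a => ?_⟩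
  refine integral_norm_sq_sum_le_of_range F (p := id) Function.injective_id a
    (X := combine δ ψ x) (fun t _ => hL t) (fun t _ => ?_) m (fun s _ t _ hst => ?_)
  · have := integral_mono (integrable_norm_sq (hL t)) (integrable_const _) fun ω =>
      pow_le_pow_left₀ (norm_nonneg _) (hb t ω) 2
    simpa using this
  · refine h.integral_inner_eq_zero (A := Set.Ioc (s - m) s) (B := Set.Ioc (t - m) t) ?_
      (hf s) (hf t) (hL s) (hL t) ?_
    · rw [Set.disjoint_left]
      intro i hi hi'
      simp only [Set.mem_Ioc, id] at hi hi' hst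
      omega
    · simp only [combine]
      rw [integral_finsetSum _ fun q _ => (((hψ q).memLp h s 1).integrable le_rfl).smul_const _]
      exact Finset.sum_eq_zero fun q _ => by rw [integral_smul_const, (hψ q).centered, zero_smul]

lemma SumBound.of_sub {Y V : ℤ → Ω → H} {C : ℝ} (hD : SumBound P (fun t ω => Y t ω - V t ω) η)
    (hV : SumBound P V C) : SumBound P Y (2 * η + 2 * C) where
  memLp t := ((hD.memLp t).add (hV.memLp t)).congr_norm
    (by
      have := ((hD.memLp t).add (hV.memLp t)).1
      simpa [Pi.add_def] using this) (ae_of_all _ fun ω => by simp)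
  bound F a := by
    have hDF : MemLp (fun ω => ∑ t ∈ F, a t • (Y t ω - V t ω)) 2 P :=
      memLp_finsetSum F fun t _ => (hD.memLp t).const_smul (a t)
    have hVF : MemLp (fun ω => ∑ t ∈ F, a t • V t ω) 2 P :=
      memLp_finsetSum F fun t _ => (hV.memLp t).const_smul (a t)
    have h1 := integral_norm_add_sq_le hDF hVF
    have h2 := hD.bound F a
    have h3 := hV.bound F a
    simp only [← Finset.sum_add_distrib, ← smul_add, sub_add_cancel] at h1
    linarith

variable {f : (ℕ → S) → H} {Y : ℤ → Ω → H}

/-- A centered strongly approximable process is uniformly approximated by processes of finite range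
and finite rank. -/
theorem StronglyApproximable.exists_sumBound_sub (hdep : StronglyApproximable P Y f δ)
    (hmean : ∀ t, ∫ ω, Y t ω ∂P = 0) {η : ℝ} (hη : 0 < η) :
    ∃ (m : ℕ) (Q : Finset H) (ψ : Q → (Fin m → S) → ℝ),
      (∀ q, CenteredFunctional P δ (ψ q) 1) ∧
      SumBound P (fun t ω => Y t ω - combine δ ψ (fun q : Q => (q : H)) t ω) η := by
  obtain ⟨m, Q, ψ, hm, h1, h0, hb⟩ := hdep.exists_finite_range_approx hmean hη
  have hψ : ∀ q, CenteredFunctional P δ (ψ q) 1 := fun q => ⟨hm q, h1 q, h0 q⟩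
  obtain ⟨C, hC⟩ := exists_sumBound_combine hdep.isIID hψ (fun q : Q => (q : H))
  exact ⟨m, Q, ψ, hψ, fun t => (hdep.memLp_two t).sub (hC.memLp t), hb⟩

theorem StronglyApproximable.exists_sumBound (hdep : StronglyApproximable P Y f δ)
    (hmean : ∀ t, ∫ ω, Y t ω ∂P = 0) : ∃ C, SumBound P Y C := by
  obtain ⟨m, Q, ψ, hψ, hD⟩ := hdep.exists_sumBound_sub hmean one_pos
  obtain ⟨C, hC⟩ := exists_sumBound_combine hdep.isIID hψ (fun q : Q => (q : H))
  exact ⟨_, hD.of_sub hC⟩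

end SumBounds

/-! ### Consistency of the bootstrap covariance operator -/

section Domination

variable {Ω : Type*} [MeasurableSpace Ω] {P : Measure Ω} [IsProbabilityMeasure P]

/-- Convergence to zero in probability from domination by integrable variables. -/
lemma tendsto_measure_le_of_dominated {G : ℕ → Ω → ℝ≥0∞}
    (h : ∀ κ : ℝ, 0 < κ → ∃ A : ℕ → Ω → ℝ, (∀ j, Integrable (A j) P) ∧ (∀ j ω, 0 ≤ A j ω) ∧
      ∀ᶠ j in atTop, (∀ ω, G j ω ≤ ENNReal.ofReal (A j ω)) ∧ ∫ ω, A j ω ∂P ≤ κ)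
    {ε : ℝ≥0∞} (hε : 0 < ε) : Tendsto (fun j => P {ω | ε ≤ G j ω}) atTop (𝓝 0) := by
  obtain ⟨r, hr0, hrε⟩ : ∃ r : ℝ, 0 < r ∧ ENNReal.ofReal r ≤ ε := by
    rcases eq_or_ne ε ⊤ with rfl | hε'
    · exact ⟨1, one_pos, le_top⟩
    · exact ⟨ε.toReal, ENNReal.toReal_pos hε.ne' hε', (ENNReal.ofReal_toReal hε').le⟩
  rw [ENNReal.tendsto_atTop_zero]
  intro τ hτ
  obtain ⟨s, hs0, hsτ⟩ : ∃ s : ℝ, 0 < s ∧ ENNReal.ofReal s ≤ τ := by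
    rcases eq_or_ne τ ⊤ with rfl | hτ'
    · exact ⟨1, one_pos, le_top⟩
    · exact ⟨τ.toReal, ENNReal.toReal_pos hτ.ne' hτ', (ENNReal.ofReal_toReal hτ').le⟩
  obtain ⟨A, hAi, hA0, hA⟩ := h (r * s) (by positivity)
  obtain ⟨J, hJ⟩ := eventually_atTop.1 hA
  refine ⟨J, fun j hj => le_trans ?_ hsτ⟩
  -- Markov's inequality is applied to the dominating variable only, so `G` need not be measurable.
  have hsub : {ω | ε ≤ G j ω} ⊆ {ω | r ≤ A j ω} := fun ω hω =>
    (ENNReal.ofReal_le_ofReal_iff (hA0 j ω)).1 (hrε.trans (le_trans hω ((hJ j hj).1 ω)))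
  refine (measure_mono hsub).trans ?_
  have hm := mul_meas_ge_le_integral_of_nonneg (ae_of_all _ (hA0 j)) (hAi j) r
  have h1 : P.real {ω | r ≤ A j ω} ≤ s := by
    have := hm.trans (hJ j hj).2
    exact le_of_mul_le_mul_left this hr0
  rw [← ofReal_measureReal]
  exact ENNReal.ofReal_le_ofReal h1

end Domination

section CovarianceOperator

variable {H : Type*} [NormedAddCommGroup H] [InnerProductSpace ℝ H] [CompleteSpace H]

open SumBound

lemma bootCov_eq (w : ℝ → ℝ) (k b : ℕ) (y : ℕ → H) :
    bootCov w k b y = ∫ I, tensor (√((k * b : ℕ) : ℝ) • bootDev w k b y I)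
      (√((k * b : ℕ) : ℝ) • bootDev w k b y I) ∂(drawLaw k b : Measure (Draw k b)) := by
  simp_rw [tensor_smul_smul, Real.mul_self_sqrt (Nat.cast_nonneg (α := ℝ) (k * b))]
  rw [integral_smul, bootCov]

lemma meanCov_eq {Ω : Type*} [MeasurableSpace Ω] (P : Measure Ω) (Y : ℤ → Ω → H) (n : ℕ) :
    meanCov P Y n = ∫ ω, tensor (√(n : ℝ) • sampleMean n (obs Y ω))
      (√(n : ℝ) • sampleMean n (obs Y ω)) ∂P := by
  simp_rw [tensor_smul_smul, Real.mul_self_sqrt (Nat.cast_nonneg (α := ℝ) n)]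
  rw [integral_smul, meanCov]

variable {ι : Type*} (e : HilbertBasis ι ℝ H)

lemma hsNorm_neg (Ψ : H →L[ℝ] H) : hsNorm e (-Ψ) = hsNorm e Ψ := by
  simp [hsNorm]

lemma hsNorm_smul_tensor_le (c : ℝ) (f g : H) :
    hsNorm e (c • tensor f g) ≤ ENNReal.ofReal (|c| * (‖f‖ * ‖g‖)) := by
  have h1 : c • tensor f g = tensor (c • f) g := by
    have := tensor_smul_smul c 1 f g
    rw [one_smul, mul_one] at this
    exact this.symm
  rw [h1]
  refine (hsNorm_tensor_le e _ _).trans (le_of_eq ?_)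
  rw [norm_smul, Real.norm_eq_abs, mul_assoc]

lemma hsNorm_bootCov_sub_le (w : ℝ → ℝ) {k b : ℕ} (hb : 1 ≤ b) (y z : ℕ → H) {θ : ℝ} (hθ : 0 < θ) :
    hsNorm e (bootCov w k b y - bootCov w k b z)
      ≤ ENNReal.ofReal ((1 + 1 / θ) * bootSq w k b (fun t => y t - z t)
        + θ * bootSq w k b y) := by
  rw [bootCov_eq, bootCov_eq]
  have h := hsNorm_integral_tensor_sub_le (μ := (drawLaw k b : Measure (Draw k b))) e
    (f := fun I => √((k * b : ℕ) : ℝ) • bootDev w k b y I)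
    (g := fun I => √((k * b : ℕ) : ℝ) • bootDev w k b z I) MemLp.of_discrete MemLp.of_discrete hθ
  simp_rw [scaled_bootDev_sub w k hb] at h
  exact h

variable {Ω S : Type*} [MeasurableSpace Ω] [MeasurableSpace S] {P : Measure Ω}
  [IsProbabilityMeasure P] {δ : ℤ → Ω → S} {m : ℕ} {κ : Type*} [Fintype κ]
  {ψ : κ → (Fin m → S) → ℝ} {K : ℝ}

lemma hsNorm_meanCov_sub_le {Y V : ℤ → Ω → H} {C η : ℝ} (hY : SumBound P Y C)
    (hV : ∀ t, MemLp (V t) 2 P) (hD : SumBound P (fun t ω => Y t ω - V t ω) η) (n : ℕ)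
    {θ : ℝ} (hθ : 0 < θ) :
    hsNorm e (meanCov P V n - meanCov P Y n) ≤ ENNReal.ofReal ((1 + 1 / θ) * η + θ * C) := by
  rw [← hsNorm_neg, neg_sub, meanCov_eq, meanCov_eq]
  have hVn : MemLp (fun ω => √(n : ℝ) • sampleMean n (obs V ω)) 2 P := by
    have h1 : MemLp (fun ω => ∑ t ∈ Finset.Icc 1 n, obs V ω t) 2 P :=
      memLp_finsetSum _ fun t _ => hV t
    exact (h1.const_smul ((n : ℝ)⁻¹)).const_smul (√(n : ℝ))
  refine (hsNorm_integral_tensor_sub_le e (hY.memLp_sampleMean n) hVn hθ).trans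
    (ENNReal.ofReal_le_ofReal ?_)
  have h1 := hD.integral_scaledMean_le n
  have h2 := hY.integral_scaledMean_le n
  have h3 : ∀ ω, √(n : ℝ) • sampleMean n (obs Y ω) - √(n : ℝ) • sampleMean n (obs V ω)
      = √(n : ℝ) • sampleMean n (obs (fun t ω => Y t ω - V t ω) ω) := fun ω => by
    rw [← smul_sub, ← CenteredFunctional.sampleMean_sub]
    rfl
  simp_rw [h3]
  gcongr

lemma bootCov_combine (w : ℝ → ℝ) (k : ℕ) {b : ℕ} (hb : 1 ≤ b) (x : κ → H) (ω : Ω) :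
    bootCov w k b (obs (combine δ ψ x) ω) = ∑ q, ∑ q',
      bootProd w k b (scalarObs δ (ψ q) ω) (scalarObs δ (ψ q') ω) • tensor (x q) (x q') := by
  rw [bootCov_eq, obs_combine]
  simp_rw [scaled_bootDev_sum_smul w k hb (fun q => scalarObs δ (ψ q) ω) x, tensor_sum_sum]
  rw [integral_finsetSum _ fun _ _ => Integrable.of_finite]
  refine Finset.sum_congr rfl fun q _ => ?_
  rw [integral_finsetSum _ fun _ _ => Integrable.of_finite]
  refine Finset.sum_congr rfl fun q' _ => ?_
  rw [integral_smul_const, bootProd]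

lemma meanCov_combine (h : IsIID P δ) (hψ : ∀ q, CenteredFunctional P δ (ψ q) K) (x : κ → H)
    (n : ℕ) : meanCov P (combine δ ψ x) n = ∑ q, ∑ q',
      CenteredFunctional.meanProd P δ (ψ q) (ψ q') n • tensor (x q) (x q') := by
  have hi : ∀ q q', Integrable (fun ω => ((√(n : ℝ) * sampleMean n (scalarObs δ (ψ q) ω))
      * (√(n : ℝ) * sampleMean n (scalarObs δ (ψ q') ω))) • tensor (x q) (x q')) P := fun q q' =>
    ((((hψ q).memLp_sampleMean h n 2).const_mul (√(n : ℝ))).integrable_mul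
      (((hψ q').memLp_sampleMean h n 2).const_mul (√(n : ℝ)))).smul_const _
  have hexp : ∀ ω, √(n : ℝ) • sampleMean n (obs (combine δ ψ x) ω)
      = ∑ q, (√(n : ℝ) * sampleMean n (scalarObs δ (ψ q) ω)) • x q := fun ω => by
    rw [obs_combine, CenteredFunctional.sampleMean_sum_smul, Finset.smul_sum]
    simp_rw [smul_smul]
  rw [meanCov_eq]
  simp_rw [hexp, tensor_sum_sum]
  rw [integral_finsetSum _ fun q _ => integrable_finsetSum _ fun q' _ => hi q q']
  refine Finset.sum_congr rfl fun q _ => ?_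
  rw [integral_finsetSum _ fun q' _ => hi q q']
  refine Finset.sum_congr rfl fun q' _ => ?_
  rw [integral_smul_const, CenteredFunctional.meanProd]

lemma hsNorm_sum_tensor_le (x : κ → H) (c : κ → κ → ℝ) :
    hsNorm e (∑ q, ∑ q', c q q' • tensor (x q) (x q'))
      ≤ ENNReal.ofReal (∑ q, ∑ q', |c q q'| * (‖x q‖ * ‖x q'‖)) := by
  refine (hsNorm_sum_le e _ _).trans ?_
  rw [ENNReal.ofReal_sum_of_nonneg fun q _ => Finset.sum_nonneg fun q' _ => by positivity]
  refine Finset.sum_le_sum fun q _ => (hsNorm_sum_le e _ _).trans ?_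
  rw [ENNReal.ofReal_sum_of_nonneg fun q' _ => by positivity]
  exact Finset.sum_le_sum fun q' _ => hsNorm_smul_tensor_le e _ _ _

variable [SecondCountableTopology H] [MeasurableSpace H] [BorelSpace H] {f : (ℕ → S) → H}
  {Y : ℤ → Ω → H}

/-- The bootstrap covariance operator is consistent in probability. -/
theorem StronglyApproximable.tendsto_measure_hsNorm_bootCov_sub
    (hdep : StronglyApproximable P Y f δ) (hmean : ∀ t, ∫ ω, Y t ω ∂P = 0) {w : ℝ → ℝ}
    (hw : IsTaper w) {k b : ℕ → ℕ} (hkb : BlockRegime k b) {ε : ℝ≥0∞} (hε : 0 < ε) :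
    Tendsto (fun j => P {ω | ε ≤ hsNorm e
      (bootCov w (k j) (b j) (obs Y ω) - meanCov P Y (k j * b j))}) atTop (𝓝 0) := by
  refine tendsto_measure_le_of_dominated (fun τ hτ => ?_) hε
  have h := hdep.isIID
  obtain ⟨C, hC⟩ := hdep.exists_sumBound hmean
  have hC0 := hC.nonneg
  -- First `θ` is chosen so that `θ * C ≤ τ / 8`, then `η` so that `(1 + 1 / θ) * η = τ / 8`. Both
  -- terms occur for the bootstrap and for the mean; with `τ / 4` for the finite rank part the total
  -- stays below `τ`.
  set θ := τ / (8 * (C + 1)) with hθ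
  have hθ0 : 0 < θ := by positivity
  set η := τ / (8 * (1 + 1 / θ)) with hη
  have hη0 : 0 < η := by positivity
  obtain ⟨m, Q, ψ, hψ, hD⟩ := hdep.exists_sumBound_sub hmean hη0
  set x : Q → H := fun q => (q : H) with hx
  set V := combine δ ψ x with hV
  obtain ⟨CV, hCV⟩ := exists_sumBound_combine h hψ x
  set β : ℕ → Q → Q → Ω → ℝ := fun j q q' ω =>
    bootProd w (k j) (b j) (scalarObs δ (ψ q) ω) (scalarObs δ (ψ q') ω) with hβ
  set α : ℕ → Q → Q → ℝ := fun j q q' =>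
    CenteredFunctional.meanProd P δ (ψ q) (ψ q') (k j * b j) with hα
  set Γ : Q → Q → ℝ := fun q q' => longRunCov P δ (ψ q) (ψ q') with hΓ
  have hβi : ∀ j q q', Integrable (β j q q') P := fun j q q' =>
    ((hψ q).tendsto_integral_abs_bootProd_sub (hψ q') h hw hkb).1 j
  have hβlim : ∀ q q', Tendsto (fun j => ∫ ω, |β j q q' ω - Γ q q'| ∂P) atTop (𝓝 0) := fun q q' =>
    ((hψ q).tendsto_integral_abs_bootProd_sub (hψ q') h hw hkb).2
  have hαlim : ∀ q q', Tendsto (fun j => α j q q') atTop (𝓝 (Γ q q')) := fun q q' =>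
    ((hψ q).tendsto_meanProd (hψ q') h).comp hkb.tendsto_n
  -- For finite rank both operators are combinations of the same `x q ⊗ x q'`, so only their
  -- coefficients need comparison; these have the common limit `Γ`.
  set G : ℕ → Ω → ℝ := fun j ω => ∑ q, ∑ q', |β j q q' ω - α j q q'| * (‖x q‖ * ‖x q'‖) with hG
  have hGi' : ∀ j q q', Integrable (fun ω => |β j q q' ω - α j q q'| * (‖x q‖ * ‖x q'‖)) P :=
    fun j q q' => ((hβi j q q').sub (integrable_const _)).abs.mul_const _
  have hGi : ∀ j, Integrable (G j) P := fun j =>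
    integrable_finsetSum _ fun q _ => integrable_finsetSum _ fun q' _ => hGi' j q q'
  have hG0 : ∀ j ω, 0 ≤ G j ω := fun j ω => by positivity
  have hGlim : Tendsto (fun j => ∫ ω, G j ω ∂P) atTop (𝓝 0) := by
    have h1 : Tendsto (fun j => ∑ q, ∑ q', (∫ ω, |β j q q' ω - Γ q q'| ∂P + |α j q q' - Γ q q'|)
        * (‖x q‖ * ‖x q'‖)) atTop (𝓝 (∑ q : Q, ∑ q' : Q, (0 + |Γ q q' - Γ q q'|) * (‖x q‖ * ‖x q'‖))) :=
      tendsto_finsetSum _ fun q _ => tendsto_finsetSum _ fun q' _ =>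
        ((hβlim q q').add ((hαlim q q').sub_const _).abs).mul_const _
    simp only [sub_self, abs_zero, add_zero, zero_mul, Finset.sum_const_zero] at h1
    refine squeeze_zero (fun j => integral_nonneg (hG0 j)) (fun j => ?_) h1
    rw [hG]
    dsimp only
    rw [integral_finsetSum _ fun q _ => integrable_finsetSum _ fun q' _ => hGi' j q q']
    refine Finset.sum_le_sum fun q _ => ?_
    rw [integral_finsetSum _ fun q' _ => hGi' j q q']
    refine Finset.sum_le_sum fun q' _ => ?_
    rw [integral_mul_const]
    refine mul_le_mul_of_nonneg_right ?_ (by positivity)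
    have i1 : Integrable (fun ω => |β j q q' ω - Γ q q'|) P :=
      ((hβi j q q').sub (integrable_const _)).abs
    have i2 : Integrable (fun ω => |β j q q' ω - Γ q q'| + |α j q q' - Γ q q'|) P :=
      i1.add (integrable_const _)
    refine (integral_mono ((hβi j q q').sub (integrable_const _)).abs i2 fun ω => ?_).trans ?_
    · dsimp only [Pi.sub_apply]
      rw [abs_sub_comm (α j q q')]
      exact abs_sub_le _ _ _
    · rw [integral_add i1 (integrable_const _)]
      simp
  set D : ℤ → Ω → H := fun t ω => Y t ω - V t ω with hDdef
  set A : ℕ → Ω → ℝ := fun j ω => ((1 + 1 / θ) * bootSq w (k j) (b j) (obs D ω)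
    + θ * bootSq w (k j) (b j) (obs Y ω)) + G j ω + ((1 + 1 / θ) * η + θ * C) with hA
  have hDi : ∀ j, Integrable (fun ω => bootSq w (k j) (b j) (obs D ω)) P := fun j =>
    hD.integrable_bootSq w (hkb.one_le_k j) (hkb.one_le_b j)
  have hYi : ∀ j, Integrable (fun ω => bootSq w (k j) (b j) (obs Y ω)) P := fun j =>
    hC.integrable_bootSq w (hkb.one_le_k j) (hkb.one_le_b j)
  have hA1 : ∀ j, Integrable (fun ω => (1 + 1 / θ) * bootSq w (k j) (b j) (obs D ω)
    + θ * bootSq w (k j) (b j) (obs Y ω)) P := fun j =>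
    ((hDi j).const_mul _).add ((hYi j).const_mul _)
  have hA2 : ∀ j, Integrable (fun ω => ((1 + 1 / θ) * bootSq w (k j) (b j) (obs D ω)
    + θ * bootSq w (k j) (b j) (obs Y ω)) + G j ω) P := fun j => (hA1 j).add (hGi j)
  have hnn : ∀ j ω, 0 ≤ (1 + 1 / θ) * bootSq w (k j) (b j) (obs D ω)
      + θ * bootSq w (k j) (b j) (obs Y ω) := fun j ω =>
    add_nonneg (mul_nonneg (by positivity) (bootSq_nonneg _ _ _ _))
      (mul_nonneg hθ0.le (bootSq_nonneg _ _ _ _))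
  have hcst : 0 ≤ (1 + 1 / θ) * η + θ * C := by positivity
  refine ⟨A, fun j => (hA2 j).add (integrable_const _),
    fun j ω => add_nonneg (add_nonneg (hnn j ω) (hG0 j ω)) hcst, ?_⟩
  filter_upwards [hGlim.eventually_le_const (show 0 < τ / 4 by positivity)] with j hj
  refine ⟨fun ω => ?_, ?_⟩
  · have hsplit : bootCov w (k j) (b j) (obs Y ω) - meanCov P Y (k j * b j)
        = (bootCov w (k j) (b j) (obs Y ω) - bootCov w (k j) (b j) (obs V ω))
          + (bootCov w (k j) (b j) (obs V ω) - meanCov P V (k j * b j))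
          + (meanCov P V (k j * b j) - meanCov P Y (k j * b j)) := by abel
    rw [hsplit, hA]
    dsimp only
    rw [ENNReal.ofReal_add (add_nonneg (hnn j ω) (hG0 j ω)) hcst,
      ENNReal.ofReal_add (hnn j ω) (hG0 j ω)]
    refine (hsNorm_add_le e _ _).trans (add_le_add ((hsNorm_add_le e _ _).trans
      (add_le_add ?_ ?_)) (hsNorm_meanCov_sub_le e hC hCV.memLp hD _ hθ0))
    · exact hsNorm_bootCov_sub_le e w (hkb.one_le_b j) _ _ hθ0
    · rw [bootCov_combine w _ (hkb.one_le_b j), meanCov_combine h hψ, ← Finset.sum_sub_distrib]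
      simp_rw [← Finset.sum_sub_distrib, ← sub_smul]
      exact hsNorm_sum_tensor_le e x fun q q' => β j q q' ω - α j q q'
  · rw [hA]
    dsimp only
    rw [integral_add (hA2 j) (integrable_const _), integral_add (hA1 j) (hGi j),
      integral_add ((hDi j).const_mul _) ((hYi j).const_mul _), integral_const_mul,
      integral_const_mul, integral_const]
    have e1 := hD.integral_bootSq_le w (hkb.one_le_k j) (hkb.one_le_b j)
    have e2 := hC.integral_bootSq_le w (hkb.one_le_k j) (hkb.one_le_b j)
    have e3 : (1 + 1 / θ) * η = τ / 8 := by rw [hη]; field_simp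
    have e4 : θ * C ≤ τ / 8 := by
      rw [hθ, div_mul_eq_mul_div, div_le_iff₀ (by positivity)]
      nlinarith
    have e5 : (1 + 1 / θ) * ∫ ω, bootSq w (k j) (b j) (obs D ω) ∂P ≤ (1 + 1 / θ) * η := by gcongr
    have e6 : θ * ∫ ω, bootSq w (k j) (b j) (obs Y ω) ∂P ≤ θ * C := by gcongr
    simp only [probReal_univ, one_smul]
    linarith

end CovarianceOperator

/-! ### The Lévy–Prokhorov distance -/

section LevyProkhorov

variable {H : Type*} [NormedAddCommGroup H] [MeasurableSpace H] [BorelSpace H]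

/-- The Lévy–Prokhorov distance of two probability measures. -/
noncomputable def lpDist (μ ν : ProbabilityMeasure H) : ℝ :=
  levyProkhorovDist (μ : Measure H) (ν : Measure H)

lemma lpDist_nonneg (μ ν : ProbabilityMeasure H) : 0 ≤ lpDist μ ν := ENNReal.toReal_nonneg

lemma lpDist_comm (μ ν : ProbabilityMeasure H) : lpDist μ ν = lpDist ν μ :=
  levyProkhorovDist_comm _ _

lemma lpDist_triangle (μ ν ρ : ProbabilityMeasure H) : lpDist μ ρ ≤ lpDist μ ν + lpDist ν ρ :=
  levyProkhorovDist_triangle _ _ _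

lemma lpDist_le_one (μ ν : ProbabilityMeasure H) : lpDist μ ν ≤ 1 := by
  refine ENNReal.toReal_le_of_le_ofReal zero_le_one ?_
  simpa using levyProkhorovEDist_le_max_measure_univ (μ : Measure H) (ν : Measure H)

lemma tendsto_lpDist_iff [SecondCountableTopology H] {ι : Type*} {l : Filter ι}
    {u : ι → ProbabilityMeasure H} {ν : ProbabilityMeasure H} :
    Tendsto (fun j => lpDist (u j) ν) l (𝓝 0) ↔ Tendsto u l (𝓝 ν) := by
  have h := (LevyProkhorov.probabilityMeasureHomeomorph (Ω := H)).isInducing.tendsto_nhds_iff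
    (f := u) (l := l) (y := ν)
  rw [tendsto_iff_dist_tendsto_zero] at h
  exact h.symm

/-- Variables that are close in mean square have close laws. -/
lemma levyProkhorovDist_map_le {α : Type*} [MeasurableSpace α] {μ : Measure α}
    [IsProbabilityMeasure μ] [SecondCountableTopology H] {X X' : α → H} (hX : Measurable X)
    (hX' : Measurable X') (hd : MemLp (fun a => X a - X' a) 2 μ) {ε : ℝ} (hε : 0 < ε)
    (h : ∫ a, ‖X a - X' a‖ ^ 2 ∂μ ≤ ε ^ 3) :
    levyProkhorovDist (μ.map X) (μ.map X') ≤ ε := by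
  have := Measure.isProbabilityMeasure_map (μ := μ) hX.aemeasurable
  have := Measure.isProbabilityMeasure_map (μ := μ) hX'.aemeasurable
  refine levyProkhorovDist_le_of_forall_le _ _ hε.le fun r B hr hB => ?_
  have hr0 : 0 < r := hε.trans hr
  rw [Measure.map_apply hX hB, Measure.map_apply hX' Metric.isOpen_thickening.measurableSet]
  -- Either the two variables are closer than `r`, or an exceptional event occurs, whose probability
  -- is at most `ε³ / r² ≤ r` by Chebyshev.
  have hsub : X ⁻¹' B ⊆ X' ⁻¹' Metric.thickening r B ∪ {a | r ^ 2 ≤ ‖X a - X' a‖ ^ 2} := by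
    intro a ha
    by_cases hr2 : r ^ 2 ≤ ‖X a - X' a‖ ^ 2
    · exact Or.inr hr2
    · refine Or.inl (Metric.mem_thickening_iff.2 ⟨X a, ha, ?_⟩)
      rw [dist_comm, dist_eq_norm]
      exact lt_of_pow_lt_pow_left₀ 2 hr0.le (not_le.1 hr2)
  refine (measure_mono hsub).trans ((measure_union_le _ _).trans (add_le_add le_rfl ?_))
  have hi : Integrable (fun a => ‖X a - X' a‖ ^ 2) μ := (memLp_two_iff_integrable_sq_norm hd.1).1 hd
  have hm := mul_meas_ge_le_integral_of_nonneg (ae_of_all _ fun a => by positivity) hi (r ^ 2)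
  have h1 : μ.real {a | r ^ 2 ≤ ‖X a - X' a‖ ^ 2} ≤ r := by
    have h2 : ε ^ 3 ≤ r ^ 2 * r := by
      have : ε ^ 3 ≤ r ^ 3 := by gcongr
      linarith [pow_succ r 2]
    exact le_of_mul_le_mul_left (hm.trans (h.trans h2)) (by positivity)
  rw [← ofReal_measureReal]
  exact ENNReal.ofReal_le_ofReal h1

end LevyProkhorov

/-! ### Tightness -/

/-- A set of measures is tight if it is almost carried by small neighbourhoods of compact sets. -/
lemma isTightMeasureSet_of_cthickening {E : Type*} [PseudoMetricSpace E] [CompleteSpace E]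
    [MeasurableSpace E] [BorelSpace E] {S : Set (Measure E)}
    (h : ∀ ε : ℝ≥0∞, 0 < ε → ∀ r : ℝ, 0 < r →
      ∃ K : Set E, IsCompact K ∧ ∀ μ ∈ S, μ (Metric.cthickening r K)ᶜ ≤ ε) :
    IsTightMeasureSet S := by
  rw [isTightMeasureSet_iff_exists_isCompact_measure_compl_le]
  intro ε hε
  obtain ⟨ε', hε'0, hε'⟩ := ENNReal.exists_pos_sum_of_countable' hε.ne' ℕ
  have hr : ∀ p : ℕ, (0 : ℝ) < 1 / (p + 1) := fun p => Nat.one_div_pos_of_nat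
  choose K hK hKS using fun p : ℕ => h (ε' p) (hε'0 p) (1 / (p + 1)) (hr p)
  -- Closed, hence complete. A finite `r / 2`-net of `K p` is an `r`-net of `T` as soon as `1 / (p +
  -- 1) < r / 2`. The lost masses add up to at most `ε`.
  set T : Set E := ⋂ p : ℕ, Metric.cthickening (1 / (p + 1 : ℝ)) (K p) with hT
  have hclosed : IsClosed T := isClosed_iInter fun p => Metric.isClosed_cthickening
  refine ⟨T, isCompact_iff_totallyBounded_isComplete.2 ⟨?_, hclosed.isComplete⟩, fun μ hμ => ?_⟩
  · rw [Metric.totallyBounded_iff]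
    intro r hr0
    obtain ⟨p, hp⟩ := exists_nat_one_div_lt (show 0 < r / 2 by positivity)
    obtain ⟨t, ht, htK⟩ := Metric.totallyBounded_iff.1 (hK p).totallyBounded (r / 2) (by positivity)
    refine ⟨t, ht, fun z hz => ?_⟩
    have hz' := Set.mem_iInter.1 hz p
    rw [(hK p).cthickening_eq_biUnion_closedBall (hr p).le] at hz'
    obtain ⟨y, hy, hzy⟩ := Set.mem_iUnion₂.1 hz'
    obtain ⟨u, hu, hyu⟩ := Set.mem_iUnion₂.1 (htK hy)
    refine Set.mem_iUnion₂.2 ⟨u, hu, ?_⟩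
    rw [Metric.mem_ball] at hyu ⊢
    rw [Metric.mem_closedBall] at hzy
    linarith [dist_triangle z y u]
  · rw [hT, Set.compl_iInter]
    refine (measure_iUnion_le _).trans ((ENNReal.tsum_le_tsum fun p => hKS p μ hμ).trans hε'.le)

/-! ### Gaussian limits of finite rank -/

section FiniteRank

variable {H : Type*} [NormedAddCommGroup H] [InnerProductSpace ℝ H] [MeasurableSpace H]
  [BorelSpace H] {κ : Type*} [Fintype κ]

lemma continuous_sum_smul (x : κ → H) : Continuous fun v : EuclideanSpace ℝ κ => ∑ q, v q • x q := by
  fun_prop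

/-- The centered Gaussian law with covariance matrix `Γ`. -/
noncomputable def gaussianVector [DecidableEq κ] (Γ : Matrix κ κ ℝ) :
    ProbabilityMeasure (EuclideanSpace ℝ κ) :=
  ⟨multivariateGaussian 0 Γ, inferInstance⟩

lemma coe_gaussianVector [DecidableEq κ] (Γ : Matrix κ κ ℝ) :
    (gaussianVector Γ : Measure (EuclideanSpace ℝ κ)) = multivariateGaussian 0 Γ := rfl

/-- The law of `∑ q, Z q • x q` for a centered Gaussian vector `Z` with covariance matrix `Γ`. -/
noncomputable def gaussianLaw [DecidableEq κ] (Γ : Matrix κ κ ℝ) (x : κ → H) :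
    ProbabilityMeasure H :=
  (gaussianVector Γ).map (f := fun v => ∑ q, v q • x q) (continuous_sum_smul x).measurable.aemeasurable

variable [SecondCountableTopology H]

lemma measurable_sum_smul {α : Type*} [MeasurableSpace α] {T : κ → α → ℝ}
    (hT : ∀ q, Measurable (T q)) (x : κ → H) : Measurable fun a => ∑ q, T q a • x q :=
  Finset.measurable_sum _ fun q _ => (hT q).smul_const _

/-- Cramér–Wold device and Lévy's continuity theorem for variables of finite rank. -/
theorem tendsto_map_gaussianLaw [DecidableEq κ] {α : ℕ → Type*} [∀ j, MeasurableSpace (α j)]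
    (μ : ∀ j, ProbabilityMeasure (α j)) {T : ∀ j, κ → α j → ℝ} (hT : ∀ j q, Measurable (T j q))
    (x : κ → H) {Γ : Matrix κ κ ℝ} (hΓ : Γ.PosSemidef)
    (h : ∀ c : κ → ℝ, Tendsto (fun j => ∫ a, Complex.exp ((∑ q, c q * T j q a : ℝ) * Complex.I)
      ∂(μ j : Measure (α j))) atTop
      (𝓝 (Real.exp (-((∑ q, ∑ q', c q * c q' * Γ q q') / 2)) : ℂ))) :
    Tendsto (fun j => (μ j).map (f := fun a => ∑ q, T j q a • x q)
      (measurable_sum_smul (hT j) x).aemeasurable) atTop (𝓝 (gaussianLaw Γ x)) := by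
  have hV : ∀ j, Measurable fun a => WithLp.toLp 2 (fun q => T j q a) := fun j =>
    (WithLp.measurable_toLp 2 _).comp (measurable_pi_lambda _ (hT j))
  -- Convergence is first shown for the coordinate vectors in Euclidean space, where characteristic
  -- functions decide, and then pushed to `H` by the continuous linear map.
  have h1 : Tendsto (fun j => (μ j).map (f := fun a => WithLp.toLp 2 (fun q => T j q a))
      (hV j).aemeasurable) atTop
      (𝓝 (gaussianVector Γ)) := by
    refine ProbabilityMeasure.tendsto_of_tendsto_charFun fun c => ?_
    have e1 : charFun (gaussianVector Γ : Measure (EuclideanSpace ℝ κ)) c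
        = (Real.exp (-((∑ q, ∑ q', c q * c q' * Γ q q') / 2)) : ℂ) := by
      rw [coe_gaussianVector, charFun_multivariateGaussian hΓ]
      simp only [inner_zero_right, Complex.ofReal_zero, zero_mul, zero_sub, dotProduct,
        Matrix.mulVec, Finset.mul_sum]
      push_cast
      congr 3
      refine Finset.sum_congr rfl fun q _ => Finset.sum_congr rfl fun q' _ => by ring
    rw [e1]
    refine (h c).congr fun j => ?_
    rw [charFun_apply, ProbabilityMeasure.toMeasure_map, integral_map (hV j).aemeasurable
      (by fun_prop)]
    congr 1 with a
  have h2 := ProbabilityMeasure.tendsto_map_of_tendsto_of_continuous _ _ h1 (continuous_sum_smul x)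
  refine h2.congr fun j => ?_
  refine ProbabilityMeasure.toMeasure_injective ?_
  simp only [ProbabilityMeasure.toMeasure_map]
  rw [Measure.map_map (continuous_sum_smul x).measurable (hV j)]
  rfl

end FiniteRank

/-! ### Consistency of the bootstrap law -/

section BootstrapLaw

variable {Ω S H : Type*} [MeasurableSpace Ω] [MeasurableSpace S] {P : Measure Ω}
  [IsProbabilityMeasure P] [NormedAddCommGroup H] [InnerProductSpace ℝ H] [CompleteSpace H]
  [SecondCountableTopology H] [MeasurableSpace H] [BorelSpace H]
  {δ : ℤ → Ω → S} {m : ℕ} {κ : Type*} [Fintype κ]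
  {ψ : κ → (Fin m → S) → ℝ} {K : ℝ}

open SumBound

/-- The matrix of long run covariances. -/
noncomputable def longRunMatrix (P : Measure Ω) (δ : ℤ → Ω → S) (ψ : κ → (Fin m → S) → ℝ) :
    Matrix κ κ ℝ := Matrix.of fun q q' => longRunCov P δ (ψ q) (ψ q')

lemma posSemidef_longRunMatrix (h : IsIID P δ) (hψ : ∀ q, CenteredFunctional P δ (ψ q) K) :
    (longRunMatrix P δ ψ).PosSemidef := by
  refine Matrix.PosSemidef.of_dotProduct_mulVec_nonneg ?_ fun c => ?_
  · ext q q'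
    simp only [longRunMatrix, Matrix.conjTranspose_apply, Matrix.of_apply, star_trivial]
    exact (hψ q').longRunCov_comm (hψ q) h
  · have h1 := CenteredFunctional.longRunVar_linComb hψ h c
    have h2 := (CenteredFunctional.linComb hψ h c).longRunVar_nonneg h
    rw [h1] at h2
    refine h2.trans (le_of_eq ?_)
    simp only [dotProduct, Matrix.mulVec, star_trivial, Finset.mul_sum, longRunMatrix,
      Matrix.of_apply]
    refine Finset.sum_congr rfl fun q _ => Finset.sum_congr rfl fun q' _ => by ring

lemma coe_meanLaw {Y : ℤ → Ω → H} (hY : ∀ t, Measurable (Y t)) (n : ℕ) :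
    (meanLaw P Y hY n : Measure H) = P.map fun ω => √(n : ℝ) • sampleMean n (obs Y ω) := rfl

/-- Central limit theorem for processes of finite range and finite rank. -/
theorem tendsto_meanLaw_combine [DecidableEq κ] (h : IsIID P δ)
    (hψ : ∀ q, CenteredFunctional P δ (ψ q) K) (x : κ → H)
    (hV : ∀ t, Measurable (combine δ ψ x t)) {k b : ℕ → ℕ} (hkb : BlockRegime k b) :
    Tendsto (fun j => meanLaw P (combine δ ψ x) hV (k j * b j)) atTop
      (𝓝 (gaussianLaw (longRunMatrix P δ ψ) x)) := by
  have h1 := tendsto_map_gaussianLaw (α := fun _ => Ω)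
    (fun _ => (⟨P, inferInstance⟩ : ProbabilityMeasure Ω))
    (T := fun j q ω => √((k j * b j : ℕ) : ℝ) * sampleMean (k j * b j) (scalarObs δ (ψ q) ω))
    (fun j q => ((hψ q).measurable_sampleMean h _).const_mul _) x
    (posSemidef_longRunMatrix h hψ) (fun c => by
      have h2 := (CenteredFunctional.linComb hψ h c).tendsto_integral_exp_scaledMean h hkb
      rw [CenteredFunctional.longRunVar_linComb hψ h c] at h2
      simp_rw [CenteredFunctional.scaledMean_linComb] at h2
      exact h2)
  refine h1.congr fun j => ProbabilityMeasure.toMeasure_injective ?_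
  rw [coe_meanLaw]
  change P.map (fun ω => ∑ q, (√((k j * b j : ℕ) : ℝ) * sampleMean (k j * b j)
    (scalarObs δ (ψ q) ω)) • x q) = _
  refine congrArg (fun g : Ω → H => P.map g) (funext fun ω => ?_)
  rw [obs_combine, CenteredFunctional.sampleMean_sum_smul, Finset.smul_sum]
  simp_rw [smul_smul]

/-- If the bootstrap covariances converge, then so do the bootstrap laws. -/
theorem tendsto_bootLaw_combine [DecidableEq κ] (h : IsIID P δ)
    (hψ : ∀ q, CenteredFunctional P δ (ψ q) K) (x : κ → H) (w : ℝ → ℝ) {k b : ℕ → ℕ}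
    (hkb : BlockRegime k b) (ω : ℕ → Ω)
    (hβ : ∀ q q', Tendsto (fun j => bootProd w (k j) (b j) (scalarObs δ (ψ q) (ω j))
      (scalarObs δ (ψ q') (ω j))) atTop (𝓝 (longRunCov P δ (ψ q) (ψ q')))) :
    Tendsto (fun j => bootLaw w (k j) (b j) (obs (combine δ ψ x) (ω j))) atTop
      (𝓝 (gaussianLaw (longRunMatrix P δ ψ) x)) := by
  have h1 := tendsto_map_gaussianLaw (α := fun j => Draw (k j) (b j))
    (fun j => drawLaw (k j) (b j))
    (T := fun j q I => √((k j * b j : ℕ) : ℝ) •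
      bootDev w (k j) (b j) (scalarObs δ (ψ q) (ω j)) I)
    (fun j q => Measurable.of_discrete) x (posSemidef_longRunMatrix h hψ) (fun c => by
      set φ : (Fin m → S) → ℝ := fun u => ∑ q, c q * ψ q u with hφ
      have hφc := CenteredFunctional.linComb hψ h c
      set L := ∑ q, |c q| * K with hL
      set σ := ∑ q, ∑ q', c q * c q' * longRunCov P δ (ψ q) (ψ q') with hσ
      have hσ0 : 0 ≤ σ := by
        have := hφc.longRunVar_nonneg h
        rwa [CenteredFunctional.longRunVar_linComb hψ h c] at this
      have hvar : Tendsto (fun j => bootVar w (k j) (b j) (scalarObs δ φ (ω j))) atTop (𝓝 σ) := by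
        have h2 : Tendsto (fun j => ∑ q, ∑ q', c q * c q' * bootProd w (k j) (b j)
            (scalarObs δ (ψ q) (ω j)) (scalarObs δ (ψ q') (ω j))) atTop (𝓝 σ) :=
          tendsto_finsetSum _ fun q _ => tendsto_finsetSum _ fun q' _ => (hβ q q').const_mul _
        refine h2.congr fun j => ?_
        rw [← bootVar_linComb w _ (hkb.one_le_b j)]
        rfl
      have hr : Tendsto (fun j => 2 * (L * √(b j : ℝ)) / √(k j)) atTop (𝓝 0) := by
        have := hkb.tendsto_ratio.const_mul (2 * L)
        rw [mul_zero] at this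
        refine this.congr fun j => by ring
      have herr := ((hr.mul hvar).add (hvar.sub_const σ).abs).add
        (hkb.tendsto_inv_k.const_mul (σ ^ 2))
      simp only [zero_mul, sub_self, abs_zero, mul_zero, add_zero] at herr
      have hmain : Tendsto (fun j => ∫ I, Complex.exp ((√((k j * b j : ℕ) : ℝ) •
          bootDev w (k j) (b j) (scalarObs δ φ (ω j)) I : ℝ) * Complex.I)
          ∂(drawLaw (k j) (b j) : Measure (Draw (k j) (b j)))) atTop
          (𝓝 (Real.exp (-(σ / 2)) : ℂ)) := by
        rw [tendsto_iff_norm_sub_tendsto_zero]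
        refine squeeze_zero' (Eventually.of_forall fun j => norm_nonneg _) ?_ herr
        filter_upwards [hr.eventually_le_const zero_lt_one,
          (hkb.tendsto_inv_k.const_mul σ).eventually_le_const (u := 2) (by simp)] with j hj1 hj2
        have hk0 : (0 : ℝ) < k j := by exact_mod_cast hkb.one_le_k j
        refine norm_integral_exp_scaled_bootDev_sub_le w (hkb.one_le_k j) (hkb.one_le_b j)
          (fun i => hφc.abs_blockSum_le w (b j) i (ω j)) ?_ hσ0 ?_
        · exact (div_le_one (Real.sqrt_pos.2 hk0)).1 hj1
        · rwa [← div_eq_mul_inv, div_le_iff₀ hk0] at hj2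
      refine hmain.congr fun j => ?_
      congr 1 with I
      rw [← scaled_bootDev_linComb w _ (hkb.one_le_b j)]
      rfl)
  refine h1.congr fun j => ProbabilityMeasure.toMeasure_injective ?_
  simp only [bootLaw, ProbabilityMeasure.toMeasure_map]
  congr 1
  ext I
  rw [obs_combine, scaled_bootDev_sum_smul w _ (hkb.one_le_b j) (fun q => scalarObs δ (ψ q) (ω j)) x]

/-- The total deviation of the bootstrap covariances from the long run covariances. -/
noncomputable def covError (P : Measure Ω) (δ : ℤ → Ω → S) (ψ : κ → (Fin m → S) → ℝ) (w : ℝ → ℝ)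
    (k b : ℕ) (ω : Ω) : ℝ :=
  ∑ q, ∑ q', |bootProd w k b (scalarObs δ (ψ q) ω) (scalarObs δ (ψ q') ω)
    - longRunCov P δ (ψ q) (ψ q')|

lemma covError_nonneg (w : ℝ → ℝ) (k b : ℕ) (ω : Ω) : 0 ≤ covError P δ ψ w k b ω :=
  Finset.sum_nonneg fun _ _ => Finset.sum_nonneg fun _ _ => abs_nonneg _

lemma integrable_covError (h : IsIID P δ) (hψ : ∀ q, CenteredFunctional P δ (ψ q) K)
    {w : ℝ → ℝ} (hw : IsTaper w) {k b : ℕ → ℕ} (hkb : BlockRegime k b) (j : ℕ) :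
    Integrable (covError P δ ψ w (k j) (b j)) P :=
  integrable_finsetSum _ fun q _ => integrable_finsetSum _ fun q' _ =>
    ((((hψ q).tendsto_integral_abs_bootProd_sub (hψ q') h hw hkb).1 j).sub
      (integrable_const _)).abs

lemma tendsto_integral_covError (h : IsIID P δ) (hψ : ∀ q, CenteredFunctional P δ (ψ q) K)
    {w : ℝ → ℝ} (hw : IsTaper w) {k b : ℕ → ℕ} (hkb : BlockRegime k b) :
    Tendsto (fun j => ∫ ω, covError P δ ψ w (k j) (b j) ω ∂P) atTop (𝓝 0) := by
  have hi : ∀ j q q', Integrable (fun ω => |bootProd w (k j) (b j) (scalarObs δ (ψ q) ω)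
      (scalarObs δ (ψ q') ω) - longRunCov P δ (ψ q) (ψ q')|) P := fun j q q' =>
    ((((hψ q).tendsto_integral_abs_bootProd_sub (hψ q') h hw hkb).1 j).sub
      (integrable_const _)).abs
  have h1 : Tendsto (fun j => ∑ q, ∑ q', ∫ ω, |bootProd w (k j) (b j) (scalarObs δ (ψ q) ω)
      (scalarObs δ (ψ q') ω) - longRunCov P δ (ψ q) (ψ q')| ∂P) atTop
      (𝓝 (∑ _q : κ, ∑ _q' : κ, 0)) :=
    tendsto_finsetSum _ fun q _ => tendsto_finsetSum _ fun q' _ =>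
      ((hψ q).tendsto_integral_abs_bootProd_sub (hψ q') h hw hkb).2
  simp only [Finset.sum_const_zero] at h1
  refine h1.congr fun j => ?_
  simp only [covError]
  rw [integral_finsetSum _ fun q _ => integrable_finsetSum _ fun q' _ => hi j q q']
  refine Finset.sum_congr rfl fun q _ => ?_
  rw [integral_finsetSum _ fun q' _ => hi j q q']

/-- The bootstrap law is close to the Gaussian limit as soon as the bootstrap covariances are close
to the long run covariances. -/
lemma exists_lpDist_bootLaw_combine_le [DecidableEq κ] (h : IsIID P δ)
    (hψ : ∀ q, CenteredFunctional P δ (ψ q) K) (x : κ → H) (w : ℝ → ℝ) {k b : ℕ → ℕ}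
    (hkb : BlockRegime k b) {ε : ℝ} (hε : 0 < ε) :
    ∃ τ : ℝ, 0 < τ ∧ ∀ᶠ j in atTop, ∀ ω, covError P δ ψ w (k j) (b j) ω ≤ τ →
      lpDist (bootLaw w (k j) (b j) (obs (combine δ ψ x) ω))
        (gaussianLaw (longRunMatrix P δ ψ) x) ≤ ε := by
  -- Otherwise there are indices tending to infinity and sample points whose covariance errors tend
  -- to zero while the distance stays above `ε`. This contradicts `tendsto_bootLaw_combine`, which
  -- allows the sample point to vary with the index.
  by_contra! hcon
  have hp : ∀ p : ℕ, ∃ j, p ≤ j ∧ ∃ ω, covError P δ ψ w (k j) (b j) ω ≤ 1 / ((p : ℝ) + 1) ∧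
      ε < lpDist (bootLaw w (k j) (b j) (obs (combine δ ψ x) ω))
        (gaussianLaw (longRunMatrix P δ ψ) x) := fun p => by
    obtain ⟨j, hj, hω⟩ := (frequently_atTop.1 (hcon (1 / ((p : ℝ) + 1)) Nat.one_div_pos_of_nat)) p
    exact ⟨j, hj, hω⟩
  choose φ hφ ω hω1 hω2 using hp
  have hφt : Tendsto φ atTop atTop := tendsto_atTop_mono hφ tendsto_id
  have hlim : Tendsto (fun p => covError P δ ψ w (k (φ p)) (b (φ p)) (ω p)) atTop (𝓝 0) :=
    squeeze_zero (fun p => covError_nonneg _ _ _ _) hω1 tendsto_one_div_add_atTop_nhds_zero_nat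
  have h1 := tendsto_bootLaw_combine h hψ x w (hkb.comp hφt) ω (fun q q' => by
    rw [tendsto_iff_norm_sub_tendsto_zero]
    refine squeeze_zero (fun p => norm_nonneg _) (fun p => ?_) hlim
    rw [covError]
    refine le_trans ?_ (Finset.single_le_sum (f := fun q => ∑ q', |bootProd w (k (φ p)) (b (φ p))
      (scalarObs δ (ψ q) (ω p)) (scalarObs δ (ψ q') (ω p)) - longRunCov P δ (ψ q) (ψ q')|)
      (fun q _ => Finset.sum_nonneg fun _ _ => abs_nonneg _) (Finset.mem_univ q))
    exact Finset.single_le_sum (f := fun q' => |bootProd w (k (φ p)) (b (φ p))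
      (scalarObs δ (ψ q) (ω p)) (scalarObs δ (ψ q') (ω p)) - longRunCov P δ (ψ q) (ψ q')|)
      (fun q _ => abs_nonneg _) (Finset.mem_univ q'))
  have h2 := tendsto_lpDist_iff.2 h1
  obtain ⟨p, hp⟩ := (h2.eventually_lt_const hε).exists
  exact absurd hp (not_lt.2 (hω2 p).le)

variable {f : (ℕ → S) → H} {Y : ℤ → Ω → H}

lemma lpDist_bootLaw_le (w : ℝ → ℝ) (k : ℕ) {b : ℕ} (hb : 1 ≤ b) (y z : ℕ → H) {ε : ℝ} (hε : 0 < ε)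
    (h : bootSq w k b (fun t => y t - z t) ≤ ε ^ 3) :
    lpDist (bootLaw w k b y) (bootLaw w k b z) ≤ ε := by
  refine levyProkhorovDist_map_le Measurable.of_discrete Measurable.of_discrete MemLp.of_discrete hε
    ?_
  simp_rw [scaled_bootDev_sub w k hb]
  exact h

lemma scaledMean_sub (n : ℕ) (Y V : ℤ → Ω → H) (ω : Ω) :
    √(n : ℝ) • sampleMean n (obs Y ω) - √(n : ℝ) • sampleMean n (obs V ω)
      = √(n : ℝ) • sampleMean n (obs (fun t ω => Y t ω - V t ω) ω) := by
  rw [← smul_sub, ← CenteredFunctional.sampleMean_sub]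
  rfl

lemma lpDist_meanLaw_le {V : ℤ → Ω → H} (hY : ∀ t, Measurable (Y t)) (hV : ∀ t, Measurable (V t))
    {η ε : ℝ} (hD : SumBound P (fun t ω => Y t ω - V t ω) η) (hε : 0 < ε) (hη : η ≤ ε ^ 3) (n : ℕ) :
    lpDist (meanLaw P Y hY n) (meanLaw P V hV n) ≤ ε := by
  refine levyProkhorovDist_map_le (μ := P) (measurable_scaledMean hY n) (measurable_scaledMean hV n) ?_ hε ?_
  · simp_rw [scaledMean_sub]
    exact hD.memLp_sampleMean n
  · simp_rw [scaledMean_sub]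
    exact (hD.integral_scaledMean_le n).trans hη

lemma measurable_combine (h : IsIID P δ) (hψ : ∀ q, CenteredFunctional P δ (ψ q) K) (x : κ → H)
    (t : ℤ) : Measurable (combine δ ψ x t) :=
  Finset.measurable_sum _ fun q _ => ((hψ q).measurable_comp h t).smul_const _

/-- The bootstrap law is consistent in the Lévy–Prokhorov distance. -/
theorem StronglyApproximable.tendsto_measure_lpDist (hdep : StronglyApproximable P Y f δ)
    (hmean : ∀ t, ∫ ω, Y t ω ∂P = 0) (hY : ∀ t, Measurable (Y t)) {w : ℝ → ℝ}
    (hw : IsTaper w) {k b : ℕ → ℕ} (hkb : BlockRegime k b) :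
    TendstoInMeasure P (fun j ω => lpDist (bootLaw w (k j) (b j) (obs Y ω))
      (meanLaw P Y hY (k j * b j))) atTop (fun _ => 0) := by
  classical
  intro ε hε
  simp only [edist_dist, Real.dist_eq, sub_zero, abs_of_nonneg (lpDist_nonneg _ _)]
  refine tendsto_measure_le_of_dominated (fun τ hτ => ?_) hε
  have h := hdep.isIID
  -- Four legs of the triangle inequality cost `4 * r = τ / 2`; the expected exceptional terms cost
  -- `τ / 4` each.
  set r := τ / 8 with hr
  have hr0 : 0 < r := by positivity
  -- The first entry makes the laws of the two means `r`-close, the second makes the expectation of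
  -- `bootSq / r ^ 3` at most `τ / 4`.
  set η := min (r ^ 3) (r ^ 3 * (τ / 4)) with hη
  have hη0 : 0 < η := by positivity
  obtain ⟨m, Q, ψ, hψ, hD⟩ := hdep.exists_sumBound_sub hmean hη0
  set x : Q → H := fun q => (q : H) with hx
  set V := combine δ ψ x with hV
  have hVm : ∀ t, Measurable (V t) := measurable_combine h hψ x
  set γ := gaussianLaw (longRunMatrix P δ ψ) x with hγ
  obtain ⟨s, hs0, hs⟩ := exists_lpDist_bootLaw_combine_le h hψ x w hkb hr0
  set D : ℤ → Ω → H := fun t ω => Y t ω - V t ω with hDdef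
  -- If `bootSq` exceeds `r ^ 3` or the covariance error exceeds `s`, the corresponding quotient is
  -- at least one and dominates the Lévy–Prokhorov distance, which never exceeds one.
  set A : ℕ → Ω → ℝ := fun j ω => 4 * r + bootSq w (k j) (b j) (obs D ω) / r ^ 3
    + covError P δ ψ w (k j) (b j) ω / s with hA
  have hDi : ∀ j, Integrable (fun ω => bootSq w (k j) (b j) (obs D ω) / r ^ 3) P := fun j =>
    (hD.integrable_bootSq w (hkb.one_le_k j) (hkb.one_le_b j)).div_const _
  have hEi : ∀ j, Integrable (fun ω => covError P δ ψ w (k j) (b j) ω / s) P := fun j =>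
    (integrable_covError h hψ hw hkb j).div_const _
  have hA1 : ∀ j, Integrable (fun ω => 4 * r + bootSq w (k j) (b j) (obs D ω) / r ^ 3) P :=
    fun j => (integrable_const _).add (hDi j)
  have hD0 : ∀ j ω, 0 ≤ bootSq w (k j) (b j) (obs D ω) / r ^ 3 := fun j ω =>
    div_nonneg (bootSq_nonneg _ _ _ _) (by positivity)
  have hE0 : ∀ j ω, 0 ≤ covError P δ ψ w (k j) (b j) ω / s := fun j ω =>
    div_nonneg (covError_nonneg _ _ _ _) hs0.le
  refine ⟨A, fun j => (hA1 j).add (hEi j), fun j ω =>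
    add_nonneg (add_nonneg (by positivity) (hD0 j ω)) (hE0 j ω), ?_⟩
  have hmean_lim := tendsto_lpDist_iff.2 (tendsto_meanLaw_combine h hψ x hVm hkb)
  have hElim := (tendsto_integral_covError h hψ hw hkb).div_const s
  rw [zero_div] at hElim
  filter_upwards [hs, hmean_lim.eventually_le_const hr0,
    hElim.eventually_le_const (show 0 < τ / 4 by positivity)] with j hj1 hj2 hj3
  refine ⟨fun ω => ENNReal.ofReal_le_ofReal ?_, ?_⟩
  · by_cases hc1 : bootSq w (k j) (b j) (obs D ω) ≤ r ^ 3
    · by_cases hc2 : covError P δ ψ w (k j) (b j) ω ≤ s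
      · have d1 : lpDist (bootLaw w (k j) (b j) (obs Y ω)) (bootLaw w (k j) (b j) (obs V ω)) ≤ r :=
          lpDist_bootLaw_le w _ (hkb.one_le_b j) _ _ hr0 hc1
        have d2 := hj1 ω hc2
        have d3 : lpDist γ (meanLaw P V hVm (k j * b j)) ≤ r := by rw [lpDist_comm]; exact hj2
        have d4 : lpDist (meanLaw P V hVm (k j * b j)) (meanLaw P Y hY (k j * b j)) ≤ r := by
          rw [lpDist_comm]
          exact lpDist_meanLaw_le hY hVm hD hr0 (min_le_left _ _) _
        have t1 := lpDist_triangle (bootLaw w (k j) (b j) (obs Y ω))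
          (bootLaw w (k j) (b j) (obs V ω)) (meanLaw P Y hY (k j * b j))
        have t2 := lpDist_triangle (bootLaw w (k j) (b j) (obs V ω)) γ
          (meanLaw P Y hY (k j * b j))
        have t3 := lpDist_triangle γ (meanLaw P V hVm (k j * b j)) (meanLaw P Y hY (k j * b j))
        have := hD0 j ω
        have := hE0 j ω
        simp only [hA]
        linarith
      · have h1 : 1 ≤ covError P δ ψ w (k j) (b j) ω / s := by
          rw [le_div_iff₀ hs0]; linarith
        have := hD0 j ω
        have := lpDist_le_one (bootLaw w (k j) (b j) (obs Y ω)) (meanLaw P Y hY (k j * b j))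
        simp only [hA]
        linarith
    · have h1 : 1 ≤ bootSq w (k j) (b j) (obs D ω) / r ^ 3 := by
        rw [le_div_iff₀ (by positivity)]; linarith
      have := hE0 j ω
      have := lpDist_le_one (bootLaw w (k j) (b j) (obs Y ω)) (meanLaw P Y hY (k j * b j))
      simp only [hA]
      linarith
  · simp only [hA]
    rw [integral_add (hA1 j) (hEi j), integral_add (integrable_const _) (hDi j), integral_div,
      integral_div, integral_const]
    have e1 := hD.integral_bootSq_le w (hkb.one_le_k j) (hkb.one_le_b j)
    have e2 : (∫ ω, bootSq w (k j) (b j) (obs D ω) ∂P) / r ^ 3 ≤ τ / 4 := by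
      rw [div_le_iff₀ (by positivity)]
      refine e1.trans ((min_le_right _ _).trans (le_of_eq ?_))
      ring
    simp only [probReal_univ, one_smul]
    linarith

/-- The laws of the scaled means form a tight set. -/
theorem StronglyApproximable.isTightMeasureSet_meanLaw (hdep : StronglyApproximable P Y f δ)
    (hmean : ∀ t, ∫ ω, Y t ω ∂P = 0) (hY : ∀ t, Measurable (Y t)) :
    IsTightMeasureSet (Set.range fun n => (meanLaw P Y hY n : Measure H)) := by
  refine isTightMeasureSet_of_cthickening fun ε hε r hr => ?_
  obtain ⟨s, hs0, hsε⟩ : ∃ s : ℝ, 0 < s ∧ ENNReal.ofReal s ≤ ε := by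
    rcases eq_or_ne ε ⊤ with rfl | hε'
    · exact ⟨1, one_pos, le_top⟩
    · exact ⟨ε.toReal, ENNReal.toReal_pos hε.ne' hε', (ENNReal.ofReal_toReal hε').le⟩
  have h := hdep.isIID
  set η := r ^ 2 * (s / 2) with hη
  obtain ⟨m, Q, ψ, hψ, hD⟩ := hdep.exists_sumBound_sub hmean (show 0 < η by positivity)
  set x : Q → H := fun q => (q : H) with hx
  set V := combine δ ψ x with hV
  set C : ℝ := Fintype.card Q * (2 * (m * 1 ^ 2)) with hC
  have hC0 : 0 ≤ C := by positivity
  obtain ⟨R, hR0, hR⟩ : ∃ R : ℝ, 0 < R ∧ C / R ^ 2 ≤ s / 2 := by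
    refine ⟨√(2 * (C + 1) / s), Real.sqrt_pos.2 (by positivity), ?_⟩
    rw [Real.sq_sqrt (by positivity), div_div_eq_mul_div, div_le_iff₀ (by positivity)]
    nlinarith
  have hξ : ∀ q, SumBound P (fun t ω => ψ q (recent δ m t ω)) (2 * (m * 1 ^ 2)) := fun q =>
    ⟨fun t => (hψ q).memLp h t 2, fun F a => by simpa using (hψ q).integral_sum_sq_le h F a⟩
  -- The finite rank approximation takes values in the range of this map, so the image of a large
  -- ball is a compact set near which the scaled mean concentrates.
  set L : (Q → ℝ) → H := fun v => ∑ q, v q • x q with hL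
  have hLc : Continuous L := by fun_prop
  refine ⟨L '' Metric.closedBall 0 R, (isCompact_closedBall 0 R).image hLc, ?_⟩
  rintro _ ⟨n, rfl⟩
  set X : Ω → H := fun ω => √(n : ℝ) • sampleMean n (obs Y ω) with hX
  set T : Q → Ω → ℝ := fun q ω => √(n : ℝ) • sampleMean n (scalarObs δ (ψ q) ω) with hT
  have hXm : Measurable X := measurable_scaledMean hY n
  have hVL : ∀ ω, √(n : ℝ) • sampleMean n (obs V ω) = L fun q => T q ω := fun ω => by
    rw [hV, obs_combine, CenteredFunctional.sampleMean_sum_smul, Finset.smul_sum]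
    simp_rw [smul_smul]
    rfl
  -- `A < 1` forces both an approximation error at most `r` and coordinates at most `R`; Markov's
  -- inequality then bounds the escaping mass by `s`, half from each term.
  set A : Ω → ℝ := fun ω => ‖X ω - L fun q => T q ω‖ ^ 2 / r ^ 2 + (∑ q, T q ω ^ 2) / R ^ 2 with hA
  have hA0 : ∀ ω, 0 ≤ A ω := fun ω => by positivity
  have hTi : ∀ q, Integrable (fun ω => T q ω ^ 2) P := fun q => by
    have := integrable_norm_sq ((hξ q).memLp_sampleMean n)
    simp only [Real.norm_eq_abs, sq_abs] at this
    exact this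
  have hT2 : ∀ q, ∫ ω, T q ω ^ 2 ∂P ≤ 2 * (m * 1 ^ 2) := fun q => by
    have := (hξ q).integral_scaledMean_le n
    simp only [Real.norm_eq_abs, sq_abs] at this
    exact this
  have hDX : ∀ ω, X ω - L (fun q => T q ω)
      = √(n : ℝ) • sampleMean n (obs (fun t ω => Y t ω - V t ω) ω) := fun ω => by
    rw [← hVL, ← scaledMean_sub]
  have hDi : Integrable (fun ω => ‖X ω - L fun q => T q ω‖ ^ 2) P := by
    simp_rw [hDX]
    exact integrable_norm_sq (hD.memLp_sampleMean n)
  have hAi : Integrable A P :=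
    (hDi.div_const _).add ((integrable_finsetSum _ fun q _ => hTi q).div_const _)
  have hEA : ∫ ω, A ω ∂P ≤ s := by
    rw [hA]
    rw [integral_add (hDi.div_const _) ((integrable_finsetSum _ fun q _ => hTi q).div_const _),
      integral_div, integral_div, integral_finsetSum _ fun q _ => hTi q]
    have e1 : (∫ ω, ‖X ω - L fun q => T q ω‖ ^ 2 ∂P) / r ^ 2 ≤ s / 2 := by
      simp_rw [hDX]
      rw [div_le_iff₀ (by positivity)]
      exact (hD.integral_scaledMean_le n).trans (by rw [hη]; linarith)
    have e2 : (∑ q, ∫ ω, T q ω ^ 2 ∂P) / R ^ 2 ≤ C / R ^ 2 := by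
      gcongr
      refine (Finset.sum_le_sum fun q _ => hT2 q).trans (le_of_eq ?_)
      rw [Finset.sum_const, Finset.card_univ, nsmul_eq_mul]
    linarith
  have hsub : X ⁻¹' (Metric.cthickening r (L '' Metric.closedBall 0 R))ᶜ ⊆ {ω | 1 ≤ A ω} := by
    intro ω hω
    by_contra hlt
    have hlt : A ω < 1 := not_le.1 hlt
    refine hω ?_
    have p1 : 0 ≤ ‖X ω - L fun q => T q ω‖ ^ 2 / r ^ 2 := by positivity
    have p2 : 0 ≤ (∑ q, T q ω ^ 2) / R ^ 2 := by positivity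
    have hAω : A ω = ‖X ω - L fun q => T q ω‖ ^ 2 / r ^ 2 + (∑ q, T q ω ^ 2) / R ^ 2 := rfl
    have q1 : ‖X ω - L fun q => T q ω‖ ≤ r := by
      have : ‖X ω - L fun q => T q ω‖ ^ 2 / r ^ 2 ≤ 1 := by linarith
      rw [div_le_one (by positivity)] at this
      exact le_of_sq_le_sq this hr.le
    have q2 : ∀ q, |T q ω| ≤ R := fun q => by
      have h2 : (∑ q, T q ω ^ 2) / R ^ 2 ≤ 1 := by linarith
      rw [div_le_one (by positivity)] at h2
      have h3 := Finset.single_le_sum (f := fun q => T q ω ^ 2) (fun q _ => sq_nonneg _)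
        (Finset.mem_univ q)
      exact abs_le_of_sq_le_sq (h3.trans h2) hR0.le
    refine Metric.mem_cthickening_of_dist_le (X ω) (L fun q => T q ω) r _ ⟨_, ?_, rfl⟩ ?_
    · rw [mem_closedBall_zero_iff, pi_norm_le_iff_of_nonneg hR0.le]
      exact q2
    · rw [dist_eq_norm]
      exact q1
  dsimp only
  rw [coe_meanLaw, Measure.map_apply hXm Metric.isClosed_cthickening.measurableSet.compl]
  refine (measure_mono hsub).trans (le_trans ?_ hsε)
  have hm := mul_meas_ge_le_integral_of_nonneg (ae_of_all _ hA0) hAi 1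
  rw [one_mul] at hm
  rw [← ofReal_measureReal]
  exact ENNReal.ofReal_le_ofReal (hm.trans hEA)

end BootstrapLaw

/-! ### Metrics for weak convergence and measurability of the bootstrap distance -/

section Measurability

variable {H : Type*} [NormedAddCommGroup H] [InnerProductSpace ℝ H] [CompleteSpace H]
  [MeasurableSpace H] [BorelSpace H] [SecondCountableTopology H]

lemma continuous_scaled_bootDev (w : ℝ → ℝ) (k : ℕ) {b : ℕ} (hb : 1 ≤ b) (I : Draw k b) :
    Continuous fun y : ℕ → H => √((k * b : ℕ) : ℝ) • bootDev w k b y I := by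
  simp_rw [scaled_bootDev_eq w k hb, blockMean, blockSum]
  fun_prop

/-- The bootstrap law depends continuously on the data. -/
lemma continuous_bootLaw (w : ℝ → ℝ) (k : ℕ) {b : ℕ} (hb : 1 ≤ b) :
    Continuous fun y : ℕ → H => bootLaw w k b y := by
  refine continuous_iff_continuousAt.2 fun y => ?_
  refine ProbabilityMeasure.tendsto_iff_forall_integral_tendsto.2 fun g => ?_
  have hint : ∀ z : ℕ → H, ∫ v, g v ∂(bootLaw w k b z : Measure H)
      = ∫ I, g (√((k * b : ℕ) : ℝ) • bootDev w k b z I) ∂(drawLaw k b : Measure (Draw k b)) :=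
    fun z => integral_map Measurable.of_discrete.aemeasurable
      g.continuous.measurable.aestronglyMeasurable
  simp_rw [hint]
  have hc : Continuous fun z : ℕ → H =>
      ∫ I, g (√((k * b : ℕ) : ℝ) • bootDev w k b z I) ∂(drawLaw k b : Measure (Draw k b)) := by
    refine continuous_of_dominated (bound := fun _ => ‖g‖)
      (fun z => Measurable.of_discrete.aestronglyMeasurable)
      (fun z => ae_of_all _ fun I => g.norm_coe_le_norm _) (integrable_const _)
      (ae_of_all _ fun I => g.continuous.comp (continuous_scaled_bootDev w k hb I))
  exact hc.tendsto y

namespace MetrizesWeakConvergence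

variable {d : ProbabilityMeasure H → ProbabilityMeasure H → ℝ}

lemma nonneg (hd : MetrizesWeakConvergence d) (μ ν : ProbabilityMeasure H) : 0 ≤ d μ ν := by
  have h1 := hd.triangle μ ν μ
  rw [(hd.eq_zero_iff μ μ).2 rfl, hd.symm ν μ] at h1
  linarith

/-- The metric is tied to the weak topology through sequences only, but that topology is sequential.
Continuity gives measurability of the distance as a function of the data. -/
lemma continuous_left (hd : MetrizesWeakConvergence d) (ν : ProbabilityMeasure H) :
    Continuous fun μ => d μ ν := by
  refine SeqContinuous.continuous fun u μ hu => ?_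
  have h1 := (hd.tendsto_iff u μ).2 hu
  rw [tendsto_iff_norm_sub_tendsto_zero]
  refine squeeze_zero (fun j => norm_nonneg _) (fun j => ?_) h1
  rw [Function.comp_apply, Real.norm_eq_abs, abs_le]
  have h2 := hd.triangle (u j) μ ν
  have h3 := hd.triangle μ (u j) ν
  rw [hd.symm μ (u j)] at h3
  exact ⟨by linarith, by linarith⟩

lemma measurable_bootLaw (hd : MetrizesWeakConvergence d) {Ω : Type*} [MeasurableSpace Ω]
    {Y : ℤ → Ω → H} (hY : ∀ t, Measurable (Y t)) (w : ℝ → ℝ) (k : ℕ) {b : ℕ} (hb : 1 ≤ b)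
    (ν : ProbabilityMeasure H) : Measurable fun ω => d (bootLaw w k b (obs Y ω)) ν := by
  have h1 : Continuous fun y : ℕ → H => d (bootLaw w k b y) ν :=
    (hd.continuous_left ν).comp (continuous_bootLaw w k hb)
  exact h1.measurable.comp (measurable_pi_lambda _ fun t => hY t)

end MetrizesWeakConvergence

end Measurability

/-! ### Transfer to arbitrary metrics for weak convergence -/

section Consistency

variable {Ω S H : Type*} [MeasurableSpace Ω] [MeasurableSpace S] {P : Measure Ω}
  [IsProbabilityMeasure P] [NormedAddCommGroup H] [InnerProductSpace ℝ H] [CompleteSpace H]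
  [SecondCountableTopology H] [MeasurableSpace H] [BorelSpace H]
  {δ : ℤ → Ω → S} {f : (ℕ → S) → H} {Y : ℤ → Ω → H}

/-- The bootstrap law is consistent in every metric for weak convergence. -/
theorem StronglyApproximable.tendstoInMeasure_bootLaw (hdep : StronglyApproximable P Y f δ)
    (hmean : ∀ t, ∫ ω, Y t ω ∂P = 0) (hY : ∀ t, Measurable (Y t)) {w : ℝ → ℝ}
    (hw : IsTaper w) {k b : ℕ → ℕ} (hkb : BlockRegime k b)
    {d : ProbabilityMeasure H → ProbabilityMeasure H → ℝ} (hd : MetrizesWeakConvergence d) :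
    TendstoInMeasure P (fun j ω => d (bootLaw w (k j) (b j) (obs Y ω))
      (meanLaw P Y hY (k j * b j))) atTop (fun _ => 0) := by
  have hmeas : ∀ j, AEStronglyMeasurable (fun ω => d (bootLaw w (k j) (b j) (obs Y ω))
      (meanLaw P Y hY (k j * b j))) P := fun j =>
    (hd.measurable_bootLaw hY w (k j) (hkb.one_le_b j) _).aestronglyMeasurable
  have hlp := hdep.tendsto_measure_lpDist hmean hY hw hkb
  -- Prokhorov's theorem.
  have hcomp : IsCompact (closure (Set.range fun n => meanLaw P Y hY n)) := by
    refine isCompact_closure_of_isTightMeasureSet ?_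
    refine (hdep.isTightMeasureSet_meanLaw hmean hY).subset ?_
    rintro _ ⟨_, ⟨n, rfl⟩, rfl⟩
    exact ⟨n, rfl⟩
  -- Subsequence criterion: every subsequence must have a further one with almost sure convergence.
  -- A first extraction makes the laws of the means converge, a second makes the Lévy–Prokhorov
  -- distance tend to zero almost surely.
  rw [exists_seq_tendstoInMeasure_atTop_iff hmeas]
  intro ns hns
  obtain ⟨ν, -, φ, hφ, hν⟩ := hcomp.tendsto_subseq
    (x := fun i => meanLaw P Y hY (k (ns i) * b (ns i))) fun i => subset_closure ⟨_, rfl⟩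
  obtain ⟨χ, hχ, hae⟩ :=
    (hlp.comp (hns.comp hφ).tendsto_atTop).exists_seq_tendsto_ae
  refine ⟨φ ∘ χ, hφ.comp hχ, ?_⟩
  have hM : Tendsto (fun i => meanLaw P Y hY (k (ns (φ (χ i))) * b (ns (φ (χ i))))) atTop (𝓝 ν) :=
    hν.comp hχ.tendsto_atTop
  filter_upwards [hae] with ω hω
  set L : ℕ → ProbabilityMeasure H := fun i =>
    bootLaw w (k (ns (φ (χ i)))) (b (ns (φ (χ i)))) (obs Y ω) with hL
  set M : ℕ → ProbabilityMeasure H := fun i =>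
    meanLaw P Y hY (k (ns (φ (χ i))) * b (ns (φ (χ i)))) with hMdef
  have hL1 : Tendsto L atTop (𝓝 ν) := by
    rw [← tendsto_lpDist_iff]
    have h1 : Tendsto (fun i => lpDist (L i) (M i) + lpDist (M i) ν) atTop (𝓝 (0 + 0)) :=
      Tendsto.add hω (tendsto_lpDist_iff.2 hM)
    rw [add_zero] at h1
    exact squeeze_zero (fun i => lpDist_nonneg _ _) (fun i => lpDist_triangle _ _ _) h1
  have h2 : Tendsto (fun i => d (L i) ν + d (M i) ν) atTop (𝓝 (0 + 0)) :=
    ((hd.tendsto_iff L ν).2 hL1).add ((hd.tendsto_iff M ν).2 hM)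
  rw [add_zero] at h2
  refine squeeze_zero (fun i => hd.nonneg _ _) (fun i => ?_) h2
  have h3 := hd.triangle (L i) ν (M i)
  rwa [hd.symm ν (M i)] at h3

end Consistency

/-- With `n = k * b`, the ratio `√b / √k` is exactly `b / √n`; the condition `b < n` excludes `k =
0`. -/
lemma BlockRegime.of_rate {n k b : ℕ → ℕ} (hn : ∀ j, n j = k j * b j)
    (hb : ∀ j, 1 ≤ b j ∧ b j < n j)
    (hrate : Tendsto (fun j => (b j : ℝ)⁻¹ + (b j : ℝ) / √(n j : ℝ)) atTop (𝓝 0)) :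
    BlockRegime k b where
  one_le_k j := by
    by_contra h
    have h1 := (hb j).2
    rw [hn, Nat.lt_one_iff.1 (not_le.1 h)] at h1
    simp at h1
  one_le_b j := (hb j).1
  tendsto_b := by
    have h1 : Tendsto (fun j => (b j : ℝ)⁻¹) atTop (𝓝 0) :=
      squeeze_zero (fun j => by positivity)
        (fun j => le_add_of_nonneg_right (by positivity)) hrate
    have h2 : Tendsto (fun j => (b j : ℝ)⁻¹) atTop (𝓝[>] 0) :=
      tendsto_nhdsWithin_iff.2 ⟨h1, Eventually.of_forall fun j => by
        have : (0 : ℝ) < b j := by exact_mod_cast (hb j).1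
        simpa using this⟩
    exact tendsto_natCast_atTop_iff.1 (h2.inv_tendsto_nhdsGT_zero.congr fun j => by simp)
  tendsto_ratio := by
    refine squeeze_zero (fun j => by positivity) (fun j => ?_) hrate
    have hb0 : (0 : ℝ) < b j := by exact_mod_cast (hb j).1
    have h1 : √(b j : ℝ) / √(k j) = (b j : ℝ) / √(n j : ℝ) := by
      rw [hn, Nat.cast_mul, mul_comm, Real.sqrt_mul hb0.le, ← div_div, Real.div_sqrt]
    rw [h1]
    exact le_add_of_nonneg_left (by positivity)

end TBB

theorem theorem2p2
    {H : Type*} [NormedAddCommGroup H] [InnerProductSpace ℝ H] [CompleteSpace H]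
    [SecondCountableTopology H] [MeasurableSpace H] [BorelSpace H]
    {Ω : Type*} [MeasurableSpace Ω] (P : Measure Ω) [IsProbabilityMeasure P]
    {S : Type*} [MeasurableSpace S]
    (Y : ℤ → Ω → H) (hY : ∀ t, Measurable (Y t)) (hmean : ∀ t, ∫ ω, Y t ω ∂P = 0)
    (f : (ℕ → S) → H) (δ : ℤ → Ω → S) (hdep : TBB.StronglyApproximable P Y f δ)
    (w : ℝ → ℝ) (hw : TBB.IsTaper w)
    (n k b : ℕ → ℕ) (hn : ∀ j, n j = k j * b j) (hb : ∀ j, 1 ≤ b j ∧ b j < n j)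
    (hn_top : Tendsto n atTop atTop)
    (hrate : Tendsto (fun j => (b j : ℝ)⁻¹ + (b j : ℝ) / √(n j : ℝ)) atTop (𝓝 0)) :
    (∀ d : ProbabilityMeasure H → ProbabilityMeasure H → ℝ, TBB.MetrizesWeakConvergence d →
      TendstoInMeasure P
        (fun j ω => d (TBB.bootLaw w (k j) (b j) (TBB.obs Y ω)) (TBB.meanLaw P Y hY (n j)))
        atTop (fun _ => 0)) ∧
    (∀ {ι : Type*} (e : HilbertBasis ι ℝ H),
      ∀ ε : ℝ≥0∞, 0 < ε →
        Tendsto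
          (fun j => P {ω | ε ≤ TBB.hsNorm e
            (TBB.bootCov w (k j) (b j) (TBB.obs Y ω) - TBB.meanCov P Y (n j))})
          atTop (𝓝 0)) := by
  have hkb := TBB.BlockRegime.of_rate hn hb hrate
  obtain rfl : n = fun j => k j * b j := funext hn
  exact ⟨fun d hd => hdep.tendstoInMeasure_bootLaw hmean hY hw hkb hd,
    fun e ε hε => hdep.tendsto_measure_hsNorm_bootCov_sub e hmean hw hkb hε⟩
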